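/- **Setting.** Let $\psi:\mathbb R\to[0,\infty)$ be $L$-Lipschitz, $b:\mathbb R\to[0,\infty)$ Borel, and $\nu$ a probability measure on $\mathbb R$ with $\mathbb E|Y|<\infty$ and $\mathbb E[b(Y)]<\infty$ for $Y\sim\nu$. Let $P$ be a Poisson random measure on $\mathbb R_+^2\times\mathbb R$ with intensity $\mathrm ds\,\mathrm d\theta\,\nu(\mathrm dy)$ and natural filtration $\mathcal F$. For $T>0$ and $h\in L^1([0,T])$ put $$\rho_h=L\,\mathbb E[b(Y)]\int_0^T|h(t)|\,\mathrm dt .$$ The continuous stability condition is $\rho_h<1$. Let $\lambda$ be an $\mathcal F$-predictable process such that $P$ has almost surely finitely many points $(s,\theta,y)$ with $s\in(0,T]$, $\theta\le\lambda_s$, and, almost surely for all $t\in[0,T]$, $$\lambda_t=\psi\Big(\int_{[0,t)\times\mathbb R_+\times\mathbb R}h(t-s)\mathbf 1_{\theta\le\lambda_s}b(y)\,P(\mathrm ds,\mathrm d\theta,\mathrm dy)\Big),$$ and let $R_t=\int_{(0,t]\times\mathbb R_+\times\mathbb R}y\,\mathbf 1_{\theta\le\lambda_s}P(\mathrm ds,\mathrm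 d\theta,\mathrm dy)$ be the Hawkes risk process. For an integer $M\ge1$ let $\Delta=T/M$, $(t)_\Delta=\lfloor t/\Delta\rfloor\Delta$, and for $n\ge 1$ $$l_n=\psi\Big(\sum_{k=1}^{n-1}h((n-k)\Delta)X_k\Big),\qquad X_n=\int_{((n-1)\Delta,n\Delta]\times\mathbb R_+\times\mathbb R}b(y)\mathbf 1_{\theta\le l_n}\,P(\mathrm ds,\mathrm d\theta,\mathrm dy),$$ $$R^\Delta_t=\sum_{k=1}^{\lfloor t/\Delta\rfloor}\int_{((k-1)\Delta,k\Delta]\times\mathbb R_+\times\mathbb R}y\,\mathbf 1_{\theta\le l_k}P(\mathrm ds,\mathrm d\theta,\mathrm dy),\qquad \rho_{h,\Delta}=L\,\mathbb E[b(Y)]\sum_{k=1}^M|h(k\Delta)|\Delta .$$ The discrete stability condition is $\rho_{h,\Delta}<1$. Put $$C_R(h,\Delta)=\int_0^\Delta|h(y)|\,\mathrm dy+\sup_{\epsilon\in[0,\Delta]}\int_0^{T-\Delta}|h(y+\epsilon)-h(y)|\,\mathrm dy+\int_0^{T-\Delta}|h(y)-h((y)_\Delta+\Delta)|\,\mathrm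 dy .$$ Write $\|h\|_\infty=\sup_{[0,T]}|h|$; $\|h\|_{p\text{-var}}=\big(\sup\sum_i|h(t_{i+1})-h(t_i)|^p\big)^{1/p}$, the supremum being over all subdivisions of $[0,T]$; and, for $0<\eta<1$, $$\|u\|_{W^\eta_T}=\int_0^T|u(t)|\,\mathrm dt+\int_0^T\!\!\int_0^T\frac{|u(t)-u(s)|}{|t-s|^{1+\eta}}\,\mathrm dt\,\mathrm ds .$$ **Statement.** (i) There is a constant $K>0$, independent of $T$, $\Delta$, $p$ and $h$, such that whenever $T>0$, $p\ge1$, $\rho_h<1$ and $\|h\|_{p\text{-var}}<\infty$, we have $$\lim_{\delta\to0^+}\int_0^{T-\delta}|h(t)-h((t)_\delta+\delta)|\,\mathrm dt=0,$$ and, for all sufficiently small $\Delta=T/M$, both $\rho_{h,\Delta}<1$ and $$C_R(h,\Delta)\le K\Big[\|h\|_{p\text{-var}}T^{\frac{p-1}p}\Delta^{\frac1p}+\Delta\|h\|_\infty\Big].$$ (ii) Let $r<1$, $0<\eta<1$ and $T_0>0$. There is a constant $K_\eta>0$, depending only on $\eta,L,\psi,b,\nu,r,T_0$ (not on $T$,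 $\Delta$, $p$ or $h$), such that whenever $T\ge T_0$, $p\ge1$, $\rho_h\le r$ and $\|h\|_{p\text{-var}}<\infty$, for all sufficiently small $\Delta=T/M$, $$\mathbb E\|R-R^\Delta\|_{W^\eta_T}\le K_\eta\Big[\|h\|_{p\text{-var}}T^{\frac{3p-1}p}\Delta^{\frac1p}+T\Delta^{1-\eta}+\Delta\|h\|_\infty\Big].$$ In both parts, how small $\Delta$ must be may depend on all the data, including $T,h,p$. -/

import Mathlib

open MeasureTheory ProbabilityTheory Set Filter Topology
open scoped NNReal ENNReal

noncomputable section

namespace HawkesRisk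

/-- The state space of the driving random measure: points `z = (s, θ, y)` with
`s` a time, `θ` a thinning height and `y` a mark. -/
abbrev State : Type := ℝ≥0 × ℝ≥0 × ℝ

/-- Lebesgue measure on `ℝ₊ = [0, ∞)`. -/
def lebesgueNN : Measure ℝ≥0 := ((volume : Measure ℝ).restrict (Ici 0)).map Real.toNNReal

/-- The intensity measure `ds dθ ν(dy)`. -/
def intensityMeasure (ν : Measure ℝ) : Measure State := lebesgueNN.prod (lebesgueNN.prod ν)

variable {Ω : Type*} [mΩ : MeasurableSpace Ω]

/-- `P` is a Poisson random measure on `ℝ₊ × ℝ₊ × ℝ` with intensity `ds dθ ν(dy)`. -/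
structure IsPoissonRandomMeasure (P : Kernel Ω State) (ν : Measure ℝ) (μ : Measure Ω) :
    Prop where
  locallyFinite : ∀ (ω : Ω) (n : ℕ), P ω (Iic (n : ℝ≥0) ×ˢ (Iic (n : ℝ≥0) ×ˢ univ)) < ⊤
  law : ∀ B : Set State, MeasurableSet B →
    intensityMeasure ν B ≠ ⊤ →
    μ.map (fun ω => P ω B) =
      (poissonMeasure (intensityMeasure ν B).toNNReal).map (fun n : ℕ => (n : ℝ≥0∞))
  indep : ∀ (n : ℕ) (B : Fin n → Set State), (∀ i, MeasurableSet (B i)) →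
    Pairwise (fun i j => Disjoint (B i) (B j)) → iIndepFun (fun i ω => P ω (B i)) μ

/-- The filtration of the random measure: `𝓕 t` is generated by the variables `P (A × S)`
with `A ⊆ (0, t]` and `S ⊆ ℝ₊ × ℝ` Borel. -/
def poissonFiltration (P : Kernel Ω State) : Filtration ℝ≥0 mΩ where
  seq t := ⨆ (A : Set ℝ≥0) (S : Set (ℝ≥0 × ℝ)) (_ : MeasurableSet A) (_ : MeasurableSet S)
    (_ : A ⊆ Ioc 0 t), MeasurableSpace.comap (fun ω => P ω (A ×ˢ S)) inferInstance
  mono' := fun _ _ hst => iSup_le fun A => iSup_le fun S => iSup_le fun hA => iSup_le fun hS =>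
    iSup_le fun hsub =>
      le_iSup_of_le A <| le_iSup_of_le S <| le_iSup_of_le hA <| le_iSup_of_le hS <|
        le_iSup_of_le (hsub.trans (Ioc_subset_Ioc_right hst)) le_rfl
  le' := fun _ => iSup_le fun _ => iSup_le fun _ => iSup_le fun hA => iSup_le fun hS =>
    iSup_le fun _ => (Kernel.measurable_coe P (hA.prod hS)).comap_le

/-- `lam` is the intensity on `[0, T]` of the marked Hawkes process with kernel `h`, jump rate `ψ`
and marks modulation `b`, obtained by thinning the random measure `P`: it is predictable, it
accepts almost surely finitely many points on `(0, T]`, and almost surely, for all `t ∈ [0, T]`,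
`lam t = ψ (∫_{[0,t) × ℝ₊ × ℝ} h (t - s) 1_{θ ≤ lam s} b y P(ds, dθ, dy))`. -/
structure IsHawkesIntensity (P : Kernel Ω State) (μ : Measure Ω) (h ψ b : ℝ → ℝ) (T : ℝ)
    (lam : ℝ≥0 → Ω → ℝ) : Prop where
  predictable : IsStronglyPredictable (poissonFiltration P) lam
  finite_jumps : ∀ᵐ ω ∂μ,
    P ω {z : State | 0 < z.1 ∧ (z.1 : ℝ) ≤ T ∧ (z.2.1 : ℝ) ≤ lam z.1 ω} < ⊤
  intensity_eq : ∀ᵐ ω ∂μ, ∀ t : ℝ≥0, (t : ℝ) ≤ T →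
    lam t ω = ψ (∫ z in {z : State | z.1 < t ∧ (z.2.1 : ℝ) ≤ lam z.1 ω},
      h ((t : ℝ) - (z.1 : ℝ)) * b z.2.2 ∂(P ω))

/-- The continuous-time risk process
`R t = ∫_{(0,t] × ℝ₊ × ℝ} y 1_{θ ≤ lam s} P(ds, dθ, dy)`. -/
def risk (P : Kernel Ω State) (lam : ℝ≥0 → Ω → ℝ) (t : ℝ) (ω : Ω) : ℝ :=
  ∫ z in {z : State | 0 < z.1 ∧ (z.1 : ℝ) ≤ t ∧ (z.2.1 : ℝ) ≤ lam z.1 ω}, z.2.2 ∂(P ω)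

/-- The points of the `k`-th time bin `((k-1)Δ, kΔ]` lying below height `l`. -/
def binBelow (Δ : ℝ) (k : ℕ) (l : ℝ) : Set State :=
  {z : State | ((k : ℝ) - 1) * Δ < (z.1 : ℝ) ∧ (z.1 : ℝ) ≤ (k : ℝ) * Δ ∧ (z.2.1 : ℝ) ≤ l}

/-- The discrete intensities `l n = ψ (∑_{k=1}^{n-1} h ((n-k)Δ) X k)`, where
`X k = ∫_{((k-1)Δ, kΔ] × ℝ₊ × ℝ} b y 1_{θ ≤ l k} P(ds, dθ, dy)`
(so that `l 0 = l 1 = ψ 0`). -/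
def discIntensity (P : Kernel Ω State) (h ψ b : ℝ → ℝ) (Δ : ℝ) (ω : Ω) (n : ℕ) : ℝ :=
  ψ (∑ k : Fin n, if (k : ℕ) = 0 then 0 else
    h (((n : ℝ) - ((k : ℕ) : ℝ)) * Δ) *
      ∫ z in binBelow Δ k (discIntensity P h ψ b Δ ω k), b z.2.2 ∂(P ω))
termination_by n
decreasing_by exact k.2

/-- The discrete-time risk process: with `n_t = ⌊t / Δ⌋`,
`R^Δ t = ∑_{k=1}^{n_t} ∫_{((k-1)Δ, kΔ] × ℝ₊ × ℝ} y 1_{θ ≤ l k} P(ds, dθ, dy)`. -/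
def discRisk (P : Kernel Ω State) (h ψ b : ℝ → ℝ) (Δ t : ℝ) (ω : Ω) : ℝ :=
  ∑ k ∈ Finset.Icc 1 ⌊t / Δ⌋₊,
    ∫ z in binBelow Δ k (discIntensity P h ψ b Δ ω k), z.2.2 ∂(P ω)

/-- `ρ_h = L ‖h‖_{L¹([0,T])} 𝔼[b(Y)]`, where `Y` has law `ν`. -/
def rho (L : ℝ≥0) (h b : ℝ → ℝ) (ν : Measure ℝ) (T : ℝ) : ℝ :=
  (L : ℝ) * (∫ t in Icc 0 T, |h t|) * ∫ y, b y ∂ν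

/-- `ρ_{h,Δ} = L ∑_{k=1}^M |h(kΔ)| Δ 𝔼[b(Y)]`, where `Δ = T / M`. -/
def rhoDisc (L : ℝ≥0) (h b : ℝ → ℝ) (ν : Measure ℝ) (T : ℝ) (M : ℕ) : ℝ :=
  (L : ℝ) * (∑ k ∈ Finset.Icc 1 M, |h ((k : ℝ) * (T / M))| * (T / M)) * ∫ y, b y ∂ν

/-- The projection `(t)_Δ = ⌊t / Δ⌋ Δ` on the time grid. -/
def gridProj (Δ t : ℝ) : ℝ := (⌊t / Δ⌋ : ℝ) * Δ

/-- The regularity functional `C_R(h, Δ)` of the kernel. -/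
def CR (h : ℝ → ℝ) (T Δ : ℝ) : ℝ :=
  (∫ y in (0 : ℝ)..Δ, |h y|)
    + (⨆ ε : Icc (0 : ℝ) Δ, ∫ y in (0 : ℝ)..(T - Δ), |h (y + (ε : ℝ)) - h y|)
    + ∫ y in (0 : ℝ)..(T - Δ), |h y - h (gridProj Δ y + Δ)|

/-- The `p`-th power of the `p`-variation of `f` on `[0, T]`: the supremum of
`∑ |f(t_{i+1}) - f(t_i)|^p` over all finite subdivisions of `[0, T]`. -/
def ePVar (p : ℝ) (f : ℝ → ℝ) (T : ℝ) : ℝ≥0∞ :=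
  ⨆ q : ℕ × {u : ℕ → ℝ // Monotone u ∧ ∀ i, u i ∈ Icc (0 : ℝ) T},
    ∑ i ∈ Finset.range q.1, ENNReal.ofReal (|f (q.2.1 (i + 1)) - f (q.2.1 i)| ^ p)

/-- The `p`-variation `‖f‖_{p-var}` on `[0, T]` (meaningful when `ePVar p f T ≠ ⊤`). -/
def pVarNorm (p : ℝ) (f : ℝ → ℝ) (T : ℝ) : ℝ := (ePVar p f T).toReal ^ (1 / p)

/-- `‖f‖_∞ = sup_{t ∈ [0, T]} |f t|`. -/
def supNorm (f : ℝ → ℝ) (T : ℝ) : ℝ := ⨆ t : Icc (0 : ℝ) T, |f t|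

/-- The norm of the fractional Sobolev space `W^{η,1}` on `[0, T]`. -/
def sobolevNorm (η T : ℝ) (u : ℝ → ℝ) : ℝ≥0∞ :=
  (∫⁻ t in Icc 0 T, ENNReal.ofReal |u t|)
    + ∫⁻ s in Icc 0 T, ∫⁻ t in Icc 0 T, ENNReal.ofReal (|u t - u s| / |t - s| ^ (1 + η))

end HawkesRisk

end

/-!
Error of the time discretization of a marked Hawkes process and its risk process, for kernels of
finite `p`-variation.

*Regularity of the kernel.* If `‖h‖_{p-var} < ∞`, the running `p`-variation is a bounded monotone
function `v` with `|h t - h s| ^ p ≤ v t - v s` (`exists_monotone_control`). By Hölder, integrals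
such as `∫ |h (y + ε) - h y| dy` reduce to the integral of the increments of `v` over windows of
length `Δ`, which telescopes to a multiple of `Δ ‖h‖_{p-var} ^ p` (`lintegral_abs_le_of_control`).
This gives the bound `CR_le` on the regularity functional, the limit `tendsto_integral_grid`, and
the convergence of Riemann sums that yields the discrete stability condition (`exists_rhoDisc_lt`).

*Campbell's formula.* For predictable integrands, integrals against the Poisson random measure have
the same mean as integrals against its intensity (`IsPoissonRandomMeasure.campbell`): restricted to
a box both sides are finite measures on the product of the predictable σ-algebra with the Borel sets
of `ℝ₊ × ℝ`, and they agree on the generating rectangles because the future of the random measure is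
independent of its past. Consequently the points below a predictable height `X` arrive at rate `X⁺`,
and those on which two heights `X`, `Y` disagree at rate at most `|X - Y|`
(`IsPoissonRandomMeasure.lintegral_below`, `IsPoissonRandomMeasure.lintegral_disagree_le`).

*Intensities.* The Lipschitz property turns the equation of the intensity into a renewal inequality
for its mean, with constant `ρ < 1`, whence `𝔼 λ_s ≤ ψ(0) / (1 - ρ)`
(`IsHawkesIntensity.lintegral_le`). Absorbing the right-hand side requires a mean that is finite
beforehand, so the intensity is first killed when the accepted mark mass exceeds `n`. The discrete
intensities, spread over their time bins as a predictable step process, obey the same bound, and the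
mean distance of the two processes obeys a renewal inequality whose inhomogeneity is the `L¹`
distance of `h` from its grid version (`IsHawkesIntensity.lintegral_abs_sub_stepIntensity_le`).

*Risk processes.* The difference of the two risk processes is a superposition of step functions of
time, one for each point `z = (s, θ, y)`. A point accepted by only one of the thinnings contributes
`± y` from `s` on; a point accepted by the discrete thinning is moreover delayed to the end of its
time bin, which costs the indicator of an interval of length at most `Δ`. The fractional Sobolev
norm of the indicator of an interval of length `ℓ` is of order `ℓ + ℓ ^ (1 - η)`
(`sobolevNorm_indicator_le`). Minkowski's inequality and Campbell's formula therefore bound the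
error by the mean distance of the intensities plus a term of order `T Δ ^ (1 - η)`
(`lintegral_sobolevNorm_risk_sub_le`).
-/

namespace HawkesRisk

/-! ### Functions of finite `p`-variation -/

theorem ePVar_mono (p : ℝ) (h : ℝ → ℝ) {s t : ℝ} (hst : s ≤ t) : ePVar p h s ≤ ePVar p h t := by
  refine iSup_le fun q => ?_
  exact le_iSup_of_le (⟨q.1, q.2.1, q.2.2.1, fun i => ⟨(q.2.2.2 i).1, (q.2.2.2 i).2.trans hst⟩⟩ :
    ℕ × {u : ℕ → ℝ // Monotone u ∧ ∀ i, u i ∈ Icc (0 : ℝ) t}) le_rfl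

/-- Superadditivity of the `p`-th power of the `p`-variation, for one extra increment: a subdivision
of `[0, s]` is prolonged by the points `s` and `t`. -/
theorem ePVar_add_le (p : ℝ) (h : ℝ → ℝ) {s t : ℝ} (hs : 0 ≤ s) (hst : s ≤ t) :
    ePVar p h s + ENNReal.ofReal (|h t - h s| ^ p) ≤ ePVar p h t := by
  have : Nonempty (ℕ × {u : ℕ → ℝ // Monotone u ∧ ∀ i, u i ∈ Icc (0 : ℝ) s}) :=
    ⟨0, fun _ => 0, monotone_const, fun _ => ⟨le_rfl, hs⟩⟩
  rw [ePVar, ENNReal.iSup_add]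
  refine iSup_le fun ⟨n, u, hu, hmem⟩ => ?_
  let w : ℕ → ℝ := fun i => if i ≤ n then u i else if i = n + 1 then s else t
  have hw : Monotone w := by
    refine monotone_nat_of_le_succ fun i => ?_
    simp only [w]
    split_ifs <;> first | omega | exact hu (Nat.le_succ i) | exact (hmem _).2 | exact hst | exact le_rfl
  have hwm : ∀ i, w i ∈ Icc (0 : ℝ) t := by
    intro i
    simp only [w]
    split_ifs
    · exact ⟨(hmem i).1, (hmem i).2.trans hst⟩
    · exact ⟨hs, hst⟩
    · exact ⟨hs.trans hst, le_rfl⟩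
  refine le_trans ?_ (le_iSup_of_le (⟨n + 2, w, hw, hwm⟩ :
    ℕ × {u : ℕ → ℝ // Monotone u ∧ ∀ i, u i ∈ Icc (0 : ℝ) t}) le_rfl)
  simp only
  rw [Finset.sum_range_succ, Finset.sum_range_succ]
  have h1 : ∑ i ∈ Finset.range n, ENNReal.ofReal (|h (w (i + 1)) - h (w i)| ^ p)
      = ∑ i ∈ Finset.range n, ENNReal.ofReal (|h (u (i + 1)) - h (u i)| ^ p) := by
    refine Finset.sum_congr rfl fun i hi => ?_
    have := Finset.mem_range.1 hi
    simp only [w, if_pos (show i + 1 ≤ n by omega), if_pos (show i ≤ n by omega)]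
  have h2 : w (n + 1 + 1) = t := by simp [w]
  have h3 : w (n + 1) = s := by simp [w]
  rw [h1, h2, h3]
  gcongr
  exact le_self_add

/-- A function of finite `p`-variation has a monotone control: the increments of the running
`p`-variation dominate the `p`-th powers of its increments. The control is extended to the whole
line by constants. -/
theorem exists_monotone_control {p : ℝ} {h : ℝ → ℝ} {T : ℝ} (hT : 0 ≤ T)
    (hV : ePVar p h T ≠ ⊤) :
    ∃ v : ℝ → ℝ, Monotone v ∧ (∀ x, 0 ≤ v x ∧ v x ≤ (ePVar p h T).toReal) ∧
      ∀ s t, 0 ≤ s → s ≤ t → t ≤ T → |h t - h s| ^ p ≤ v t - v s := by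
  have hfin : ∀ t, t ≤ T → ePVar p h t ≠ ⊤ := fun t ht => ne_top_of_le_ne_top hV (ePVar_mono p h ht)
  refine ⟨fun t => (ePVar p h (max 0 (min t T))).toReal, ?_, ?_, ?_⟩
  · intro s t hst
    refine ENNReal.toReal_mono (hfin _ (by simp [hT])) (ePVar_mono p h ?_)
    gcongr
  · exact fun x => ⟨ENNReal.toReal_nonneg, ENNReal.toReal_mono hV (ePVar_mono p h (by simp [hT]))⟩
  · intro s t hs hst ht
    have e1 : max 0 (min s T) = s := by rw [min_eq_left (hst.trans ht), max_eq_right hs]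
    have e2 : max 0 (min t T) = t := by rw [min_eq_left ht, max_eq_right (hs.trans hst)]
    simp only [e1, e2]
    have h1 := ENNReal.toReal_mono (hfin t ht) (ePVar_add_le p h hs hst)
    rw [ENNReal.toReal_add (hfin s (hst.trans ht)) ENNReal.ofReal_ne_top,
      ENNReal.toReal_ofReal (Real.rpow_nonneg (abs_nonneg _) _)] at h1
    linarith

theorem abs_sub_rpow_le_of_control {p : ℝ} {h v : ℝ → ℝ} {T : ℝ} (hv : Monotone v)
    (hc : ∀ s t, 0 ≤ s → s ≤ t → t ≤ T → |h t - h s| ^ p ≤ v t - v s) {s t x y : ℝ}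
    (hs : s ∈ Icc 0 T) (ht : t ∈ Icc 0 T) (hxs : x ≤ s) (hxt : x ≤ t) (hsy : s ≤ y) (hty : t ≤ y) :
    |h s - h t| ^ p ≤ v y - v x := by
  rcases le_total s t with hst | hst
  · rw [abs_sub_comm]
    linarith [hc s t hs.1 hst ht.2, hv hty, hv hxs]
  · linarith [hc t s ht.1 hst hs.2, hv hsy, hv hxt]

theorem abs_le_of_control {p : ℝ} (hp : 1 ≤ p) {h v : ℝ → ℝ} {T V : ℝ}
    (hvb : ∀ x, 0 ≤ v x ∧ v x ≤ V)
    (hc : ∀ s t, 0 ≤ s → s ≤ t → t ≤ T → |h t - h s| ^ p ≤ v t - v s) {t : ℝ}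
    (ht : t ∈ Icc 0 T) : |h t| ≤ |h 0| + V ^ (1 / p) := by
  have h1 : |h t - h 0| ^ p ≤ V := by linarith [hc 0 t le_rfl ht.1 ht.2, (hvb t).2, (hvb 0).1]
  have h2 : |h t - h 0| ≤ V ^ (1 / p) := by
    have := Real.rpow_le_rpow (by positivity) h1 (show 0 ≤ 1 / p by positivity)
    rwa [← Real.rpow_mul (abs_nonneg _), mul_one_div_cancel (by linarith), Real.rpow_one] at this
  have := abs_sub_abs_le_abs_sub (h t) (h 0)
  linarith

theorem bddAbove_abs_of_ePVar {p : ℝ} (hp : 1 ≤ p) {h : ℝ → ℝ} {T : ℝ} (hT : 0 ≤ T)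
    (hV : ePVar p h T ≠ ⊤) : BddAbove (range fun t : Icc (0 : ℝ) T => |h t|) := by
  obtain ⟨v, -, hvb, hc⟩ := exists_monotone_control hT hV
  refine ⟨|h 0| + (ePVar p h T).toReal ^ (1 / p), ?_⟩
  rintro _ ⟨t, rfl⟩
  exact abs_le_of_control hp hvb hc t.2

theorem abs_le_supNorm {p : ℝ} (hp : 1 ≤ p) {h : ℝ → ℝ} {T : ℝ} (hT : 0 ≤ T)
    (hV : ePVar p h T ≠ ⊤) {t : ℝ} (ht : t ∈ Icc 0 T) : |h t| ≤ supNorm h T :=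
  le_ciSup (bddAbove_abs_of_ePVar hp hT hV) ⟨t, ht⟩

theorem supNorm_nonneg (h : ℝ → ℝ) (T : ℝ) : 0 ≤ supNorm h T :=
  Real.iSup_nonneg fun _ => abs_nonneg _

theorem pVarNorm_nonneg (p : ℝ) (h : ℝ → ℝ) (T : ℝ) : 0 ≤ pVarNorm p h T :=
  Real.rpow_nonneg ENNReal.toReal_nonneg _

/-- A real function continuous off a countable set is Borel measurable. -/
theorem measurable_of_countable_not_continuousAt {f : ℝ → ℝ}
    (hf : {x | ¬ContinuousAt f x}.Countable) : Measurable f := by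
  refine measurable_of_Ioi fun a => ?_
  have : f ⁻¹' Ioi a = interior (f ⁻¹' Ioi a) ∪ (f ⁻¹' Ioi a ∩ {x | ¬ContinuousAt f x}) := by
    ext x
    constructor
    · intro hx
      by_cases hc : ContinuousAt f x
      · exact Or.inl (mem_interior_iff_mem_nhds.2 (hc (Ioi_mem_nhds hx)))
      · exact Or.inr ⟨hx, hc⟩
    · rintro (hx | hx)
      · exact interior_subset hx
      · exact hx.1
  rw [this]
  exact isOpen_interior.measurableSet.union (hf.mono inter_subset_right).measurableSet

theorem measurable_indicator_of_ePVar {p : ℝ} (hp : 1 ≤ p) {h : ℝ → ℝ} {T : ℝ} (hT : 0 ≤ T)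
    (hV : ePVar p h T ≠ ⊤) : Measurable ((Icc 0 T).indicator h) := by
  obtain ⟨v, hv, -, hc⟩ := exists_monotone_control hT hV
  refine measurable_of_countable_not_continuousAt
    (((hv.countable_not_continuousAt).union (countable_singleton 0 |>.union
      (countable_singleton T))).mono fun x hx => ?_)
  by_contra hcon
  simp only [mem_union, mem_ofPred_eq, not_or, not_not, mem_singleton_iff] at hcon
  obtain ⟨hvx, hx0, hxT⟩ := hcon
  apply hx
  by_cases hxm : x ∈ Icc 0 T
  · have hxo : x ∈ Ioo 0 T := ⟨lt_of_le_of_ne hxm.1 (Ne.symm hx0), lt_of_le_of_ne hxm.2 hxT⟩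
    have hnb : ∀ᶠ y in 𝓝 x, y ∈ Ioo 0 T := Ioo_mem_nhds hxo.1 hxo.2
    have hEq : (Icc 0 T).indicator h =ᶠ[𝓝 x] h := by
      filter_upwards [hnb] with y hy
      exact indicator_of_mem (Ioo_subset_Icc_self hy) h
    refine ContinuousAt.congr ?_ hEq.symm
    rw [ContinuousAt, tendsto_iff_norm_sub_tendsto_zero]
    have hlim : Tendsto (fun y => |v y - v x| ^ (1 / p)) (𝓝 x) (𝓝 0) := by
      have h1 : Tendsto (fun y => |v y - v x|) (𝓝 x) (𝓝 0) := by
        have := (hvx.tendsto.sub_const (v x)).abs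
        simpa using this
      have h2 := h1.rpow_const (p := 1 / p) (Or.inr (by positivity))
      rwa [Real.zero_rpow (by positivity)] at h2
    refine squeeze_zero' (Eventually.of_forall fun y => norm_nonneg _) ?_ hlim
    filter_upwards [hnb] with y hy
    have h3 : |h y - h x| ^ p ≤ |v y - v x| := by
      rcases le_total x y with hxy | hxy
      · exact (hc x y hxm.1 hxy hy.2.le).trans (le_abs_self _)
      · rw [abs_sub_comm, abs_sub_comm (v y)]
        exact (hc y x hy.1.le hxy hxm.2).trans (le_abs_self _)
    have := Real.rpow_le_rpow (by positivity) h3 (show 0 ≤ 1 / p by positivity)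
    rwa [← Real.rpow_mul (abs_nonneg _), mul_one_div_cancel (by linarith), Real.rpow_one] at this
  · have hnb : ∀ᶠ y in 𝓝 x, y ∉ Icc 0 T := isClosed_Icc.isOpen_compl.mem_nhds hxm
    have hEq : (Icc 0 T).indicator h =ᶠ[𝓝 x] fun _ => 0 := by
      filter_upwards [hnb] with y hy
      exact indicator_of_notMem hy h
    exact continuousAt_const.congr hEq.symm

/-- The increments of a bounded monotone function over moving windows of length `δ₁ + δ₂` telescope.
-/
theorem integral_shift_sub_le {v : ℝ → ℝ} (hv : Monotone v) {V : ℝ}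
    (hvb : ∀ x, 0 ≤ v x ∧ v x ≤ V) {a b δ₁ δ₂ : ℝ} (h1 : 0 ≤ δ₁) (h2 : 0 ≤ δ₂) :
    ∫ x in a..b, (v (x + δ₁) - v (x - δ₂)) ≤ (δ₁ + δ₂) * V := by
  have hi : ∀ c d, IntervalIntegrable v volume c d := fun c d => hv.intervalIntegrable
  have hi1 : IntervalIntegrable (fun x => v (x + δ₁)) volume a b :=
    Monotone.intervalIntegrable fun x y hxy => hv (by linarith)
  have hi2 : IntervalIntegrable (fun x => v (x - δ₂)) volume a b :=
    Monotone.intervalIntegrable fun x y hxy => hv (by linarith)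
  rw [intervalIntegral.integral_sub hi1 hi2, intervalIntegral.integral_comp_add_right,
    intervalIntegral.integral_comp_sub_right,
    intervalIntegral.integral_interval_sub_interval_comm (hi _ _) (hi _ _) (hi _ _),
    intervalIntegral.integral_symm, intervalIntegral.integral_symm (b - δ₂)]
  have e1 : 0 ≤ ∫ x in (a - δ₂)..(a + δ₁), v x :=
    intervalIntegral.integral_nonneg (by linarith) fun x _ => (hvb x).1
  have e2 : ∫ x in (b - δ₂)..(b + δ₁), v x ≤ (δ₁ + δ₂) * V := by
    have := intervalIntegral.integral_mono_on (by linarith : b - δ₂ ≤ b + δ₁) (hi _ _)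
      (intervalIntegrable_const (c := V)) fun x _ => (hvb x).2
    refine this.trans (le_of_eq ?_)
    rw [intervalIntegral.integral_const, smul_eq_mul]
    ring
  linarith

/-- Hölder's inequality combined with a monotone control: if `|f x|ᵖ` is at most the increment of
the control over `[x - δ₂, x + δ₁]`, the `L¹` norm of `f` is of order `(δ₁ + δ₂)^(1/p)`. -/
theorem lintegral_abs_le_of_control {p : ℝ} (hp : 1 ≤ p) {f v : ℝ → ℝ} (hv : Monotone v) {V : ℝ}
    (hvb : ∀ x, 0 ≤ v x ∧ v x ≤ V) {a b δ₁ δ₂ : ℝ} (hab : a ≤ b) (h1 : 0 ≤ δ₁) (h2 : 0 ≤ δ₂)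
    (hf : AEMeasurable f (volume.restrict (Ioc a b)))
    (hle : ∀ x ∈ Ioc a b, |f x| ^ p ≤ v (x + δ₁) - v (x - δ₂)) :
    ∫⁻ x in Ioc a b, ENNReal.ofReal |f x|
      ≤ ENNReal.ofReal ((b - a) ^ (1 - 1 / p) * ((δ₁ + δ₂) * V) ^ (1 / p)) := by
  have hp0 : 0 < p := by linarith
  have hV : 0 ≤ V := (hvb 0).1.trans (hvb 0).2
  have hH := eLpNorm'_le_eLpNorm'_mul_rpow_measure_univ (p := 1) (q := p) one_pos hp
    hf.aestronglyMeasurable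
  simp only [eLpNorm', ENNReal.rpow_one, div_one, Measure.restrict_apply_univ, Real.volume_Ioc,
    Real.enorm_eq_ofReal_abs] at hH
  refine hH.trans ?_
  have hint : IntegrableOn (fun x => v (x + δ₁) - v (x - δ₂)) (Ioc a b) := by
    have : IntervalIntegrable (fun x => v (x + δ₁) - v (x - δ₂)) volume a b :=
      (Monotone.intervalIntegrable fun x y hxy => hv (by linarith)).sub
        (Monotone.intervalIntegrable fun x y hxy => hv (by linarith))
    exact (intervalIntegrable_iff_integrableOn_Ioc_of_le hab).1 this
  have hI : ∫⁻ x in Ioc a b, ENNReal.ofReal |f x| ^ p ≤ ENNReal.ofReal ((δ₁ + δ₂) * V) := by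
    calc ∫⁻ x in Ioc a b, ENNReal.ofReal |f x| ^ p
        ≤ ∫⁻ x in Ioc a b, ENNReal.ofReal (v (x + δ₁) - v (x - δ₂)) := by
          refine setLIntegral_mono' measurableSet_Ioc fun x hx => ?_
          rw [ENNReal.ofReal_rpow_of_nonneg (abs_nonneg _) hp0.le]
          exact ENNReal.ofReal_le_ofReal (hle x hx)
      _ = ENNReal.ofReal (∫ x in Ioc a b, (v (x + δ₁) - v (x - δ₂))) := by
          rw [ofReal_integral_eq_lintegral_ofReal hint]
          exact Eventually.of_forall fun x => sub_nonneg.2 (hv (by linarith))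
      _ ≤ _ := by
          rw [← intervalIntegral.integral_of_le hab]
          exact ENNReal.ofReal_le_ofReal (integral_shift_sub_le hv hvb h1 h2)
  have hpp : 0 ≤ 1 - 1 / p := by
    rw [sub_nonneg, div_le_one hp0]; exact hp
  calc (∫⁻ x in Ioc a b, ENNReal.ofReal |f x| ^ p) ^ (1 / p) * ENNReal.ofReal (b - a) ^ (1 - 1 / p)
      ≤ ENNReal.ofReal ((δ₁ + δ₂) * V) ^ (1 / p) * ENNReal.ofReal (b - a) ^ (1 - 1 / p) := by
        gcongr
    _ = _ := by
        rw [ENNReal.ofReal_rpow_of_nonneg (by positivity) (by positivity),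
          ENNReal.ofReal_rpow_of_nonneg (by linarith) hpp, ← ENNReal.ofReal_mul (by positivity),
          mul_comm]

theorem integral_abs_le_of_control {p : ℝ} (hp : 1 ≤ p) {f v : ℝ → ℝ} (hv : Monotone v) {V : ℝ}
    (hvb : ∀ x, 0 ≤ v x ∧ v x ≤ V) {a b δ₁ δ₂ : ℝ} (hab : a ≤ b) (h1 : 0 ≤ δ₁) (h2 : 0 ≤ δ₂)
    (hf : AEMeasurable f (volume.restrict (Ioc a b)))
    (hle : ∀ x ∈ Ioc a b, |f x| ^ p ≤ v (x + δ₁) - v (x - δ₂)) :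
    ∫ x in a..b, |f x| ≤ (b - a) ^ (1 - 1 / p) * ((δ₁ + δ₂) * V) ^ (1 / p) := by
  have hV : 0 ≤ V := (hvb 0).1.trans (hvb 0).2
  rw [intervalIntegral.integral_of_le hab,
    integral_eq_lintegral_of_nonneg_ae (Eventually.of_forall fun x => abs_nonneg _)
      (by simpa using hf.aestronglyMeasurable.norm)]
  refine ENNReal.toReal_le_of_le_ofReal ?_
    (lintegral_abs_le_of_control hp hv hvb hab h1 h2 hf hle)
  have : 0 ≤ b - a := by linarith
  positivity

theorem gridProj_le {Δ : ℝ} (hΔ : 0 < Δ) (t : ℝ) : gridProj Δ t ≤ t := by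
  have := mul_le_mul_of_nonneg_right (Int.floor_le (t / Δ)) hΔ.le
  rwa [div_mul_cancel₀ _ hΔ.ne'] at this

theorem lt_gridProj_add {Δ : ℝ} (hΔ : 0 < Δ) (t : ℝ) : t < gridProj Δ t + Δ := by
  have := mul_lt_mul_of_pos_right (Int.lt_floor_add_one (t / Δ)) hΔ
  rw [div_mul_cancel₀ _ hΔ.ne'] at this
  unfold gridProj
  linarith

theorem measurable_gridProj (Δ : ℝ) : Measurable (gridProj Δ) := by
  unfold gridProj
  have : Measurable fun t : ℝ => ((⌊t / Δ⌋ : ℤ) : ℝ) :=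
    measurable_from_top.comp (Int.measurable_floor.comp (measurable_id.div_const Δ))
  exact this.mul_const Δ

/-! ### Time bins and the grid projection -/

/-- The index `k` of the time bin `((k-1)Δ, kΔ]` containing `t > 0`; it is `0` for `t ≤ 0`. -/
noncomputable def binIdx (Δ t : ℝ) : ℕ := ⌈t / Δ⌉₊

theorem measurable_binIdx (Δ : ℝ) : Measurable (binIdx Δ) :=
  Nat.measurable_ceil.comp (measurable_id.div_const Δ)

theorem binIdx_le_iff {Δ : ℝ} (hΔ : 0 < Δ) {t : ℝ} {n : ℕ} : binIdx Δ t ≤ n ↔ t ≤ n * Δ := by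
  rw [binIdx, Nat.ceil_le, div_le_iff₀ hΔ]

theorem le_binIdx_mul {Δ : ℝ} (hΔ : 0 < Δ) (t : ℝ) : t ≤ binIdx Δ t * Δ :=
  (binIdx_le_iff hΔ).1 le_rfl

theorem binIdx_pos_iff {Δ : ℝ} (hΔ : 0 < Δ) {t : ℝ} : 0 < binIdx Δ t ↔ 0 < t := by
  rw [binIdx, Nat.ceil_pos, div_pos_iff_of_pos_right hΔ]

theorem binIdx_mul_lt {Δ : ℝ} (hΔ : 0 < Δ) {t : ℝ} (ht : 0 < t) : binIdx Δ t * Δ < t + Δ := by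
  have h := Nat.ceil_lt_add_one (show 0 ≤ t / Δ by positivity)
  have := mul_lt_mul_of_pos_right h hΔ
  rwa [add_mul, div_mul_cancel₀ _ hΔ.ne', one_mul] at this

theorem binIdx_eq_iff {Δ : ℝ} (hΔ : 0 < Δ) {t : ℝ} {k : ℕ} (hk : 1 ≤ k) :
    binIdx Δ t = k ↔ ((k : ℝ) - 1) * Δ < t ∧ t ≤ k * Δ := by
  obtain ⟨j, rfl⟩ : ∃ j, k = j + 1 := ⟨k - 1, by omega⟩
  have h1 : binIdx Δ t = j + 1 ↔ ¬ binIdx Δ t ≤ j ∧ binIdx Δ t ≤ j + 1 := by omega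
  rw [h1, binIdx_le_iff hΔ, binIdx_le_iff hΔ, not_le]
  push_cast
  rw [add_sub_cancel_right]

/-- Integral of a step function over the time bins. -/
theorem lintegral_binIdx {Δ : ℝ} (hΔ : 0 < Δ) (F : ℕ → ℝ≥0∞) (M : ℕ) :
    ∫⁻ t in Ioc 0 (M * Δ), F (binIdx Δ t) = ∑ k ∈ Finset.Icc 1 M, F k * ENNReal.ofReal Δ := by
  induction M with
  | zero => simp
  | succ M ih =>
    have hu : Ioc (0 : ℝ) ((M + 1 : ℕ) * Δ)
        = Ioc 0 (M * Δ) ∪ Ioc (M * Δ) ((M + 1 : ℕ) * Δ) := by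
      rw [Ioc_union_Ioc_eq_Ioc (by positivity)]
      gcongr
      simp
    have hd : Disjoint (Ioc (0 : ℝ) (M * Δ)) (Ioc (M * Δ) ((M + 1 : ℕ) * Δ)) :=
      Ioc_disjoint_Ioc_of_le le_rfl
    rw [hu, lintegral_union measurableSet_Ioc hd, ih, Finset.sum_Icc_succ_top (by omega)]
    congr 1
    have : ∀ t ∈ Ioc (M * Δ) ((M + 1 : ℕ) * Δ), F (binIdx Δ t) = F (M + 1) := by
      intro t ht
      congr 1
      rw [binIdx_eq_iff hΔ (by omega)]
      refine ⟨?_, ht.2⟩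
      have := ht.1
      push_cast
      linarith
    rw [setLIntegral_congr_fun measurableSet_Ioc this, setLIntegral_const, Real.volume_Ioc]
    congr 2
    push_cast
    ring

theorem aemeasurable_restrict_comp {h φ : ℝ → ℝ} {T a b : ℝ}
    (hm : Measurable ((Icc 0 T).indicator h)) (hφ : Measurable φ)
    (hmem : ∀ x ∈ Ioc a b, φ x ∈ Icc 0 T) :
    AEMeasurable (fun x => h (φ x)) (volume.restrict (Ioc a b)) := by
  refine (hm.comp hφ).aemeasurable.congr ?_
  filter_upwards [ae_restrict_mem measurableSet_Ioc] with x hx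
  simp [hmem x hx]

theorem rpow_one_sub_mul_rpow {p x y V : ℝ} (hp : 1 ≤ p) (hx : 0 ≤ x) (hxy : x ≤ y) {δ : ℝ}
    (hδ : 0 ≤ δ) (hV : 0 ≤ V) :
    x ^ (1 - 1 / p) * (δ * V) ^ (1 / p) ≤ V ^ (1 / p) * y ^ ((p - 1) / p) * δ ^ (1 / p) := by
  have hp0 : 0 < p := by linarith
  have e : 1 - 1 / p = (p - 1) / p := by field_simp
  rw [e, Real.mul_rpow hδ hV]
  have : x ^ ((p - 1) / p) ≤ y ^ ((p - 1) / p) :=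
    Real.rpow_le_rpow hx hxy (div_nonneg (by linarith) hp0.le)
  calc x ^ ((p - 1) / p) * (δ ^ (1 / p) * V ^ (1 / p))
      ≤ y ^ ((p - 1) / p) * (δ ^ (1 / p) * V ^ (1 / p)) := by gcongr
    _ = _ := by ring

theorem integral_grid_le {p : ℝ} (hp : 1 ≤ p) {h : ℝ → ℝ} {T : ℝ} (hV : ePVar p h T ≠ ⊤) {δ : ℝ}
    (hδ : 0 < δ) (hδT : δ ≤ T) :
    ∫ t in (0 : ℝ)..(T - δ), |h t - h (gridProj δ t + δ)|
      ≤ pVarNorm p h T * T ^ ((p - 1) / p) * δ ^ (1 / p) := by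
  have hT : 0 ≤ T := hδ.le.trans hδT
  obtain ⟨v, hv, hvb, hc⟩ := exists_monotone_control hT hV
  have hm := measurable_indicator_of_ePVar hp hT hV
  have mem1 : ∀ t ∈ Ioc 0 (T - δ), t ∈ Icc 0 T := fun t ht => ⟨ht.1.le, by linarith [ht.2]⟩
  have mem2 : ∀ t ∈ Ioc 0 (T - δ), gridProj δ t + δ ∈ Icc 0 T := fun t ht =>
    ⟨(ht.1.trans (lt_gridProj_add hδ t)).le, by linarith [ht.2, gridProj_le hδ t]⟩
  have key := integral_abs_le_of_control hp hv hvb (sub_nonneg.2 hδT) hδ.le le_rfl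
    ((aemeasurable_restrict_comp hm measurable_id mem1).sub
      (aemeasurable_restrict_comp hm ((measurable_gridProj δ).add_const δ) mem2))
    (fun t ht => abs_sub_rpow_le_of_control hv hc (mem1 t ht) (mem2 t ht) (by simp)
      (by linarith [lt_gridProj_add hδ t]) (by simpa using hδ.le) (by linarith [gridProj_le hδ t]))
  rw [add_zero, sub_zero] at key
  exact key.trans (rpow_one_sub_mul_rpow hp (by linarith) (by linarith) hδ.le
    ENNReal.toReal_nonneg)

theorem integral_translate_le {p : ℝ} (hp : 1 ≤ p) {h : ℝ → ℝ} {T : ℝ} (hV : ePVar p h T ≠ ⊤)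
    {δ ε : ℝ} (hε : ε ∈ Icc 0 δ) (hδT : δ ≤ T) :
    ∫ t in (0 : ℝ)..(T - δ), |h (t + ε) - h t|
      ≤ pVarNorm p h T * T ^ ((p - 1) / p) * δ ^ (1 / p) := by
  have hδ : 0 ≤ δ := hε.1.trans hε.2
  have hT : 0 ≤ T := hδ.trans hδT
  obtain ⟨v, hv, hvb, hc⟩ := exists_monotone_control hT hV
  have hm := measurable_indicator_of_ePVar hp hT hV
  have mem1 : ∀ t ∈ Ioc 0 (T - δ), t ∈ Icc 0 T := fun t ht => ⟨ht.1.le, by linarith [ht.2]⟩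
  have mem2 : ∀ t ∈ Ioc 0 (T - δ), t + ε ∈ Icc 0 T := fun t ht =>
    ⟨by linarith [ht.1, hε.1], by linarith [ht.2, hε.2]⟩
  have key := integral_abs_le_of_control hp hv hvb (sub_nonneg.2 hδT) hδ le_rfl
    ((aemeasurable_restrict_comp hm (measurable_id.add_const ε) mem2).sub
      (aemeasurable_restrict_comp hm measurable_id mem1))
    (fun t ht => abs_sub_rpow_le_of_control hv hc (mem2 t ht) (mem1 t ht) (by simpa using hε.1)
      (by simp) (by simpa using hε.2) (by simpa using hδ))
  rw [add_zero, sub_zero] at key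
  exact key.trans (rpow_one_sub_mul_rpow hp (by linarith) (by linarith) hδ
    ENNReal.toReal_nonneg)

theorem CR_le {p : ℝ} (hp : 1 ≤ p) {h : ℝ → ℝ} {T : ℝ} (hV : ePVar p h T ≠ ⊤) {δ : ℝ}
    (hδ : 0 < δ) (hδT : δ ≤ T) :
    CR h T δ ≤ 2 * (pVarNorm p h T * T ^ ((p - 1) / p) * δ ^ (1 / p) + δ * supNorm h T) := by
  have hT : 0 ≤ T := hδ.le.trans hδT
  have h1 : ∫ y in (0 : ℝ)..δ, |h y| ≤ δ * supNorm h T := by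
    have := intervalIntegral.norm_integral_le_of_norm_le_const (a := 0) (b := δ)
      (f := fun y => |h y|) (C := supNorm h T) (fun y hy => by
        rw [uIoc_of_le hδ.le] at hy
        rw [Real.norm_eq_abs, abs_abs]
        exact abs_le_supNorm hp hT hV ⟨hy.1.le, hy.2.trans hδT⟩)
    rw [Real.norm_eq_abs, sub_zero, abs_of_pos hδ] at this
    linarith [le_abs_self (∫ y in (0 : ℝ)..δ, |h y|)]
  have h2 : (⨆ ε : Icc (0 : ℝ) δ, ∫ y in (0 : ℝ)..(T - δ), |h (y + (ε : ℝ)) - h y|)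
      ≤ pVarNorm p h T * T ^ ((p - 1) / p) * δ ^ (1 / p) := by
    have : Nonempty (Icc (0 : ℝ) δ) := ⟨0, le_rfl, hδ.le⟩
    exact ciSup_le fun ε => integral_translate_le hp hV ε.2 hδT
  have h3 := integral_grid_le hp hV hδ hδT
  have h4 := mul_nonneg hδ.le (supNorm_nonneg h T)
  unfold CR
  linarith

theorem integrableOn_of_ePVar {p : ℝ} (hp : 1 ≤ p) {h : ℝ → ℝ} {T : ℝ} (hT : 0 ≤ T)
    (hV : ePVar p h T ≠ ⊤) : IntegrableOn h (Icc 0 T) := by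
  rw [← integrable_indicator_iff measurableSet_Icc]
  refine IntegrableOn.integrable_of_forall_notMem_eq_zero (s := Icc 0 T) ?_
    fun x hx => indicator_of_notMem hx h
  refine IntegrableOn.of_bound (C := supNorm h T) (by simp)
    (measurable_indicator_of_ePVar hp hT hV).aestronglyMeasurable ?_
  filter_upwards [ae_restrict_mem measurableSet_Icc] with x hx
  rw [indicator_of_mem hx, Real.norm_eq_abs]
  exact abs_le_supNorm hp hT hV hx

/-- Right-endpoint Riemann sums of `|h|` approximate its integral at rate `Δ^(1/p)`. -/
theorem sum_abs_le_integral_add {p : ℝ} (hp : 1 ≤ p) {h : ℝ → ℝ} {T : ℝ} (hT : 0 < T)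
    (hV : ePVar p h T ≠ ⊤) {M : ℕ} (hM : 1 ≤ M) :
    ∑ k ∈ Finset.Icc 1 M, |h ((k : ℝ) * (T / M))| * (T / M)
      ≤ (∫ t in Icc 0 T, |h t|) + pVarNorm p h T * T ^ ((p - 1) / p) * (T / M) ^ (1 / p) := by
  obtain ⟨v, hv, hvb, hc⟩ := exists_monotone_control hT.le hV
  have hm := measurable_indicator_of_ePVar hp hT.le hV
  have hM0 : (0 : ℝ) < M := by exact_mod_cast hM
  set Δ : ℝ := T / M with hΔdef
  have hΔ : 0 < Δ := by positivity
  have hMΔ : M * Δ = T := by rw [hΔdef]; field_simp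
  have mem1 : ∀ t ∈ Ioc 0 T, t ∈ Icc 0 T := fun t ht => Ioc_subset_Icc_self ht
  have mem2 : ∀ t ∈ Ioc 0 T, (binIdx Δ t : ℝ) * Δ ∈ Icc 0 T := fun t ht => by
    refine ⟨by positivity, ?_⟩
    rw [← hMΔ]
    have : binIdx Δ t ≤ M := (binIdx_le_iff hΔ).2 (hMΔ ▸ ht.2)
    gcongr
  have hmφ : Measurable fun t => (binIdx Δ t : ℝ) * Δ :=
    (measurable_from_top.comp (measurable_binIdx Δ)).mul_const Δ
  have key := lintegral_abs_le_of_control hp hv hvb hT.le hΔ.le le_rfl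
    ((aemeasurable_restrict_comp hm measurable_id mem1).sub
      (aemeasurable_restrict_comp hm hmφ mem2))
    (fun t ht => abs_sub_rpow_le_of_control hv hc (mem1 t ht) (mem2 t ht) (by simp)
      (by simpa using le_binIdx_mul hΔ t) (by simpa using hΔ.le) (binIdx_mul_lt hΔ ht.1).le)
  rw [add_zero, sub_zero] at key
  have hint := integrableOn_of_ePVar hp hT.le hV
  have hI : ∫⁻ t in Ioc 0 T, ENNReal.ofReal |h t| = ENNReal.ofReal (∫ t in Icc 0 T, |h t|) := by
    rw [ofReal_integral_eq_lintegral_ofReal hint.abs (Eventually.of_forall fun x => abs_nonneg _)]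
    exact setLIntegral_congr Ioc_ae_eq_Icc
  have hsum : ENNReal.ofReal (∑ k ∈ Finset.Icc 1 M, |h ((k : ℝ) * Δ)| * Δ)
      = ∫⁻ t in Ioc 0 T, ENNReal.ofReal |h (binIdx Δ t * Δ)| := by
    have := lintegral_binIdx hΔ (fun k => ENNReal.ofReal |h (k * Δ)|) M
    rw [hMΔ] at this
    rw [this, ENNReal.ofReal_sum_of_nonneg fun k _ => by positivity]
    exact Finset.sum_congr rfl fun k _ => ENNReal.ofReal_mul (abs_nonneg _)
  have hnn : 0 ≤ ∫ t in Icc 0 T, |h t| := integral_nonneg fun _ => abs_nonneg _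
  have hnn2 : 0 ≤ T ^ (1 - 1 / p) * (Δ * (ePVar p h T).toReal) ^ (1 / p) := by positivity
  have hle : ENNReal.ofReal (∑ k ∈ Finset.Icc 1 M, |h ((k : ℝ) * Δ)| * Δ)
      ≤ ENNReal.ofReal ((∫ t in Icc 0 T, |h t|)
        + T ^ (1 - 1 / p) * (Δ * (ePVar p h T).toReal) ^ (1 / p)) := by
    rw [hsum, ENNReal.ofReal_add hnn hnn2, ← hI]
    refine le_trans ?_ (add_le_add le_rfl key)
    rw [← lintegral_add_left']
    · refine lintegral_mono fun t => ?_
      rw [← ENNReal.ofReal_add (abs_nonneg _) (abs_nonneg _)]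
      refine ENNReal.ofReal_le_ofReal ?_
      simp only [Pi.sub_apply, id]
      have := abs_sub_abs_le_abs_sub (h (binIdx Δ t * Δ)) (h t)
      rw [abs_sub_comm] at this
      linarith
    · exact ((aemeasurable_restrict_comp hm measurable_id mem1).abs).ennreal_ofReal
  rw [ENNReal.ofReal_le_ofReal_iff (by positivity)] at hle
  refine hle.trans ?_
  exact add_le_add_right (rpow_one_sub_mul_rpow hp hT.le le_rfl hΔ.le ENNReal.toReal_nonneg) _

theorem tendsto_integral_grid {p : ℝ} (hp : 1 ≤ p) {h : ℝ → ℝ} {T : ℝ} (hT : 0 < T)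
    (hV : ePVar p h T ≠ ⊤) :
    Tendsto (fun Δ : ℝ => ∫ t in (0 : ℝ)..(T - Δ), |h t - h (gridProj Δ t + Δ)|)
      (𝓝[>] 0) (𝓝 0) := by
  have hlim : Tendsto (fun δ : ℝ => pVarNorm p h T * T ^ ((p - 1) / p) * δ ^ (1 / p)) (𝓝[>] 0)
      (𝓝 0) := by
    have h1 : Tendsto (fun δ : ℝ => δ ^ (1 / p)) (𝓝[>] 0) (𝓝 0) := by
      have := (tendsto_id (α := ℝ) (x := 𝓝 0)).rpow_const (p := 1 / p) (Or.inr (by positivity))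
      rw [Real.zero_rpow (by positivity)] at this
      exact this.mono_left nhdsWithin_le_nhds
    simpa using h1.const_mul (pVarNorm p h T * T ^ ((p - 1) / p))
  have hev : ∀ᶠ δ : ℝ in 𝓝[>] 0, δ ∈ Ioo 0 T := Ioo_mem_nhdsGT hT
  refine squeeze_zero' ?_ ?_ hlim
  · filter_upwards [hev] with δ hδ
    exact intervalIntegral.integral_nonneg (by linarith [hδ.2]) fun _ _ => abs_nonneg _
  · filter_upwards [hev] with δ hδ
    exact integral_grid_le hp hV hδ.1 hδ.2.le

/-- For small mesh the discrete stability constant is below any bound strictly above the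
continuous one. -/
theorem exists_rhoDisc_lt (L : ℝ≥0) {b : ℝ → ℝ} (ν : Measure ℝ) (hb : ∀ y, 0 ≤ b y) {p : ℝ}
    (hp : 1 ≤ p) {h : ℝ → ℝ} {T : ℝ} (hT : 0 < T) (hV : ePVar p h T ≠ ⊤) {r : ℝ}
    (hr : rho L h b ν T < r) :
    ∃ Δ₀ : ℝ, 0 < Δ₀ ∧ ∀ M : ℕ, 1 ≤ M → T / M ≤ Δ₀ → rhoDisc L h b ν T M < r := by
  have hm : 0 ≤ ∫ y, b y ∂ν := integral_nonneg hb
  set C : ℝ := L * (pVarNorm p h T * T ^ ((p - 1) / p)) * ∫ y, b y ∂ν with hC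
  have hlim : Tendsto (fun δ : ℝ => rho L h b ν T + C * δ ^ (1 / p)) (𝓝 0)
      (𝓝 (rho L h b ν T)) := by
    have := (tendsto_id (α := ℝ) (x := 𝓝 0)).rpow_const (p := 1 / p) (Or.inr (by positivity))
    rw [Real.zero_rpow (by positivity)] at this
    simpa using (this.const_mul C).const_add (rho L h b ν T)
  obtain ⟨ε, hε, hball⟩ := Metric.eventually_nhds_iff.1 (hlim.eventually (gt_mem_nhds hr))
  refine ⟨ε / 2, by positivity, fun M hM hMε => ?_⟩
  have hM0 : (0 : ℝ) < M := by exact_mod_cast hM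
  have hΔ : 0 < T / M := by positivity
  refine lt_of_le_of_lt ?_ (hball (y := T / M) (by
    rw [Real.dist_eq, sub_zero, abs_of_pos hΔ]; linarith))
  have := sum_abs_le_integral_add hp hT hV hM
  have h2 := mul_le_mul_of_nonneg_right (mul_le_mul_of_nonneg_left this L.coe_nonneg) hm
  unfold rhoDisc rho
  refine h2.trans (le_of_eq ?_)
  rw [hC]
  generalize (∫ y, b y ∂ν) = m
  generalize (∫ t in Icc 0 T, |h t|) = I
  ring

/-! ### Lebesgue measure on the half-line and Poisson boxes -/

instance : SFinite lebesgueNN := by unfold lebesgueNN; infer_instance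

instance (ν : Measure ℝ) [SFinite ν] : SFinite (intensityMeasure ν) := by
  unfold intensityMeasure; infer_instance

theorem lintegral_lebesgueNN {f : ℝ≥0 → ℝ≥0∞} (hf : Measurable f) :
    ∫⁻ s, f s ∂lebesgueNN = ∫⁻ x in Ici (0 : ℝ), f x.toNNReal :=
  lintegral_map hf measurable_real_toNNReal

theorem lebesgueNN_apply {s : Set ℝ≥0} (hs : MeasurableSet s) :
    lebesgueNN s = volume (Real.toNNReal ⁻¹' s ∩ Ici 0) := by
  rw [lebesgueNN, Measure.map_apply measurable_real_toNNReal hs,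
    Measure.restrict_apply (measurable_real_toNNReal hs)]

theorem lebesgueNN_singleton_zero : lebesgueNN {0} = 0 := by
  rw [lebesgueNN_apply (measurableSet_singleton _)]
  refine measure_mono_null (t := {0}) ?_ (by simp)
  rintro x ⟨hx, hx0⟩
  exact le_antisymm (Real.toNNReal_eq_zero.1 hx) hx0

theorem lebesgueNN_setOf_coe_le (x : ℝ) :
    lebesgueNN {θ : ℝ≥0 | (θ : ℝ) ≤ x} = ENNReal.ofReal x := by
  rw [lebesgueNN_apply (measurableSet_le NNReal.continuous_coe.measurable measurable_const)]
  have : Real.toNNReal ⁻¹' {θ : ℝ≥0 | (θ : ℝ) ≤ x} ∩ Ici 0 = Icc 0 x := by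
    ext y
    simp only [mem_inter_iff, mem_preimage, mem_ofPred_eq, mem_Ici, mem_Icc, Real.coe_toNNReal']
    constructor
    · rintro ⟨h1, h2⟩
      exact ⟨h2, (le_max_left _ _).trans h1⟩
    · rintro ⟨h1, h2⟩
      exact ⟨by rwa [max_eq_left h1], h1⟩
  rw [this, Real.volume_Icc, sub_zero]

theorem lebesgueNN_Iic (a : ℝ≥0) : lebesgueNN (Iic a) = a := by
  have := lebesgueNN_setOf_coe_le (a : ℝ)
  rw [ENNReal.ofReal_coe_nnreal] at this
  rwa [show {θ : ℝ≥0 | (θ : ℝ) ≤ a} = Iic a by ext; simp] at this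

/-- The heights that exactly one of the two thresholds accepts have Lebesgue measure at most the
distance between the thresholds. -/
theorem lebesgueNN_disagree_le (x y : ℝ) :
    lebesgueNN {θ : ℝ≥0 | ¬((θ : ℝ) ≤ x ↔ (θ : ℝ) ≤ y)} ≤ ENNReal.ofReal |x - y| := by
  have hm : MeasurableSet {θ : ℝ≥0 | ¬((θ : ℝ) ≤ x ↔ (θ : ℝ) ≤ y)} :=
    ((measurableSet_le NNReal.continuous_coe.measurable measurable_const).iff
      (measurableSet_le NNReal.continuous_coe.measurable measurable_const)).compl
  rw [lebesgueNN_apply hm]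
  have : Real.toNNReal ⁻¹' {θ : ℝ≥0 | ¬((θ : ℝ) ≤ x ↔ (θ : ℝ) ≤ y)} ∩ Ici 0
      ⊆ Ioc (min x y) (max x y) := by
    rintro z ⟨h1, h2⟩
    simp only [mem_preimage, mem_ofPred_eq, Real.coe_toNNReal', max_eq_left (mem_Ici.1 h2)] at h1
    rw [mem_Ioc, min_lt_iff, le_max_iff]
    by_cases hx : z ≤ x <;> by_cases hy : z ≤ y <;> simp_all
  refine (measure_mono this).trans ?_
  rw [Real.volume_Ioc, max_sub_min_eq_abs']

theorem lintegral_intensityMeasure (ν : Measure ℝ) [SFinite ν] {f : State → ℝ≥0∞}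
    (hf : Measurable f) :
    ∫⁻ z, f z ∂(intensityMeasure ν)
      = ∫⁻ s, ∫⁻ θ, ∫⁻ y, f (s, θ, y) ∂ν ∂lebesgueNN ∂lebesgueNN := by
  rw [intensityMeasure, lintegral_prod _ hf.aemeasurable]
  refine lintegral_congr fun s => ?_
  rw [lintegral_prod _ (by fun_prop)]

theorem intensityMeasure_prod (ν : Measure ℝ) [SFinite ν] (A : Set ℝ≥0) (S : Set (ℝ≥0 × ℝ)) :
    intensityMeasure ν (A ×ˢ S) = lebesgueNN A * lebesgueNN.prod ν S := by
  rw [intensityMeasure, Measure.prod_prod]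

/-- The box `[0, n] × [0, n] × ℝ`. -/
def box (n : ℕ) : Set State := Iic (n : ℝ≥0) ×ˢ (Iic (n : ℝ≥0) ×ˢ univ)

theorem measurableSet_box (n : ℕ) : MeasurableSet (box n) :=
  measurableSet_Iic.prod (measurableSet_Iic.prod MeasurableSet.univ)

theorem box_mono : Monotone box := by
  intro m n hmn z hz
  have : (m : ℝ≥0) ≤ n := by exact_mod_cast hmn
  exact ⟨le_trans hz.1 this, le_trans hz.2.1 this, trivial⟩

theorem iUnion_box : ⋃ n, box n = univ := by
  refine eq_univ_of_forall fun z => mem_iUnion.2 ?_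
  obtain ⟨n, hn⟩ := exists_nat_ge (max z.1 z.2.1)
  exact ⟨n, (le_max_left _ _).trans hn, (le_max_right _ _).trans hn, trivial⟩

theorem intensityMeasure_box (ν : Measure ℝ) [IsProbabilityMeasure ν] (n : ℕ) :
    intensityMeasure ν (box n) = n * n := by
  rw [box, intensityMeasure_prod, Measure.prod_prod, lebesgueNN_Iic]
  simp

theorem intensityMeasure_zero (ν : Measure ℝ) [IsProbabilityMeasure ν] :
    intensityMeasure ν ({0} ×ˢ univ) = 0 := by
  rw [intensityMeasure_prod, lebesgueNN_singleton_zero, zero_mul]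

/-- A kernel that is pointwise finite on an exhaustion independent of the parameter is s-finite:
it is the sum of its restrictions to the disjointed pieces, localized on the sets of
parameters for which the mass of the `n`-th piece has integer part `k`. -/
theorem isSFiniteKernel_of_iUnion {α β : Type*} [MeasurableSpace α] [MeasurableSpace β]
    (κ : Kernel α β) (B : ℕ → Set β) (hB : ∀ n, MeasurableSet (B n)) (hU : ⋃ n, B n = univ)
    (hfin : ∀ a n, κ a (B n) < ⊤) : IsSFiniteKernel κ := by
  classical
  have hD : ∀ n, MeasurableSet (disjointed B n) := fun n => MeasurableSet.disjointed hB n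
  have hfl : ∀ n : ℕ, ∀ a, κ a (disjointed B n) < ⊤ := fun n a =>
    (measure_mono (disjointed_subset B n)).trans_lt (hfin a n)
  let lev : ℕ → α → ℕ := fun n a => ⌊(κ a (disjointed B n)).toReal⌋₊
  have hlev : ∀ n, Measurable (lev n) := fun n =>
    Nat.measurable_floor.comp (Kernel.measurable_coe κ (hD n)).ennreal_toReal
  let κ' : ℕ → ℕ → Kernel α β := fun n k =>
    Kernel.piecewise (hlev n (measurableSet_singleton k)) (κ.restrict (hD n)) 0
  have hfinK : ∀ n k, IsFiniteKernel (κ' n k) := by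
    intro n k
    refine ⟨⟨k + 1, by simp, fun a => ?_⟩⟩
    simp only [κ', Kernel.piecewise_apply']
    split_ifs with h
    · rw [Kernel.restrict_apply, Measure.restrict_apply_univ]
      have h1 : lev n a = k := h
      have h2 := Nat.lt_floor_add_one (κ a (disjointed B n)).toReal
      rw [show ⌊(κ a (disjointed B n)).toReal⌋₊ = k from h1] at h2
      rw [← ENNReal.ofReal_toReal (hfl n a).ne]
      refine (ENNReal.ofReal_le_ofReal h2.le).trans (le_of_eq ?_)
      rw [ENNReal.ofReal_add (by positivity) zero_le_one]
      simp
    · simp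
  have hsum : κ = Kernel.sum fun n => Kernel.sum fun k => κ' n k := by
    ext a s hs
    rw [Kernel.sum_apply' _ _ hs]
    have h1 : ∀ n, Kernel.sum (fun k => κ' n k) a s = κ a (s ∩ disjointed B n) := by
      intro n
      rw [Kernel.sum_apply' _ _ hs, tsum_eq_single (lev n a)]
      · simp only [κ', Kernel.piecewise_apply']
        rw [if_pos (by rfl), Kernel.restrict_apply, Measure.restrict_apply hs]
      · intro k hk
        simp only [κ', Kernel.piecewise_apply']
        rw [if_neg]
        · simp
        · exact fun h => hk (Eq.symm h)
    simp_rw [h1]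
    rw [← measure_iUnion (fun i j hij => ((disjoint_disjointed B) hij).mono inter_subset_right
      inter_subset_right) (fun n => hs.inter (hD n)), ← inter_iUnion, iUnion_disjointed, hU,
      inter_univ]
  rw [hsum]
  have : ∀ n, IsSFiniteKernel (Kernel.sum fun k => κ' n k) := fun n =>
    Kernel.isSFiniteKernel_sum
  exact Kernel.isSFiniteKernel_sum

theorem lintegral_cast_poissonMeasure (r : ℝ≥0) :
    ∫⁻ n : ℕ, (n : ℝ≥0∞) ∂(poissonMeasure r) = r := by
  have hterm : ∀ n : ℕ, ENNReal.ofReal (Real.exp (-r) * r ^ (n + 1) / (n + 1).factorial)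
      * ((n + 1 : ℕ) : ℝ≥0∞) = r * ENNReal.ofReal (Real.exp (-r) * r ^ n / n.factorial) := by
    intro n
    rw [← ENNReal.ofReal_natCast, ← ENNReal.ofReal_coe_nnreal (p := r),
      ← ENNReal.ofReal_mul (by positivity), ← ENNReal.ofReal_mul (by positivity)]
    congr 1
    rw [Nat.factorial_succ]
    push_cast
    field_simp
    ring
  have hs := hasSum_one_poissonMeasure r
  have h1 : ∑' n : ℕ, ENNReal.ofReal (Real.exp (-r) * r ^ n / n.factorial) = 1 := by
    rw [← ENNReal.ofReal_tsum_of_nonneg (fun n => by positivity) hs.summable, hs.tsum_eq,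
      ENNReal.ofReal_one]
  rw [lintegral_countable']
  simp_rw [poissonMeasure_singleton]
  rw [tsum_eq_zero_add' ENNReal.summable]
  simp only [Nat.cast_zero, zero_mul, zero_add]
  simp_rw [mul_comm (((_ + 1 : ℕ) : ℝ≥0∞)), hterm]
  rw [ENNReal.tsum_mul_left, h1, mul_one]

section Poisson

variable {Ω : Type*} [mΩ : MeasurableSpace Ω] {P : Kernel Ω State} {ν : Measure ℝ} {μ : Measure Ω}

theorem IsPoissonRandomMeasure.isSFiniteKernel (hP : IsPoissonRandomMeasure P ν μ) :
    IsSFiniteKernel P :=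
  isSFiniteKernel_of_iUnion P box measurableSet_box iUnion_box hP.locallyFinite

theorem IsPoissonRandomMeasure.lintegral_apply (hP : IsPoissonRandomMeasure P ν μ)
    {B : Set State} (hB : MeasurableSet B) (hfin : intensityMeasure ν B ≠ ⊤) :
    ∫⁻ ω, P ω B ∂μ = intensityMeasure ν B := by
  have h1 : ∫⁻ ω, P ω B ∂μ = ∫⁻ x, x ∂(μ.map fun ω => P ω B) :=
    (lintegral_map measurable_id (Kernel.measurable_coe P hB)).symm
  rw [h1, hP.law B hB hfin, lintegral_map (f := fun x => x) measurable_id measurable_from_top]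
  rw [lintegral_cast_poissonMeasure, ENNReal.coe_toNNReal hfin]

end Poisson

/-! ### Campbell formula for predictable integrands -/

section Poisson

variable {Ω : Type*} [mΩ : MeasurableSpace Ω] {P : Kernel Ω State} {ν : Measure ℝ} {μ : Measure Ω}

/-- The masses of finitely many sets are independent of the mass of a set disjoint from them: the
former are sums of masses of the atoms that the sets generate. -/
theorem IsPoissonRandomMeasure.indep_finset (hP : IsPoissonRandomMeasure P ν μ)
    {ι : Type*} (J : Finset ι) (B : ι → Set State)
    (hB : ∀ i, MeasurableSet (B i)) {D : Set State} (hD : MeasurableSet D)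
    (hBD : ∀ i, Disjoint (B i) D) :
    Indep (⨆ i ∈ J, MeasurableSpace.comap (fun ω => P ω (B i)) inferInstance)
      (MeasurableSpace.comap (fun ω => P ω D) inferInstance) μ := by
  classical
  let code : State → Option (J → Bool) := fun z =>
    if z ∈ D then none else some fun i => decide (z ∈ B i)
  let E : Option (J → Bool) → Set State := fun c => {z | code z = c}
  have hEnone : E none = D := by
    ext z
    by_cases hz : z ∈ D <;> simp [E, code, hz]
  have hEsome : ∀ σ : J → Bool, E (some σ) = Dᶜ ∩ ⋂ i : J, {z | decide (z ∈ B i) = σ i} := by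
    intro σ
    ext z
    by_cases hz : z ∈ D <;> simp [E, code, hz, funext_iff]
  have hEm : ∀ c, MeasurableSet (E c) := by
    rintro (_ | σ)
    · rw [hEnone]; exact hD
    · rw [hEsome]
      refine hD.compl.inter (MeasurableSet.iInter fun i => ?_)
      have : {z | decide (z ∈ B i) = σ i} = if σ i then B i else (B i)ᶜ := by
        ext z
        cases hσ : σ i <;> simp
      rw [this]
      split_ifs
      · exact hB i
      · exact (hB i).compl
  have hEd : Pairwise fun c c' => Disjoint (E c) (E c') := by
    intro c c' hcc
    rw [Set.disjoint_left]
    intro z h1 h2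
    exact hcc (Eq.trans (Eq.symm h1) h2)
  have hind : iIndepFun (fun c ω => P ω (E c)) μ := by
    let e := Fintype.equivFin (Option (J → Bool))
    have h1 := hP.indep _ (fun i => E (e.symm i)) (fun i => hEm _)
      (fun i j hij => hEd (fun h => hij (e.symm.injective h)))
    have h2 := h1.precomp e.injective
    simpa using h2
  have hsum : ∀ i : J, ∀ ω, P ω (B i)
      = ∑ σ : J → Bool, if σ i then P ω (E (some σ)) else 0 := by
    intro i ω
    have hU : B i = ⋃ σ ∈ (Finset.univ.filter fun σ : J → Bool => σ i = true), E (some σ) := by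
      ext z
      simp only [Finset.mem_filter, Finset.mem_univ, true_and, mem_iUnion, exists_prop]
      constructor
      · intro hz
        have hzD : z ∉ D := fun h => (Set.disjoint_left.1 (hBD i)) hz h
        exact ⟨fun j => decide (z ∈ B j), by simpa using hz, by simp [E, code, hzD]⟩
      · rintro ⟨σ, hσ, hz⟩
        rw [hEsome] at hz
        have := mem_iInter.1 hz.2 i
        rw [mem_ofPred_eq, hσ] at this
        simpa using this
    rw [hU, measure_biUnion_finset (fun σ _ σ' _ h => hEd (by simpa using h)) fun σ _ => hEm _,
      Finset.sum_filter]
  let S : Finset (Option (J → Bool)) := Finset.univ.filter fun c => c ≠ none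
  let R : Finset (Option (J → Bool)) := {none}
  have hSR : Disjoint S R := by simp [S, R]
  have key := hind.indepFun_finset S R hSR fun c => Kernel.measurable_coe P (hEm c)
  have keyI : Indep _ _ μ := key
  refine indep_of_indep_of_le_left (indep_of_indep_of_le_right keyI ?_) ?_
  · have : (fun ω => P ω D)
        = (fun x : R → ℝ≥0∞ => x ⟨none, by simp [R]⟩) ∘ fun ω (i : R) => P ω (E i) := by
      ext ω; simp [hEnone]
    rw [this, ← MeasurableSpace.comap_comp]
    exact MeasurableSpace.comap_mono (measurable_pi_apply _).comap_le
  · refine iSup₂_le fun i hi => ?_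
    have : (fun ω => P ω (B i)) = (fun x : S → ℝ≥0∞ => ∑ σ : J → Bool,
        if σ ⟨i, hi⟩ then x ⟨some σ, by simp [S]⟩ else 0) ∘ fun ω (c : S) => P ω (E c) := by
      ext ω
      rw [hsum ⟨i, hi⟩ ω]
      rfl
    rw [this, ← MeasurableSpace.comap_comp]
    refine MeasurableSpace.comap_mono (Measurable.comap_le ?_)
    refine Finset.measurable_sum _ fun σ _ => ?_
    split_ifs
    · exact measurable_pi_apply _
    · exact measurable_const

/-- The past up to time `t` is independent of the mass of any set of points lying after `t`. -/
theorem IsPoissonRandomMeasure.indep_filtration [IsProbabilityMeasure μ]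
    (hP : IsPoissonRandomMeasure P ν μ) (t : ℝ≥0) {D : Set State} (hD : MeasurableSet D)
    (hDt : ∀ z ∈ D, t < z.1) :
    Indep (poissonFiltration P t) (MeasurableSpace.comap (fun ω => P ω D) inferInstance) μ := by
  classical
  let ι := {q : Set ℝ≥0 × Set (ℝ≥0 × ℝ) //
    MeasurableSet q.1 ∧ MeasurableSet q.2 ∧ q.1 ⊆ Ioc 0 t}
  let B : ι → Set State := fun i => i.1.1 ×ˢ i.1.2
  have hB : ∀ i, MeasurableSet (B i) := fun i => i.2.1.prod i.2.2.1
  have hBD : ∀ i, Disjoint (B i) D := by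
    intro i
    rw [Set.disjoint_left]
    intro z hz hzD
    exact absurd (i.2.2.2 hz.1).2 (not_le.2 (hDt z hzD))
  have hle : poissonFiltration P t ≤ ⨆ J : Finset ι, ⨆ i ∈ J,
      MeasurableSpace.comap (fun ω => P ω (B i)) inferInstance := by
    refine iSup_le fun A => iSup_le fun S => iSup_le fun hA => iSup_le fun hS => iSup_le fun hs => ?_
    refine le_iSup_of_le {(⟨(A, S), hA, hS, hs⟩ : ι)} ?_
    exact le_iSup₂_of_le (⟨(A, S), hA, hS, hs⟩ : ι) (Finset.mem_singleton_self _) le_rfl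
  refine indep_of_indep_of_le_left (indep_iSup_of_directed_le (fun J => ?_) (fun J => ?_) ?_ ?_) hle
  · exact hP.indep_finset J B hB hD hBD
  · exact iSup₂_le fun i _ => (Kernel.measurable_coe P (hB i)).comap_le
  · exact (Kernel.measurable_coe P hD).comap_le
  · refine directed_of_isDirected_le fun J J' hJ => ?_
    exact iSup₂_le fun i hi => le_iSup₂_of_le i (hJ hi) le_rfl

theorem poissonFiltration_le (P : Kernel Ω State) (t : ℝ≥0) : poissonFiltration P t ≤ mΩ :=
  (poissonFiltration P).le t

theorem predictable_le (P : Kernel Ω State) :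
    (poissonFiltration P).predictable ≤ (inferInstance : MeasurableSpace (ℝ≥0 × Ω)) := by
  refine measurableSpace_le_predictable_of_measurableSet (fun A hA => ?_) fun i A hA => ?_
  · exact (measurableSet_singleton _).prod (poissonFiltration_le P _ _ hA)
  · exact measurableSet_Ioi.prod (poissonFiltration_le P _ _ hA)

theorem IsPoissonRandomMeasure.ae_apply_zero_time [IsProbabilityMeasure ν]
    (hP : IsPoissonRandomMeasure P ν μ) : ∀ᵐ ω ∂μ, P ω ({0} ×ˢ univ) = 0 := by
  have hm : MeasurableSet (({0} : Set ℝ≥0) ×ˢ (univ : Set (ℝ≥0 × ℝ))) :=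
    (measurableSet_singleton _).prod MeasurableSet.univ
  have h1 := hP.lintegral_apply hm (by rw [intensityMeasure_zero]; simp)
  rw [intensityMeasure_zero, lintegral_eq_zero_iff (Kernel.measurable_coe P hm)] at h1
  exact h1

/-- The generators of the predictable σ-algebra form a π-system. -/
theorem predictable_isPiSystem (P : Kernel Ω State) :
    IsPiSystem ({s : Set (ℝ≥0 × Ω) | ∃ A, MeasurableSet[poissonFiltration P ⊥] A ∧ s = {⊥} ×ˢ A} ∪
      {s | ∃ i A, MeasurableSet[poissonFiltration P i] A ∧ s = Set.Ioi i ×ˢ A}) := by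
  rintro s (⟨A, hA, rfl⟩ | ⟨i, A, hA, rfl⟩) s' (⟨A', hA', rfl⟩ | ⟨i', A', hA', rfl⟩) hne
  · refine Or.inl ⟨A ∩ A', MeasurableSet.inter hA hA', ?_⟩
    rw [prod_inter_prod, inter_self]
  · exfalso
    obtain ⟨z, hz, hz'⟩ := hne
    have h1 : z.1 = ⊥ := hz.1
    have h2 : i' < z.1 := hz'.1
    rw [h1] at h2
    exact not_lt_bot h2
  · exfalso
    obtain ⟨z, hz', hz⟩ := hne
    have h1 : z.1 = ⊥ := hz.1
    have h2 : i < z.1 := hz'.1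
    rw [h1] at h2
    exact not_lt_bot h2
  · refine Or.inr ⟨max i i', A ∩ A', MeasurableSet.inter ?_ ?_, ?_⟩
    · exact (poissonFiltration P).mono (le_max_left _ _) _ hA
    · exact (poissonFiltration P).mono (le_max_right _ _) _ hA'
    · rw [prod_inter_prod, Ioi_inter_Ioi]

/-- Campbell's formula in a box: the measure `μ ⊗ P` and the product `μ ⊗ intensity`, restricted to
a box, agree on the product of the predictable σ-algebra with the Borel sets of `ℝ₊ × ℝ`. Both are
finite, so it suffices to compare them on a generating π-system, where independence applies. -/
theorem IsPoissonRandomMeasure.campbell_box [IsProbabilityMeasure μ] [IsProbabilityMeasure ν]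
    (hP : IsPoissonRandomMeasure P ν μ) (n : ℕ) {C : Set ((ℝ≥0 × Ω) × (ℝ≥0 × ℝ))}
    (hC : MeasurableSet[((poissonFiltration P).predictable).prod inferInstance] C) :
    ∫⁻ ω, P ω ({z | ((z.1, ω), z.2) ∈ C} ∩ box n) ∂μ
      = ∫⁻ ω, intensityMeasure ν ({z | ((z.1, ω), z.2) ∈ C} ∩ box n) ∂μ := by
  have := hP.isSFiniteKernel
  let mA : MeasurableSpace ((ℝ≥0 × Ω) × (ℝ≥0 × ℝ)) := inferInstance
  let mC : MeasurableSpace ((ℝ≥0 × Ω) × (ℝ≥0 × ℝ)) :=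
    ((poissonFiltration P).predictable).prod inferInstance
  have hmle : mC ≤ mA := sup_le_sup (MeasurableSpace.comap_mono (predictable_le P)) le_rfl
  let φ : Ω × State → (ℝ≥0 × Ω) × (ℝ≥0 × ℝ) := fun x => ((x.2.1, x.1), x.2.2)
  have hφA : Measurable[_, mA] φ := by
    exact (measurable_snd.fst.prodMk measurable_fst).prodMk measurable_snd.snd
  have hφ : Measurable[_, mC] φ := hφA.mono le_rfl hmle
  let m1 : @Measure _ mC := @Measure.map _ _ _ mC φ (μ ⊗ₘ P.restrict (measurableSet_box n))
  let m2 : @Measure _ mC := @Measure.map _ _ _ mC φ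
    (μ ⊗ₘ Kernel.const Ω ((intensityMeasure ν).restrict (box n)))
  have hfib : ∀ (C : Set ((ℝ≥0 × Ω) × (ℝ≥0 × ℝ))), MeasurableSet[mC] C → ∀ ω : Ω,
      MeasurableSet {z : State | ((z.1, ω), z.2) ∈ C} := by
    intro C hC ω
    have : Measurable[_, mA] fun z : State => ((z.1, ω), z.2) :=
      (measurable_fst.prodMk measurable_const).prodMk measurable_snd
    exact this (hmle _ hC)
  have e1 : ∀ C, MeasurableSet[mC] C → m1 C = ∫⁻ ω, P ω ({z | ((z.1, ω), z.2) ∈ C} ∩ box n) ∂μ := by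
    intro C hC
    simp only [m1]
    rw [@Measure.map_apply _ _ _ mC _ _ hφ _ hC, Measure.compProd_apply (hφ hC)]
    refine lintegral_congr fun ω => ?_
    rw [Kernel.restrict_apply, Measure.restrict_apply]
    · rfl
    · exact hfib C hC ω
  have e2 : ∀ C, MeasurableSet[mC] C → m2 C
      = ∫⁻ ω, intensityMeasure ν ({z | ((z.1, ω), z.2) ∈ C} ∩ box n) ∂μ := by
    intro C hC
    simp only [m2]
    rw [@Measure.map_apply _ _ _ mC _ _ hφ _ hC, Measure.compProd_apply (hφ hC)]
    refine lintegral_congr fun ω => ?_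
    rw [Kernel.const_apply, Measure.restrict_apply]
    · rfl
    · exact hfib C hC ω
  have hbox : intensityMeasure ν (box n) ≠ ⊤ := by
    rw [intensityMeasure_box]; exact ENNReal.mul_ne_top (by simp) (by simp)
  have hEbox : ∫⁻ ω, P ω (box n) ∂μ = intensityMeasure ν (box n) :=
    hP.lintegral_apply (measurableSet_box n) hbox
  suffices h : m1 = m2 by rw [← e1 C hC, ← e2 C hC, h]
  have huniv : m1 univ = m2 univ := by
    rw [e1 _ MeasurableSet.univ, e2 _ MeasurableSet.univ]
    simp [hEbox]
  have hfin : IsFiniteMeasure m1 := by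
    refine ⟨?_⟩
    rw [e1 _ MeasurableSet.univ]
    simp only [mem_univ, ofPred_true, univ_inter]
    rw [hEbox]
    exact hbox.lt_top
  refine @ext_of_generate_finite _ mC _ _ (image2 (· ×ˢ ·) _ {S | MeasurableSet S})
    ?_ ((predictable_isPiSystem P).prod MeasurableSpace.isPiSystem_measurableSet) hfin ?_ huniv
  · let : MeasurableSpace (ℝ≥0 × Ω) := (poissonFiltration P).predictable
    refine (generateFrom_eq_prod (α := ℝ≥0 × Ω) (β := ℝ≥0 × ℝ) rfl
      MeasurableSpace.generateFrom_measurableSet ?_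
      ⟨fun _ => univ, fun _ => mem_ofPred_eq ▸ MeasurableSet.univ, iUnion_const _⟩).symm
    refine ⟨fun k => if k = 0 then {⊥} ×ˢ univ else Ioi 0 ×ˢ univ, fun k => ?_, ?_⟩
    · simp only
      split_ifs
      · exact Or.inl ⟨univ, MeasurableSet.univ, rfl⟩
      · exact Or.inr ⟨0, univ, MeasurableSet.univ, rfl⟩
    · refine eq_univ_of_forall fun x => mem_iUnion.2 ?_
      rcases eq_or_lt_of_le (zero_le (a := x.1)) with h | h
      · exact ⟨0, by simpa using h.symm, trivial⟩
      · exact ⟨1, by simpa using h, trivial⟩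
  · rintro _ ⟨s, hs, S, hS, rfl⟩
    have hSm : MeasurableSet S := hS
    have hsm : MeasurableSet[mC] (s ×ˢ S) := by
      refine @MeasurableSet.prod _ _ (poissonFiltration P).predictable _ _ _ ?_ hSm
      exact MeasurableSpace.measurableSet_generateFrom hs
    rw [e1 _ hsm, e2 _ hsm]
    rcases hs with ⟨A, hA, rfl⟩ | ⟨i, A, hA, rfl⟩
    · have h0 : ∀ ω : Ω, {z : State | ((z.1, ω), z.2) ∈ (({⊥} : Set ℝ≥0) ×ˢ A) ×ˢ S} ∩ box n
          ⊆ {0} ×ˢ univ := fun ω z hz => ⟨hz.1.1.1, trivial⟩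
      have hl : ∫⁻ ω, P ω ({z : State | ((z.1, ω), z.2) ∈ (({⊥} : Set ℝ≥0) ×ˢ A) ×ˢ S} ∩ box n) ∂μ
          = ∫⁻ _, 0 ∂μ := by
        refine lintegral_congr_ae ?_
        filter_upwards [hP.ae_apply_zero_time] with ω hω
        exact measure_mono_null (h0 ω) hω
      rw [hl]
      refine lintegral_congr fun ω => ?_
      exact (measure_mono_null (h0 ω) (intensityMeasure_zero ν)).symm
    · let D : Set State := (Ioi i ×ˢ S) ∩ box n
      have hD : MeasurableSet D := (measurableSet_Ioi.prod hSm).inter (measurableSet_box n)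
      have hDfin : intensityMeasure ν D ≠ ⊤ := ne_top_of_le_ne_top hbox (measure_mono inter_subset_right)
      have hA' : MeasurableSet A := poissonFiltration_le P i _ hA
      have hset : ∀ (m : Ω → Measure State) (ω : Ω),
          m ω ({z : State | ((z.1, ω), z.2) ∈ (Ioi i ×ˢ A) ×ˢ S} ∩ box n)
            = A.indicator (fun _ => 1) ω * m ω D := by
        intro m ω
        by_cases hω : ω ∈ A
        · rw [indicator_of_mem hω, one_mul]
          congr 1
          ext z
          simp [D, hω]
        · rw [indicator_of_notMem hω, zero_mul]
          convert measure_empty (μ := m ω)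
          ext z
          simp [hω]
      simp_rw [hset (fun ω => P ω), hset (fun _ => intensityMeasure ν)]
      have hind := hP.indep_filtration i hD fun z hz => hz.1.1
      rw [lintegral_mul_eq_lintegral_mul_lintegral_of_independent_measurableSpace
        (poissonFiltration_le P i) (Kernel.measurable_coe P hD).comap_le hind
        ((measurable_indicator_const_iff (m := poissonFiltration P i) (1 : ℝ≥0∞)).2 hA)
        (comap_measurable _),
        lintegral_mul_const _ (measurable_const.indicator hA'), hP.lintegral_apply hD hDfin]

/-- **Campbell's formula** for predictable integrands. The predictable dependence is encoded by a
map `Φ` on `ℝ₊ × Ω`, measurable for the predictable σ-algebra. -/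
theorem IsPoissonRandomMeasure.campbell [IsProbabilityMeasure μ] [IsProbabilityMeasure ν]
    (hP : IsPoissonRandomMeasure P ν μ) {E : Type*} [MeasurableSpace E] {Φ : ℝ≥0 × Ω → E}
    (hΦ : Measurable[(poissonFiltration P).predictable] Φ) {H : E × (ℝ≥0 × ℝ) → ℝ≥0∞}
    (hH : Measurable H) :
    ∫⁻ ω, ∫⁻ z, H (Φ (z.1, ω), z.2) ∂(P ω) ∂μ
      = ∫⁻ ω, ∫⁻ z, H (Φ (z.1, ω), z.2) ∂(intensityMeasure ν) ∂μ := by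
  have := hP.isSFiniteKernel
  have hΦ' : Measurable Φ := hΦ.mono (predictable_le P) le_rfl
  let φ : Ω × State → E × (ℝ≥0 × ℝ) := fun x => (Φ (x.2.1, x.1), x.2.2)
  have hφ : Measurable φ :=
    (hΦ'.comp (measurable_snd.fst.prodMk measurable_fst)).prodMk measurable_snd.snd
  have hmeas : (μ ⊗ₘ P).map φ = (μ ⊗ₘ Kernel.const Ω (intensityMeasure ν)).map φ := by
    ext C hC
    rw [Measure.map_apply hφ hC, Measure.map_apply hφ hC, Measure.compProd_apply (hφ hC),
      Measure.compProd_apply (hφ hC)]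
    have hC' : MeasurableSet[((poissonFiltration P).predictable).prod inferInstance]
        ((fun x : (ℝ≥0 × Ω) × (ℝ≥0 × ℝ) => (Φ x.1, x.2)) ⁻¹' C) := by
      let : MeasurableSpace (ℝ≥0 × Ω) := (poissonFiltration P).predictable
      have : Measurable fun x : (ℝ≥0 × Ω) × (ℝ≥0 × ℝ) => (Φ x.1, x.2) :=
        (hΦ.comp measurable_fst).prodMk measurable_snd
      exact this hC
    have hlim : ∀ κ : Kernel Ω State, IsSFiniteKernel κ →
        ∫⁻ ω, κ ω (Prod.mk ω ⁻¹' (φ ⁻¹' C)) ∂μ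
          = ⨆ n, ∫⁻ ω, κ ω (Prod.mk ω ⁻¹' (φ ⁻¹' C) ∩ box n) ∂μ := by
      intro κ hκ
      rw [← lintegral_iSup]
      · refine lintegral_congr fun ω => ?_
        rw [← Monotone.measure_iUnion, ← inter_iUnion, iUnion_box, inter_univ]
        exact fun m n hmn => inter_subset_inter_right _ (box_mono hmn)
      · intro n
        have := Kernel.measurable_kernel_prodMk_left (κ := κ)
          (((hφ hC)).inter (measurable_snd (measurableSet_box n)))
        exact this
      · exact fun m n hmn ω => measure_mono (inter_subset_inter_right _ (box_mono hmn))
    rw [hlim P inferInstance, hlim (Kernel.const Ω (intensityMeasure ν)) inferInstance]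
    exact iSup_congr fun n => hP.campbell_box n hC'
  have h1 := lintegral_map (μ := μ ⊗ₘ P) hH hφ
  have h2 := lintegral_map (μ := μ ⊗ₘ Kernel.const Ω (intensityMeasure ν)) hH hφ
  rw [Measure.lintegral_compProd (f := fun x => H (φ x)) (hH.comp hφ)] at h1 h2
  rw [hmeas] at h1
  exact h1.symm.trans h2

end Poisson

/-! ### Expected integrals over thinned points -/

theorem measurable_coe_nnreal : Measurable fun x : ℝ≥0 => (x : ℝ) :=
  NNReal.continuous_coe.measurable

section Campbell

variable {Ω : Type*} [mΩ : MeasurableSpace Ω] {P : Kernel Ω State} {ν : Measure ℝ} {μ : Measure Ω}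

theorem measurable_fst_predictable (P : Kernel Ω State) :
    Measurable[(poissonFiltration P).predictable] (Prod.fst : ℝ≥0 × Ω → ℝ≥0) := by
  let : MeasurableSpace (ℝ≥0 × Ω) := (poissonFiltration P).predictable
  refine measurable_of_Ioi fun a => ?_
  have : (Prod.fst : ℝ≥0 × Ω → ℝ≥0) ⁻¹' Ioi a = Ioi a ×ˢ univ := by ext; simp
  rw [this]
  exact measurableSet_predictable_Ioi_prod MeasurableSet.univ

/-- Campbell's formula for the points whose height is accepted by a predictable rule. -/
theorem IsPoissonRandomMeasure.campbell_accept [IsProbabilityMeasure μ] [IsProbabilityMeasure ν]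
    (hP : IsPoissonRandomMeasure P ν μ) {E : Type*} [MeasurableSpace E] {Φ : ℝ≥0 × Ω → E}
    (hΦ : Measurable[(poissonFiltration P).predictable] Φ) {A : Set (E × ℝ≥0)}
    (hA : MeasurableSet A) {c : ℝ≥0 → ℝ≥0∞} (hc : Measurable c) {g : ℝ → ℝ≥0∞}
    (hg : Measurable g) :
    ∫⁻ ω, ∫⁻ z in {z : State | (Φ (z.1, ω), z.2.1) ∈ A}, c z.1 * g z.2.2 ∂(P ω) ∂μ
      = (∫⁻ s, c s * ∫⁻ ω, lebesgueNN {θ | (Φ (s, ω), θ) ∈ A} ∂μ ∂lebesgueNN)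
        * ∫⁻ y, g y ∂ν := by
  have hΦ' : Measurable Φ := hΦ.mono (predictable_le P) le_rfl
  let H : (ℝ≥0 × E) × (ℝ≥0 × ℝ) → ℝ≥0∞ := fun x =>
    ((fun x : (ℝ≥0 × E) × (ℝ≥0 × ℝ) => (x.1.2, x.2.1)) ⁻¹' A).indicator
      (fun x => c x.1.1 * g x.2.2) x
  have hpre : MeasurableSet ((fun x : (ℝ≥0 × E) × (ℝ≥0 × ℝ) => (x.1.2, x.2.1)) ⁻¹' A) :=
    (measurable_fst.snd.prodMk measurable_snd.fst) hA
  have hH : Measurable H :=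
    ((hc.comp measurable_fst.fst).mul (hg.comp measurable_snd.snd)).indicator hpre
  have hΦ2 : Measurable[(poissonFiltration P).predictable] fun x : ℝ≥0 × Ω => (x.1, Φ x) :=
    (measurable_fst_predictable P).prodMk hΦ
  have hset : ∀ ω, MeasurableSet {z : State | (Φ (z.1, ω), z.2.1) ∈ A} := fun ω =>
    ((hΦ'.comp (measurable_fst.prodMk measurable_const)).prodMk measurable_snd.fst) hA
  have key := hP.campbell hΦ2 hH
  have hl : ∀ ω, ∫⁻ z in {z : State | (Φ (z.1, ω), z.2.1) ∈ A}, c z.1 * g z.2.2 ∂(P ω)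
      = ∫⁻ z, H ((z.1, Φ (z.1, ω)), z.2) ∂(P ω) := by
    intro ω
    rw [← lintegral_indicator (hset ω)]
    rfl
  simp_rw [hl]
  rw [key]
  have hsec : Measurable fun x : ℝ≥0 × Ω => lebesgueNN {θ | (Φ x, θ) ∈ A} :=
    (measurable_measure_prodMk_left hA).comp hΦ'
  have hr : ∀ ω, ∫⁻ z, H ((z.1, Φ (z.1, ω)), z.2) ∂(intensityMeasure ν)
      = (∫⁻ s, c s * lebesgueNN {θ | (Φ (s, ω), θ) ∈ A} ∂lebesgueNN) * ∫⁻ y, g y ∂ν := by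
    intro ω
    rw [lintegral_intensityMeasure ν (f := fun z => H ((z.1, Φ (z.1, ω)), z.2))
      (hH.comp ((measurable_fst.prodMk
        (hΦ'.comp (measurable_fst.prodMk measurable_const))).prodMk measurable_snd)),
      ← lintegral_mul_const]
    · refine lintegral_congr fun s => ?_
      have h1 : ∀ θ : ℝ≥0, ∫⁻ y, H ((s, Φ (s, ω)), (θ, y)) ∂ν
          = {θ | (Φ (s, ω), θ) ∈ A}.indicator (fun _ => c s * ∫⁻ y, g y ∂ν) θ := by
        intro θ
        by_cases hθ : (Φ (s, ω), θ) ∈ A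
        · rw [indicator_of_mem (by exact hθ), ← lintegral_const_mul _ hg]
          refine lintegral_congr fun y => ?_
          exact indicator_of_mem (by exact hθ) _
        · rw [indicator_of_notMem (by exact hθ), ← lintegral_zero (μ := ν)]
          refine lintegral_congr fun y => ?_
          exact indicator_of_notMem (by exact hθ) _
      simp_rw [h1]
      rw [lintegral_indicator (s := {θ | (Φ (s, ω), θ) ∈ A}) (measurable_prodMk_left hA),
        setLIntegral_const]
      ring
    · exact hc.mul (hsec.comp (measurable_id.prodMk measurable_const))
  simp_rw [hr]
  have hm2 : Measurable fun x : Ω × ℝ≥0 => c x.2 * lebesgueNN {θ | (Φ (x.2, x.1), θ) ∈ A} :=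
    (hc.comp measurable_snd).mul (hsec.comp measurable_swap)
  rw [lintegral_mul_const _ hm2.lintegral_prod_right', lintegral_lintegral_swap hm2.aemeasurable]
  congr 1
  refine lintegral_congr fun s => ?_
  exact lintegral_const_mul (c s) (f := fun ω => lebesgueNN {θ | (Φ (s, ω), θ) ∈ A})
    (hsec.comp (measurable_const.prodMk measurable_id))

/-- The points below a predictable height `X` arrive at rate `X⁺`. -/
theorem IsPoissonRandomMeasure.lintegral_below [IsProbabilityMeasure μ] [IsProbabilityMeasure ν]
    (hP : IsPoissonRandomMeasure P ν μ) {X : ℝ≥0 → Ω → ℝ}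
    (hX : Measurable[(poissonFiltration P).predictable] (Function.uncurry X))
    {c : ℝ≥0 → ℝ≥0∞} (hc : Measurable c) {g : ℝ → ℝ≥0∞} (hg : Measurable g) :
    ∫⁻ ω, ∫⁻ z in {z : State | (z.2.1 : ℝ) ≤ X z.1 ω}, c z.1 * g z.2.2 ∂(P ω) ∂μ
      = (∫⁻ s, c s * ∫⁻ ω, ENNReal.ofReal (X s ω) ∂μ ∂lebesgueNN) * ∫⁻ y, g y ∂ν := by
  have hA : MeasurableSet {x : ℝ × ℝ≥0 | (x.2 : ℝ) ≤ x.1} :=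
    measurableSet_le (measurable_coe_nnreal.comp measurable_snd) measurable_fst
  have := hP.campbell_accept hX hA hc hg
  simp only [mem_ofPred_eq, Function.uncurry_apply_pair, lebesgueNN_setOf_coe_le] at this
  exact this

/-- The points accepted by exactly one of two predictable heights `X` and `Y` arrive at rate at most
`|X - Y|`. -/
theorem IsPoissonRandomMeasure.lintegral_disagree_le [IsProbabilityMeasure μ]
    [IsProbabilityMeasure ν] (hP : IsPoissonRandomMeasure P ν μ) {X Y : ℝ≥0 → Ω → ℝ}
    (hX : Measurable[(poissonFiltration P).predictable] (Function.uncurry X))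
    (hY : Measurable[(poissonFiltration P).predictable] (Function.uncurry Y))
    {c : ℝ≥0 → ℝ≥0∞} (hc : Measurable c) {g : ℝ → ℝ≥0∞} (hg : Measurable g) :
    ∫⁻ ω, ∫⁻ z in {z : State | ¬((z.2.1 : ℝ) ≤ X z.1 ω ↔ (z.2.1 : ℝ) ≤ Y z.1 ω)},
        c z.1 * g z.2.2 ∂(P ω) ∂μ
      ≤ (∫⁻ s, c s * ∫⁻ ω, ENNReal.ofReal |X s ω - Y s ω| ∂μ ∂lebesgueNN) * ∫⁻ y, g y ∂ν := by
  have hA : MeasurableSet {x : (ℝ × ℝ) × ℝ≥0 | ¬((x.2 : ℝ) ≤ x.1.1 ↔ (x.2 : ℝ) ≤ x.1.2)} :=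
    ((measurableSet_le (measurable_coe_nnreal.comp measurable_snd) measurable_fst.fst).iff
      (measurableSet_le (measurable_coe_nnreal.comp measurable_snd) measurable_fst.snd)).compl
  have := hP.campbell_accept (hX.prodMk hY) hA hc hg
  simp only [mem_ofPred_eq, Function.uncurry_apply_pair] at this
  rw [this]
  gcongr
  exact lebesgueNN_disagree_le _ _

/-- Almost surely all masses of `P` are integers; only the resulting gap between `0` and `1` is
recorded. Integrality on a countable algebra passes to all Borel sets by density. -/
theorem IsPoissonRandomMeasure.ae_eq_zero_of_lt_one [IsProbabilityMeasure ν]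
    (hP : IsPoissonRandomMeasure P ν μ) :
    ∀ᵐ ω ∂μ, ∀ B : Set State, MeasurableSet B → P ω B < 1 → P ω B = 0 := by
  obtain ⟨S, hSc, hSg⟩ := MeasurableSpace.CountablyGenerated.isCountablyGenerated (α := State)
  let 𝒜 := generateSetAlgebra S
  have h𝒜c : 𝒜.Countable := countable_generateSetAlgebra hSc
  have h𝒜g : (inferInstance : MeasurableSpace State) = MeasurableSpace.generateFrom 𝒜 := by
    rw [generateFrom_generateSetAlgebra_eq, ← hSg]
  have h𝒜m : ∀ A ∈ 𝒜, MeasurableSet A := by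
    intro A hA
    have : MeasurableSet[MeasurableSpace.generateFrom 𝒜] A :=
      MeasurableSpace.measurableSet_generateFrom hA
    rwa [← h𝒜g] at this
  have hint : ∀ᵐ ω ∂μ, ∀ A ∈ 𝒜, ∀ n : ℕ, P ω (A ∩ box n) ∈ range (Nat.cast : ℕ → ℝ≥0∞) := by
    rw [ae_ball_iff h𝒜c]
    intro A hA
    rw [ae_all_iff]
    intro n
    have hm : MeasurableSet (A ∩ box n) := (h𝒜m A hA).inter (measurableSet_box n)
    have hfin : intensityMeasure ν (A ∩ box n) ≠ ⊤ := by
      refine ne_top_of_le_ne_top ?_ (measure_mono inter_subset_right)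
      rw [intensityMeasure_box]
      exact ENNReal.mul_ne_top (by simp) (by simp)
    have hlaw := hP.law _ hm hfin
    have hr : MeasurableSet (range (Nat.cast : ℕ → ℝ≥0∞)) := (countable_range _).measurableSet
    have h1 : ∀ᵐ x ∂(μ.map fun ω => P ω (A ∩ box n)), x ∈ range (Nat.cast : ℕ → ℝ≥0∞) := by
      rw [hlaw]
      exact (ae_map_iff (measurable_from_top).aemeasurable hr).2
        (Eventually.of_forall fun k => mem_range_self k)
    exact ae_of_ae_map (Kernel.measurable_coe P hm).aemeasurable h1
  filter_upwards [hint] with ω hω B hB hlt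
  have hbox : ∀ n, P ω (B ∩ box n) = 0 := by
    intro n
    have : IsFiniteMeasure ((P ω).restrict (box n)) :=
      ⟨by rw [Measure.restrict_apply_univ]; exact hP.locallyFinite ω n⟩
    set m := (P ω).restrict (box n)
    have hdense := Measure.MeasureDense.of_generateFrom_isSetAlgebra_finite m
      (isSetAlgebra_generateSetAlgebra (𝒜 := S)) h𝒜g
    have hcl : m.real B ∈ closure (range (Nat.cast : ℕ → ℝ)) := by
      rw [Metric.mem_closure_iff]
      intro ε hε
      obtain ⟨A, hA, hAε⟩ := hdense.approx B hB (measure_ne_top m B) ε hε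
      refine ⟨m.real A, ?_, ?_⟩
      · obtain ⟨k, hk⟩ := hω A hA n
        refine ⟨k, ?_⟩
        rw [measureReal_def, Measure.restrict_apply (h𝒜m A hA), ← hk, ENNReal.toReal_natCast]
      · rw [Real.dist_eq]
        refine (abs_measureReal_sub_le_measureReal_symmDiff hB.nullMeasurableSet
          (h𝒜m A hA).nullMeasurableSet).trans_lt ?_
        rw [measureReal_def]
        exact (ENNReal.toReal_lt_of_lt_ofReal hAε)
    rw [Nat.isClosedEmbedding_coe_real.isClosed_range.closure_eq] at hcl
    obtain ⟨k, hk⟩ := hcl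
    have hmB : m B = P ω (B ∩ box n) := Measure.restrict_apply hB
    have hlt1 : m.real B < 1 := by
      rw [measureReal_def, hmB]
      refine ENNReal.toReal_lt_of_lt_ofReal ?_
      rw [ENNReal.ofReal_one]
      exact (measure_mono inter_subset_left).trans_lt hlt
    rw [← hk] at hlt1
    have hk0 : k = 0 := by
      have : k < 1 := by exact_mod_cast hlt1
      omega
    rw [hk0, Nat.cast_zero] at hk
    rw [← hmB]
    exact (measureReal_eq_zero_iff (measure_ne_top m B)).1 hk.symm
  have : B = ⋃ n, B ∩ box n := by rw [← inter_iUnion, iUnion_box, inter_univ]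
  rw [this]
  exact measure_iUnion_null hbox

theorem IsPoissonRandomMeasure.ae_lintegral_box_lt_top [IsProbabilityMeasure μ]
    [IsProbabilityMeasure ν] (hP : IsPoissonRandomMeasure P ν μ) {g : ℝ → ℝ≥0∞}
    (hg : Measurable g) (hfin : ∫⁻ y, g y ∂ν ≠ ⊤) :
    ∀ᵐ ω ∂μ, ∀ n : ℕ, ∫⁻ z in box n, g z.2.2 ∂(P ω) < ⊤ := by
  have := hP.isSFiniteKernel
  rw [ae_all_iff]
  intro n
  have hA : MeasurableSet {x : ℝ≥0 × ℝ≥0 | x.1 ≤ (n : ℝ≥0) ∧ x.2 ≤ (n : ℝ≥0)} :=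
    (measurable_fst measurableSet_Iic).inter (measurable_snd measurableSet_Iic)
  have key := hP.campbell_accept (measurable_fst_predictable P) hA
    (measurable_const (a := (1 : ℝ≥0∞))) hg
  have hbox : ∀ z : State, z ∈ {z : State | (z.1, z.2.1) ∈ {x : ℝ≥0 × ℝ≥0 | x.1 ≤ (n : ℝ≥0) ∧ x.2 ≤ (n : ℝ≥0)}}
      ↔ z ∈ box n := by
    intro z
    simp [box]
  simp only [one_mul] at key
  rw [show {z : State | (z.1, z.2.1) ∈ {x : ℝ≥0 × ℝ≥0 | x.1 ≤ (n : ℝ≥0) ∧ x.2 ≤ (n : ℝ≥0)}} = box n from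
    Set.ext hbox] at key
  refine ae_lt_top ?_ ?_
  · exact (hg.comp measurable_snd.snd).setLIntegral_kernel (measurableSet_box n)
  · rw [key]
    refine ENNReal.mul_ne_top ?_ hfin
    have hle : ∀ s : ℝ≥0, ∫⁻ _ : Ω, lebesgueNN {θ : ℝ≥0 | (s, θ) ∈ {x : ℝ≥0 × ℝ≥0 | x.1 ≤ (n : ℝ≥0) ∧ x.2 ≤ (n : ℝ≥0)}} ∂μ
        = (Iic (n : ℝ≥0)).indicator (fun _ => (n : ℝ≥0∞)) s := by
      intro s
      rw [lintegral_const, measure_univ, mul_one]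
      by_cases hs : s ≤ n
      · rw [indicator_of_mem (by exact hs)]
        simp only [mem_ofPred_eq, hs, true_and]
        have := lebesgueNN_Iic n
        simpa [Iic] using this
      · rw [indicator_of_notMem (by exact hs)]
        simp [hs]
    simp_rw [hle]
    rw [lintegral_indicator measurableSet_Iic, setLIntegral_const, lebesgueNN_Iic]
    exact ENNReal.mul_ne_top (by simp) (by simp)

/-- A set of finitely many points is, up to a null set, contained in a box: the mass outside
the `n`-th box tends to zero and is an integer. Integrals over it are therefore finite. -/
theorem setLIntegral_lt_top_of_measure_lt_top {m : Measure State}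
    (h01 : ∀ B : Set State, MeasurableSet B → m B < 1 → m B = 0) {g : ℝ → ℝ≥0∞}
    (hbox : ∀ n : ℕ, ∫⁻ z in box n, g z.2.2 ∂m < ⊤) {A : Set State}
    (hA : MeasurableSet A) (hfin : m A < ⊤) :
    ∫⁻ z in A, g z.2.2 ∂m < ⊤ := by
  have hlim : Tendsto (fun n : ℕ => m (A ∩ (box n)ᶜ)) atTop (𝓝 (m (⋂ n : ℕ, A ∩ (box n)ᶜ))) := by
    refine tendsto_measure_iInter_atTop
      (fun n => (hA.inter (measurableSet_box n).compl).nullMeasurableSet) ?_ ?_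
    · exact fun i j hij => inter_subset_inter_right _ (compl_subset_compl.2 (box_mono hij))
    · exact ⟨0, ne_top_of_le_ne_top hfin.ne (measure_mono inter_subset_left)⟩
  have hempty : ⋂ n : ℕ, A ∩ (box n)ᶜ = ∅ := by
    rw [← inter_iInter, ← compl_iUnion, iUnion_box, compl_univ, inter_empty]
  rw [hempty, measure_empty] at hlim
  obtain ⟨n, hn⟩ := (hlim.eventually (gt_mem_nhds zero_lt_one)).exists
  have h0 := h01 _ (hA.inter (measurableSet_box n).compl) hn
  have hsplit : A = (A ∩ box n) ∪ (A ∩ (box n)ᶜ) := (inter_union_compl A _).symm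
  rw [hsplit]
  refine (lintegral_union_le _ _ _).trans_lt ?_
  rw [setLIntegral_measure_zero _ _ h0, add_zero]
  exact (lintegral_mono_set inter_subset_right).trans_lt (hbox n)

end Campbell

/-! ### Predictability of the thinned intensities -/

/-- If the masses of all sets of points in the time window `(0, q]` are measurable for a given
σ-algebra, then so are integrals over the part of the window that lies below a measurable height. -/
theorem measurable_setLIntegral_below {Ω : Type*} [MeasurableSpace Ω] {P : Ω → Measure State}
    (hfin : ∀ ω n, P ω (box n) < ⊤) {q : ℝ≥0}
    (hrect : ∀ (A : Set ℝ≥0) (S : Set (ℝ≥0 × ℝ)), MeasurableSet A → MeasurableSet S →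
      A ⊆ Ioc 0 q → Measurable fun ω => P ω (A ×ˢ S))
    {X : Ω → ℝ≥0 → ℝ} (hX : Measurable (Function.uncurry X)) {f : State → ℝ≥0∞}
    (hf : Measurable f) :
    Measurable fun ω => ∫⁻ z in {z : State | 0 < z.1 ∧ z.1 ≤ q ∧ (z.2.1 : ℝ) ≤ X ω z.1},
      f z ∂(P ω) := by
  let W : Set State := Ioc 0 q ×ˢ univ
  have hW : MeasurableSet W := measurableSet_Ioc.prod MeasurableSet.univ
  have hbox : ∀ n : ℕ, Measurable fun ω => ((P ω).restrict W).restrict (box n) := by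
    intro n
    have : ∀ ω, IsFiniteMeasure (((P ω).restrict W).restrict (box n)) := fun ω =>
      ⟨by
        rw [Measure.restrict_apply_univ]
        exact (Measure.restrict_apply_le _ _).trans_lt (hfin ω n)⟩
    have hr : ∀ (A : Set ℝ≥0) (S : Set (ℝ≥0 × ℝ)), MeasurableSet A → MeasurableSet S →
        Measurable fun ω => (((P ω).restrict W).restrict (box n)) (A ×ˢ S) := by
      intro A S hA hS
      have h1 : ∀ ω, (((P ω).restrict W).restrict (box n)) (A ×ˢ S)
          = P ω ((A ∩ Iic (n : ℝ≥0) ∩ Ioc 0 q) ×ˢ (S ∩ (Iic (n : ℝ≥0) ×ˢ univ))) := by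
        intro ω
        rw [Measure.restrict_apply (hA.prod hS),
          Measure.restrict_apply ((hA.prod hS).inter (measurableSet_box n)), box,
          prod_inter_prod, prod_inter_prod, inter_univ]
      simp_rw [h1]
      exact hrect _ _ ((hA.inter measurableSet_Iic).inter measurableSet_Ioc)
        (hS.inter (measurableSet_Iic.prod MeasurableSet.univ)) inter_subset_right
    refine Measurable.measure_of_isPiSystem generateFrom_prod.symm isPiSystem_prod ?_ ?_
    · rintro _ ⟨A, hA, S, hS, rfl⟩
      exact hr A S hA hS
    · rw [← univ_prod_univ]
      exact hr _ _ MeasurableSet.univ MeasurableSet.univ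
  have hκm : Measurable fun ω => (P ω).restrict W := by
    refine Measure.measurable_of_measurable_coe _ fun B hB => ?_
    have h1 : ∀ ω, (P ω).restrict W B = ⨆ n, (((P ω).restrict W).restrict (box n)) B := by
      intro ω
      simp_rw [Measure.restrict_apply (μ := (P ω).restrict W) hB]
      rw [← Monotone.measure_iUnion, ← inter_iUnion, iUnion_box, inter_univ]
      exact fun m n hmn => inter_subset_inter_right _ (box_mono hmn)
    simp_rw [h1]
    exact Measurable.iSup fun n => (Measure.measurable_coe hB).comp (hbox n)
  let κ : Kernel Ω State := ⟨fun ω => (P ω).restrict W, hκm⟩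
  have hκ : IsSFiniteKernel κ :=
    isSFiniteKernel_of_iUnion κ box measurableSet_box iUnion_box fun ω n =>
      (Measure.restrict_apply_le _ _).trans_lt (hfin ω n)
  let B : Set (Ω × State) := {x | (x.2.2.1 : ℝ) ≤ X x.1 x.2.1}
  have hB : MeasurableSet B :=
    measurableSet_le (measurable_coe_nnreal.comp measurable_snd.snd.fst)
      (hX.comp (measurable_fst.prodMk measurable_snd.fst))
  have key : Measurable fun ω => ∫⁻ z, B.indicator (fun x => f x.2) (ω, z) ∂(κ ω) :=
    Measurable.lintegral_kernel_prod_right' (((hf.comp measurable_snd)).indicator hB)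
  refine Eq.subst (motive := fun g => Measurable g) ?_ key
  funext ω
  have hBω : MeasurableSet (Prod.mk ω ⁻¹' B) := measurable_prodMk_left hB
  have hset : {z : State | 0 < z.1 ∧ z.1 ≤ q ∧ (z.2.1 : ℝ) ≤ X ω z.1}
      = (Prod.mk ω ⁻¹' B) ∩ W := by
    ext z
    simp only [mem_ofPred_eq, mem_inter_iff, mem_preimage, B, W, mem_prod, mem_Ioc, mem_univ]
    tauto
  rw [hset, ← Measure.restrict_restrict hBω, ← lintegral_indicator hBω]
  rfl

section Processes

variable {Ω : Type*} [mΩ : MeasurableSpace Ω] {P : Kernel Ω State} {ν : Measure ℝ} {μ : Measure Ω}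

theorem measurable_rect_poissonFiltration (P : Kernel Ω State) (q : ℝ≥0) (A : Set ℝ≥0)
    (S : Set (ℝ≥0 × ℝ)) (hA : MeasurableSet A) (hS : MeasurableSet S) (hAq : A ⊆ Ioc 0 q) :
    Measurable[poissonFiltration P q] fun ω => P ω (A ×ˢ S) := by
  rw [measurable_iff_comap_le]
  exact le_iSup_of_le A <| le_iSup_of_le S <| le_iSup_of_le hA <| le_iSup_of_le hS <|
    le_iSup_of_le hAq le_rfl

/-- The mark mass accepted strictly before time `s`:
`∫_{(0,s) × ℝ₊ × ℝ} b y 1_{θ ≤ lam u} P(du, dθ, dy)`. -/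
noncomputable def acceptedMass (P : Kernel Ω State) (b : ℝ → ℝ) (lam : ℝ≥0 → Ω → ℝ) (s : ℝ≥0)
    (ω : Ω) : ℝ≥0∞ :=
  ∫⁻ z in {z : State | 0 < z.1 ∧ z.1 < s ∧ (z.2.1 : ℝ) ≤ lam z.1 ω}, ENNReal.ofReal (b z.2.2) ∂(P ω)

theorem acceptedMass_mono (b : ℝ → ℝ) (lam : ℝ≥0 → Ω → ℝ) (ω : Ω) :
    Monotone fun s => acceptedMass P b lam s ω := by
  intro s t hst
  exact lintegral_mono_set fun z hz => ⟨hz.1, hz.2.1.trans_le hst, hz.2.2⟩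

theorem measurable_acceptedMass (hP : IsPoissonRandomMeasure P ν μ) {b : ℝ → ℝ} (hb : Measurable b)
    {lam : ℝ≥0 → Ω → ℝ} (hlam : IsStronglyPredictable (poissonFiltration P) lam) (q : ℝ≥0) :
    Measurable[poissonFiltration P q] (acceptedMass P b lam q) := by
  have hprog := (hlam.isStronglyProgressive q).measurable
  have hX : @Measurable _ _ (@Prod.instMeasurableSpace _ _ (poissonFiltration P q) _) _
      (Function.uncurry fun (ω : Ω) (u : ℝ≥0) => lam (min u q) ω) := by
    let : MeasurableSpace Ω := poissonFiltration P q
    have : Measurable fun x : Ω × ℝ≥0 => ((⟨min x.2 q, mem_Iic.2 (min_le_right _ _)⟩ : Iic q), x.1) :=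
      ((measurable_snd.min measurable_const).subtype_mk).prodMk measurable_fst
    exact hprog.comp this
  have hf : Measurable fun z : State =>
      {z : State | z.1 < q}.indicator (fun z => ENNReal.ofReal (b z.2.2)) z :=
    (hb.comp measurable_snd.snd).ennreal_ofReal.indicator (measurable_fst measurableSet_Iio)
  have key := @measurable_setLIntegral_below Ω (poissonFiltration P q) (fun ω => P ω)
    hP.locallyFinite q (measurable_rect_poissonFiltration P q) _ hX _ hf
  refine Eq.subst (motive := fun g => Measurable[poissonFiltration P q] g) ?_ key
  funext ω
  rw [setLIntegral_indicator (s := {z : State | z.1 < q}) (measurable_fst measurableSet_Iio),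
    acceptedMass]
  congr 2
  ext z
  simp only [mem_inter_iff, mem_ofPred_eq]
  constructor
  · rintro ⟨h1, h2, h3, h4⟩
    exact ⟨h2, h1, by rwa [min_eq_left h3] at h4⟩
  · rintro ⟨h1, h2, h3⟩
    exact ⟨h2, h1, h2.le, by rwa [min_eq_left h2.le]⟩

/-- Left-continuity of the accepted mass in time. -/
theorem exists_lt_of_lt_acceptedMass {b : ℝ → ℝ} {lam : ℝ≥0 → Ω → ℝ} {s : ℝ≥0} {ω : Ω} {a : ℝ≥0∞}
    (h : a < acceptedMass P b lam s ω) : ∃ q < s, a < acceptedMass P b lam q ω := by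
  rcases eq_or_lt_of_le (zero_le (a := s)) with h0 | h0
  · exfalso
    have : acceptedMass P b lam s ω = 0 := by
      have he : {z : State | 0 < z.1 ∧ z.1 < s ∧ (z.2.1 : ℝ) ≤ lam z.1 ω} = ∅ := by
        ext z
        simp only [mem_ofPred_eq, mem_empty_iff_false, iff_false, not_and]
        intro h1 h2
        rw [← h0] at h2
        exact absurd h2 (not_lt_of_ge zero_le)
      rw [acceptedMass, he, Measure.restrict_empty, lintegral_zero_measure]
    rw [this] at h
    exact absurd h not_lt_zero
  · obtain ⟨u, hu, hus, hut⟩ := exists_seq_strictMono_tendsto' h0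
    have hU : {z : State | 0 < z.1 ∧ z.1 < s ∧ (z.2.1 : ℝ) ≤ lam z.1 ω}
        = ⋃ n, {z : State | 0 < z.1 ∧ z.1 < u n ∧ (z.2.1 : ℝ) ≤ lam z.1 ω} := by
      ext z
      simp only [mem_ofPred_eq, mem_iUnion]
      constructor
      · rintro ⟨h1, h2, h3⟩
        obtain ⟨n, hn⟩ := (hut.eventually (lt_mem_nhds h2)).exists
        exact ⟨n, h1, hn, h3⟩
      · rintro ⟨n, h1, h2, h3⟩
        exact ⟨h1, h2.trans (hus n).2, h3⟩
    have hdir : Directed (· ⊆ ·)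
        fun n => {z : State | 0 < z.1 ∧ z.1 < u n ∧ (z.2.1 : ℝ) ≤ lam z.1 ω} :=
      Monotone.directed_le fun m n hmn z hz => ⟨hz.1, hz.2.1.trans_le (hu.monotone hmn), hz.2.2⟩
    rw [acceptedMass, hU, setLIntegral_iUnion_of_directed _ hdir, lt_iSup_iff] at h
    obtain ⟨n, hn⟩ := h
    exact ⟨u n, (hus n).2, hn⟩

/-- Accumulated mass is nondecreasing and left-continuous, so its upper level sets are unions of
countably many predictable rectangles. -/
theorem measurableSet_acceptedMass_le (hP : IsPoissonRandomMeasure P ν μ) {b : ℝ → ℝ}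
    (hb : Measurable b) {lam : ℝ≥0 → Ω → ℝ}
    (hlam : IsStronglyPredictable (poissonFiltration P) lam) (a : ℝ≥0∞) :
    MeasurableSet[(poissonFiltration P).predictable]
      {x : ℝ≥0 × Ω | acceptedMass P b lam x.1 x.2 ≤ a} := by
  obtain ⟨Q, hQc, hQd⟩ := TopologicalSpace.exists_countable_dense ℝ≥0
  have h1 : {x : ℝ≥0 × Ω | acceptedMass P b lam x.1 x.2 ≤ a}ᶜ
      = ⋃ q ∈ Q, Ioi q ×ˢ {ω | a < acceptedMass P b lam q ω} := by
    ext x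
    simp only [mem_compl_iff, mem_ofPred_eq, not_le, mem_iUnion, mem_prod, mem_Ioi, exists_prop]
    constructor
    · intro h
      obtain ⟨q, hq, hqa⟩ := exists_lt_of_lt_acceptedMass h
      obtain ⟨r, hr, hqr, hrs⟩ := hQd.exists_between hq
      exact ⟨r, hr, hrs, hqa.trans_le (acceptedMass_mono b lam _ hqr.le)⟩
    · rintro ⟨q, -, hq, hqa⟩
      exact hqa.trans_le (acceptedMass_mono b lam _ hq.le)
  rw [← MeasurableSet.compl_iff, h1]
  refine MeasurableSet.biUnion hQc fun q _ => measurableSet_predictable_Ioi_prod ?_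
  exact measurable_acceptedMass hP hb hlam q measurableSet_Ioi

/-- The intensity killed once the accepted mark mass exceeds `n`; the value `-1` lies below every
height, so that no point is accepted afterwards. -/
noncomputable def localizedIntensity (P : Kernel Ω State) (b : ℝ → ℝ) (lam : ℝ≥0 → Ω → ℝ) (n : ℕ)
    (s : ℝ≥0) (ω : Ω) : ℝ :=
  open Classical in if acceptedMass P b lam s ω ≤ n then lam s ω else -1

theorem measurable_localizedIntensity (hP : IsPoissonRandomMeasure P ν μ) {b : ℝ → ℝ}
    (hb : Measurable b) {lam : ℝ≥0 → Ω → ℝ}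
    (hlam : IsStronglyPredictable (poissonFiltration P) lam) (n : ℕ) :
    Measurable[(poissonFiltration P).predictable]
      (Function.uncurry (localizedIntensity P b lam n)) := by
  let : MeasurableSpace (ℝ≥0 × Ω) := (poissonFiltration P).predictable
  exact Measurable.ite (measurableSet_acceptedMass_le hP hb hlam n) hlam.measurable
    measurable_const

/-- The `n`-th discrete intensity is known at time `(n - 1)Δ`, the beginning of the `n`-th bin. -/
theorem measurable_discIntensity (hP : IsPoissonRandomMeasure P ν μ) {h ψ b : ℝ → ℝ}
    (hψ : Measurable ψ) (hb : Measurable b) (hb0 : ∀ y, 0 ≤ b y) {Δ : ℝ≥0} (n : ℕ) :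
    Measurable[poissonFiltration P ((n - 1 : ℕ) * Δ)] fun ω => discIntensity P h ψ b Δ ω n := by
  induction n using Nat.strong_induction_on with
  | _ n ih =>
  have heq : (fun ω => discIntensity P h ψ b Δ ω n) = fun ω =>
      ψ (∑ k : Fin n, if (k : ℕ) = 0 then 0 else h (((n : ℝ) - ((k : ℕ) : ℝ)) * Δ) *
        ∫ z in binBelow Δ k (discIntensity P h ψ b Δ ω k), b z.2.2 ∂(P ω)) := by
    funext ω
    rw [discIntensity]
  rw [heq]
  refine hψ.comp (Finset.measurable_sum _ fun k _ => ?_)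
  by_cases hk : (k : ℕ) = 0
  · simp only [hk, if_true]
    exact measurable_const
  simp only [hk, if_false]
  refine Measurable.const_mul ?_ _
  have hk1 : 1 ≤ (k : ℕ) := Nat.one_le_iff_ne_zero.2 hk
  have hkn : ((k : ℕ) : ℝ≥0) * Δ ≤ ((n - 1 : ℕ) : ℝ≥0) * Δ := by
    have : (k : ℕ) ≤ n - 1 := by have := k.2; omega
    gcongr
  have hkk : (((k : ℕ) - 1 : ℕ) : ℝ≥0) * Δ ≤ ((k : ℕ) : ℝ≥0) * Δ := by
    gcongr
    exact Nat.sub_le _ _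
  refine Measurable.mono ?_ ((poissonFiltration P).mono hkn) le_rfl
  have hl : Measurable[poissonFiltration P ((k : ℕ) * Δ)]
      fun ω => discIntensity P h ψ b Δ ω k :=
    (ih k k.2).mono ((poissonFiltration P).mono hkk) le_rfl
  have hX : @Measurable _ _ (@Prod.instMeasurableSpace _ _ (poissonFiltration P ((k : ℕ) * Δ)) _) _
      (Function.uncurry fun (ω : Ω) (_ : ℝ≥0) => discIntensity P h ψ b Δ ω k) := by
    let : MeasurableSpace Ω := poissonFiltration P ((k : ℕ) * Δ)
    exact hl.comp measurable_fst
  have hs : MeasurableSet {z : State | ((((k : ℕ) - 1 : ℕ) : ℝ≥0) * Δ) < z.1} :=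
    measurable_fst measurableSet_Ioi
  have hf : Measurable fun z : State => {z : State | ((((k : ℕ) - 1 : ℕ) : ℝ≥0) * Δ) < z.1}.indicator
      (fun z => ENNReal.ofReal (b z.2.2)) z :=
    (hb.comp measurable_snd.snd).ennreal_ofReal.indicator hs
  have key := @measurable_setLIntegral_below Ω (poissonFiltration P ((k : ℕ) * Δ)) (fun ω => P ω)
    hP.locallyFinite _ (measurable_rect_poissonFiltration P _) _ hX _ hf
  refine Eq.subst (motive := fun g => Measurable[poissonFiltration P ((k : ℕ) * Δ)] g) ?_
    key.ennreal_toReal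
  funext ω
  rw [integral_eq_lintegral_of_nonneg_ae (Eventually.of_forall fun z => hb0 _)
    (hb.comp measurable_snd.snd).aestronglyMeasurable, setLIntegral_indicator hs]
  congr 3
  ext z
  have e1 : ((((k : ℕ) - 1 : ℕ) : ℝ≥0) * Δ < z.1) ↔ (((k : ℕ) : ℝ) - 1) * Δ < z.1 := by
    rw [← NNReal.coe_lt_coe]
    rw [NNReal.coe_mul, NNReal.coe_natCast, Nat.cast_sub hk1, Nat.cast_one]
  have e2 : (z.1 ≤ ((k : ℕ) : ℝ≥0) * Δ) ↔ (z.1 : ℝ) ≤ ((k : ℕ) : ℝ) * Δ := by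
    rw [← NNReal.coe_le_coe, NNReal.coe_mul, NNReal.coe_natCast]
  simp only [binBelow, mem_inter_iff, mem_ofPred_eq, ← e1, ← e2]
  constructor
  · rintro ⟨h1, -, h2, h3⟩
    exact ⟨h1, h2, h3⟩
  · rintro ⟨h1, h2, h3⟩
    exact ⟨h1, zero_le.trans_lt h1, h2, h3⟩

/-- The piecewise constant process equal to the `k`-th discrete intensity on the `k`-th bin. -/
noncomputable def stepIntensity (P : Kernel Ω State) (h ψ b : ℝ → ℝ) (Δ : ℝ) (s : ℝ≥0) (ω : Ω) :
    ℝ :=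
  discIntensity P h ψ b Δ ω (binIdx Δ s)

theorem measurable_stepIntensity (hP : IsPoissonRandomMeasure P ν μ) {h ψ b : ℝ → ℝ}
    (hψ : Measurable ψ) (hb : Measurable b) (hb0 : ∀ y, 0 ≤ b y) {Δ : ℝ≥0} (hΔ : 0 < Δ) :
    Measurable[(poissonFiltration P).predictable]
      (Function.uncurry (stepIntensity P h ψ b Δ)) := by
  have hΔ' : (0 : ℝ) < Δ := hΔ
  intro S hS
  have hU : Function.uncurry (stepIntensity P h ψ b Δ) ⁻¹' S
      = (({⊥} : Set ℝ≥0) ×ˢ {ω | discIntensity P h ψ b Δ ω 0 ∈ S}) ∪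
        ⋃ k : ℕ, (Ioc ((k : ℝ≥0) * Δ) (((k + 1 : ℕ) : ℝ≥0) * Δ)) ×ˢ
          {ω | discIntensity P h ψ b Δ ω (k + 1) ∈ S} := by
    ext ⟨s, ω⟩
    simp only [mem_preimage, Function.uncurry_apply_pair, stepIntensity, mem_union, mem_prod,
      mem_singleton_iff, mem_ofPred_eq, mem_iUnion]
    have hk : ∀ k : ℕ, binIdx Δ s = k + 1 ↔ s ∈ Ioc ((k : ℝ≥0) * Δ) (((k + 1 : ℕ) : ℝ≥0) * Δ) := by
      intro k
      rw [binIdx_eq_iff hΔ' (by omega), mem_Ioc, ← NNReal.coe_lt_coe, ← NNReal.coe_le_coe]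
      push_cast
      rw [add_sub_cancel_right]
    have h0 : binIdx Δ s = 0 ↔ s = ⊥ := by
      rw [← Nat.le_zero, binIdx_le_iff hΔ', Nat.cast_zero, zero_mul, bot_eq_zero]
      exact ⟨fun h => le_antisymm (by exact_mod_cast h) zero_le, fun h => by simp [h]⟩
    simp_rw [← hk, ← h0]
    constructor
    · intro hm
      rcases hn : binIdx Δ s with _ | k
      · left; rw [hn] at hm; exact ⟨rfl, hm⟩
      · right; rw [hn] at hm; exact ⟨k, rfl, hm⟩
    · rintro (⟨h1, h2⟩ | ⟨k, h1, h2⟩)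
      · rwa [h1]
      · rwa [h1]
  rw [hU]
  refine MeasurableSet.union ?_ (MeasurableSet.iUnion fun k => ?_)
  · refine measurableSet_predictable_singleton_bot_prod ?_
    have := measurable_discIntensity (h := h) hP hψ hb hb0 (Δ := Δ) 0 hS
    have e : (((0 - 1 : ℕ) : ℝ≥0) * Δ) = ⊥ := by simp
    rw [e] at this
    exact this
  · refine measurableSet_predictable_Ioc_prod _ _ ?_
    exact measurable_discIntensity (h := h) hP hψ hb hb0 (Δ := Δ) (k + 1) hS

end Processes

/-! ### Moment bound for the intensity -/

/-- Solution of a scalar renewal inequality; finiteness of `x` is essential. -/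
theorem ennreal_le_div_of_le_add_mul {x : ℝ≥0∞} (hx : x ≠ ⊤) {a ρ : ℝ} (ha : 0 ≤ a) (hρ0 : 0 ≤ ρ)
    (hρ : ρ < 1) (h : x ≤ ENNReal.ofReal a + ENNReal.ofReal ρ * x) :
    x ≤ ENNReal.ofReal (a / (1 - ρ)) := by
  lift x to ℝ≥0 using hx
  rw [← ENNReal.ofReal_coe_nnreal, ← ENNReal.ofReal_mul hρ0, ← ENNReal.ofReal_add ha (by positivity),
    ENNReal.ofReal_le_ofReal_iff (by positivity)] at h
  rw [← ENNReal.ofReal_coe_nnreal]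
  refine ENNReal.ofReal_le_ofReal ?_
  rw [le_div_iff₀ (by linarith)]
  linarith

theorem ofReal_lipschitz_le {L : ℝ≥0} {ψ : ℝ → ℝ} (hψ : LipschitzWith L ψ) (x y : ℝ) :
    ENNReal.ofReal |ψ x - ψ y| ≤ L * ENNReal.ofReal |x - y| := by
  have := hψ x y
  rwa [edist_dist, edist_dist, Real.dist_eq, Real.dist_eq] at this

theorem ofReal_le_add_lipschitz {L : ℝ≥0} {ψ : ℝ → ℝ} (hψ : LipschitzWith L ψ) (x : ℝ) :
    ENNReal.ofReal (ψ x) ≤ ENNReal.ofReal (ψ 0) + L * ENNReal.ofReal |x| := by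
  have h1 := ofReal_lipschitz_le hψ x 0
  rw [sub_zero] at h1
  refine le_trans ?_ (add_le_add le_rfl h1)
  refine le_trans (ENNReal.ofReal_le_ofReal ?_) ENNReal.ofReal_add_le
  linarith [le_abs_self (ψ x - ψ 0)]

theorem ofReal_abs_integral_le {α : Type*} [MeasurableSpace α] (m : Measure α) (f : α → ℝ) :
    ENNReal.ofReal |∫ z, f z ∂m| ≤ ∫⁻ z, ENNReal.ofReal |f z| ∂m := by
  have := enorm_integral_le_lintegral_enorm (μ := m) f
  simpa only [Real.enorm_eq_ofReal_abs] using this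

/-- The weight `u ↦ 1_{u < s} |h (s - u)|` with which the past acts on the intensity at time `s`. -/
noncomputable def pastWeight (h : ℝ → ℝ) (s : ℝ≥0) (u : ℝ≥0) : ℝ≥0∞ :=
  (Iio s).indicator (fun u => ENNReal.ofReal |h ((s : ℝ) - u)|) u

theorem measurable_pastWeight {h : ℝ → ℝ} (hh : Measurable h) (s : ℝ≥0) :
    Measurable (pastWeight h s) :=
  ((hh.comp (measurable_const.sub measurable_coe_nnreal)).abs.ennreal_ofReal).indicator
    measurableSet_Iio

theorem lintegral_pastWeight_le {h : ℝ → ℝ} (hh : Measurable h) {s : ℝ≥0} {T : ℝ}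
    (hs : (s : ℝ) ≤ T) :
    ∫⁻ u, pastWeight h s u ∂lebesgueNN ≤ ∫⁻ x in Icc 0 T, ENNReal.ofReal |h x| := by
  rw [lintegral_lebesgueNN (measurable_pastWeight hh s), ← lintegral_indicator measurableSet_Ici,
    ← lintegral_indicator measurableSet_Icc,
    ← lintegral_sub_left_eq_self ((Icc 0 T).indicator fun x => ENNReal.ofReal |h x|) (s : ℝ)]
  refine lintegral_mono fun x => ?_
  by_cases hx : 0 ≤ x
  · rw [indicator_of_mem (mem_Ici.2 hx), pastWeight]
    by_cases hxs : x < s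
    · have h1 : x.toNNReal < s := by
        rw [← NNReal.coe_lt_coe, Real.coe_toNNReal x hx]; exact hxs
      rw [indicator_of_mem (mem_Iio.2 h1), indicator_of_mem (by constructor <;> linarith),
        Real.coe_toNNReal x hx]
    · have h1 : ¬ x.toNNReal < s := by
        rw [← NNReal.coe_lt_coe, Real.coe_toNNReal x hx]; exact hxs
      rw [indicator_of_notMem (by simpa using h1)]
      exact zero_le
  · rw [indicator_of_notMem (by simpa using hx)]
    exact zero_le

section Moments

variable {Ω : Type*} [mΩ : MeasurableSpace Ω] {P : Kernel Ω State} {ν : Measure ℝ} {μ : Measure Ω}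

theorem IsHawkesIntensity.measurable {h ψ b : ℝ → ℝ} {T : ℝ} {lam : ℝ≥0 → Ω → ℝ}
    (hl : IsHawkesIntensity P μ h ψ b T lam) : Measurable (Function.uncurry lam) :=
  hl.predictable.measurable.mono (predictable_le P) le_rfl

theorem measurableSet_le_process {X : ℝ≥0 → Ω → ℝ} (hX : Measurable (Function.uncurry X)) (ω : Ω) :
    MeasurableSet {z : State | (z.2.1 : ℝ) ≤ X z.1 ω} :=
  measurableSet_le (measurable_coe_nnreal.comp measurable_snd.fst)
    (hX.comp (measurable_fst.prodMk measurable_const))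

/-- Almost surely the accepted mark mass stays finite up to the horizon. -/
theorem IsHawkesIntensity.ae_acceptedMass_lt_top [IsProbabilityMeasure μ] [IsProbabilityMeasure ν]
    {h ψ b : ℝ → ℝ} {T : ℝ} {lam : ℝ≥0 → Ω → ℝ} (hl : IsHawkesIntensity P μ h ψ b T lam)
    (hP : IsPoissonRandomMeasure P ν μ) (hb : Measurable b)
    (hb_fin : ∫⁻ y, ENNReal.ofReal (b y) ∂ν ≠ ⊤) :
    ∀ᵐ ω ∂μ, ∀ s : ℝ≥0, (s : ℝ) ≤ T → acceptedMass P b lam s ω < ⊤ := by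
  filter_upwards [hP.ae_eq_zero_of_lt_one, hl.finite_jumps,
    hP.ae_lintegral_box_lt_top hb.ennreal_ofReal hb_fin] with ω h01 hfin hbox s hs
  have hA : MeasurableSet {z : State | 0 < z.1 ∧ z.1 < s ∧ (z.2.1 : ℝ) ≤ lam z.1 ω} :=
    (measurable_fst measurableSet_Ioi).inter
      ((measurable_fst measurableSet_Iio).inter (measurableSet_le_process hl.measurable ω))
  refine setLIntegral_lt_top_of_measure_lt_top (g := fun y => ENNReal.ofReal (b y)) h01 hbox hA ?_
  refine lt_of_le_of_lt (measure_mono ?_) hfin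
  rintro z ⟨h1, h2, h3⟩
  exact ⟨h1, (NNReal.coe_le_coe.2 h2.le).trans hs, h3⟩

/-- Ignoring the null time `0`, the accepted mass is an integral over all points before `s`. -/
theorem setLIntegral_before_eq_acceptedMass {b : ℝ → ℝ} {lam : ℝ≥0 → Ω → ℝ} {ω : Ω}
    (h0 : P ω ({0} ×ˢ univ) = 0) (s : ℝ≥0) :
    ∫⁻ z in {z : State | z.1 < s ∧ (z.2.1 : ℝ) ≤ lam z.1 ω}, ENNReal.ofReal (b z.2.2) ∂(P ω)
      = acceptedMass P b lam s ω := by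
  refine setLIntegral_congr ?_
  have : ∀ᵐ z ∂(P ω), z ∉ (({0} : Set ℝ≥0) ×ˢ (univ : Set (ℝ≥0 × ℝ))) := measure_eq_zero_iff_ae_notMem.1 h0
  filter_upwards [this] with z hz
  have hz0 : 0 < z.1 := by
    refine lt_of_le_of_ne zero_le fun h => hz ⟨h.symm, trivial⟩
  refine propext ?_
  exact ⟨fun h => ⟨hz0, h⟩, fun h => h.2⟩

/-- Renewal inequality on a path. Accepted points before `s` stay accepted after localization,
because the accepted mass is nondecreasing. -/
theorem ofReal_localizedIntensity_le {L : ℝ≥0} {h ψ b : ℝ → ℝ} (hψ : LipschitzWith L ψ)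
    (hb0 : ∀ y, 0 ≤ b y) {lam : ℝ≥0 → Ω → ℝ} (hlam : Measurable (Function.uncurry lam)) {s : ℝ≥0}
    {ω : Ω} (heq : lam s ω = ψ (∫ z in {z : State | z.1 < s ∧ (z.2.1 : ℝ) ≤ lam z.1 ω},
      h ((s : ℝ) - (z.1 : ℝ)) * b z.2.2 ∂(P ω))) (n : ℕ) :
    ENNReal.ofReal (localizedIntensity P b lam n s ω) ≤ ENNReal.ofReal (ψ 0) +
      L * ∫⁻ z in {z : State | (z.2.1 : ℝ) ≤ localizedIntensity P b lam n z.1 ω},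
        pastWeight h s z.1 * ENNReal.ofReal (b z.2.2) ∂(P ω) := by
  by_cases hZ : acceptedMass P b lam s ω ≤ n
  · rw [localizedIntensity, if_pos hZ, heq]
    refine (ofReal_le_add_lipschitz hψ _).trans ?_
    gcongr
    refine (ofReal_abs_integral_le _ _).trans ?_
    have hm1 : MeasurableSet {z : State | z.1 < s} := measurable_fst measurableSet_Iio
    have hmA : MeasurableSet {z : State | z.1 < s ∧ (z.2.1 : ℝ) ≤ lam z.1 ω} :=
      hm1.inter (measurableSet_le_process hlam ω)
    calc ∫⁻ z in {z : State | z.1 < s ∧ (z.2.1 : ℝ) ≤ lam z.1 ω},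
          ENNReal.ofReal |h ((s : ℝ) - (z.1 : ℝ)) * b z.2.2| ∂(P ω)
        = ∫⁻ z in {z : State | z.1 < s ∧ (z.2.1 : ℝ) ≤ lam z.1 ω},
          pastWeight h s z.1 * ENNReal.ofReal (b z.2.2) ∂(P ω) := by
          refine setLIntegral_congr_fun hmA fun z hz => ?_
          simp only [pastWeight]
          rw [indicator_of_mem (by exact hz.1), abs_mul, abs_of_nonneg (hb0 _),
            ENNReal.ofReal_mul (abs_nonneg _)]
      _ ≤ _ := by
          refine lintegral_mono_set fun z hz => ?_
          have hz' : acceptedMass P b lam z.1 ω ≤ n := (acceptedMass_mono b lam ω hz.1.le).trans hZ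
          simp only [mem_ofPred_eq, localizedIntensity, if_pos hz']
          exact hz.2
  · rw [localizedIntensity, if_neg hZ, ENNReal.ofReal_of_nonpos (by norm_num)]
    exact zero_le

/-- A bound by a constant depending on the localization level, which makes the mean finite a priori.
-/
theorem ofReal_localizedIntensity_le_const {L : ℝ≥0} {h ψ b : ℝ → ℝ} {H : ℝ}
    (hψ : LipschitzWith L ψ)
    (hH : ∀ x, |h x| ≤ H) (hb0 : ∀ y, 0 ≤ b y) {lam : ℝ≥0 → Ω → ℝ} {s : ℝ≥0}
    {ω : Ω} (h0 : P ω ({0} ×ˢ univ) = 0)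
    (heq : lam s ω = ψ (∫ z in {z : State | z.1 < s ∧ (z.2.1 : ℝ) ≤ lam z.1 ω},
      h ((s : ℝ) - (z.1 : ℝ)) * b z.2.2 ∂(P ω))) (n : ℕ) :
    ENNReal.ofReal (localizedIntensity P b lam n s ω) ≤ ENNReal.ofReal (ψ 0) +
      L * (ENNReal.ofReal H * n) := by
  by_cases hZ : acceptedMass P b lam s ω ≤ n
  · rw [localizedIntensity, if_pos hZ, heq]
    refine (ofReal_le_add_lipschitz hψ _).trans ?_
    gcongr
    refine (ofReal_abs_integral_le _ _).trans ?_
    rw [← setLIntegral_before_eq_acceptedMass h0] at hZ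
    refine le_trans ?_ (mul_le_mul_right hZ _)
    rw [← lintegral_const_mul' _ _ ENNReal.ofReal_ne_top]
    refine lintegral_mono fun z => ?_
    rw [abs_mul, abs_of_nonneg (hb0 _), ENNReal.ofReal_mul (abs_nonneg _)]
    gcongr
    exact hH _
  · rw [localizedIntensity, if_neg hZ, ENNReal.ofReal_of_nonpos (by norm_num)]
    exact zero_le

/-- Uniform moment bound for the intensity: `𝔼[lam s] ≤ ψ 0 / (1 - ρ)`. The renewal inequality is
solved for the localized intensity, whose mean is finite a priori, and the localization is then
removed by monotone convergence. -/
theorem IsHawkesIntensity.lintegral_le [IsProbabilityMeasure μ] [IsProbabilityMeasure ν]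
    {L : ℝ≥0} {h ψ b : ℝ → ℝ} {T H ρ : ℝ} {lam : ℝ≥0 → Ω → ℝ}
    (hl : IsHawkesIntensity P μ h ψ b T lam) (hP : IsPoissonRandomMeasure P ν μ)
    (hψ : LipschitzWith L ψ) (hψ0 : ∀ x, 0 ≤ ψ x) (hb : Measurable b) (hb0 : ∀ y, 0 ≤ b y)
    (hb_fin : ∫⁻ y, ENNReal.ofReal (b y) ∂ν ≠ ⊤) (hh : Measurable h) (hH : ∀ x, |h x| ≤ H)
    (hρ0 : 0 ≤ ρ) (hρ1 : ρ < 1)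
    (hρ : L * ((∫⁻ x in Icc 0 T, ENNReal.ofReal |h x|) * ∫⁻ y, ENNReal.ofReal (b y) ∂ν)
      ≤ ENNReal.ofReal ρ) {s : ℝ≥0} (hs : (s : ℝ) ≤ T) :
    ∫⁻ ω, ENNReal.ofReal (lam s ω) ∂μ ≤ ENNReal.ofReal (ψ 0 / (1 - ρ)) := by
  have hlam := hl.measurable
  have hXm : ∀ n, Measurable (Function.uncurry (localizedIntensity P b lam n)) := fun n =>
    (measurable_localizedIntensity hP hb hl.predictable n).mono (predictable_le P) le_rfl
  have hloc : ∀ n : ℕ, ∀ s : ℝ≥0, (s : ℝ) ≤ T →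
      ∫⁻ ω, ENNReal.ofReal (localizedIntensity P b lam n s ω) ∂μ
        ≤ ENNReal.ofReal (ψ 0 / (1 - ρ)) := by
    intro n
    set F : ℝ≥0 → ℝ≥0∞ := fun s => ∫⁻ ω, ENNReal.ofReal (localizedIntensity P b lam n s ω) ∂μ
      with hF
    set x : ℝ≥0∞ := ⨆ s : {s : ℝ≥0 // (s : ℝ) ≤ T}, F s with hx
    have hxfin : x ≠ ⊤ := by
      refine ne_top_of_le_ne_top (b := ENNReal.ofReal (ψ 0) + L * (ENNReal.ofReal H * n)) ?_ ?_
      · exact ENNReal.add_ne_top.2 ⟨ENNReal.ofReal_ne_top, ENNReal.mul_ne_top ENNReal.coe_ne_top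
          (ENNReal.mul_ne_top ENNReal.ofReal_ne_top (ENNReal.natCast_ne_top n))⟩
      · refine iSup_le fun s => ?_
        calc F s ≤ ∫⁻ _, (ENNReal.ofReal (ψ 0) + L * (ENNReal.ofReal H * n)) ∂μ := by
              refine lintegral_mono_ae ?_
              filter_upwards [hP.ae_apply_zero_time, hl.intensity_eq] with ω h0 heq
              exact ofReal_localizedIntensity_le_const hψ hH hb0 h0 (heq s s.2) n
          _ = _ := by rw [lintegral_const, measure_univ, mul_one]
    have hrec : ∀ s : {s : ℝ≥0 // (s : ℝ) ≤ T}, F s ≤ ENNReal.ofReal (ψ 0) + ENNReal.ofReal ρ * x := by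
      rintro ⟨s, hs⟩
      calc F s ≤ ∫⁻ ω, (ENNReal.ofReal (ψ 0) +
            L * ∫⁻ z in {z : State | (z.2.1 : ℝ) ≤ localizedIntensity P b lam n z.1 ω},
              pastWeight h s z.1 * ENNReal.ofReal (b z.2.2) ∂(P ω)) ∂μ := by
            refine lintegral_mono_ae ?_
            filter_upwards [hl.intensity_eq] with ω heq
            exact ofReal_localizedIntensity_le hψ hb0 hlam (heq s hs) n
        _ = ENNReal.ofReal (ψ 0) + L * ((∫⁻ u, pastWeight h s u * F u ∂lebesgueNN)
              * ∫⁻ y, ENNReal.ofReal (b y) ∂ν) := by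
            rw [lintegral_add_left measurable_const, lintegral_const, measure_univ, mul_one,
              lintegral_const_mul' _ _ ENNReal.coe_ne_top,
              hP.lintegral_below (measurable_localizedIntensity hP hb hl.predictable n)
                (measurable_pastWeight hh s) hb.ennreal_ofReal]
        _ ≤ ENNReal.ofReal (ψ 0) + L * (((∫⁻ x in Icc 0 T, ENNReal.ofReal |h x|) * x)
              * ∫⁻ y, ENNReal.ofReal (b y) ∂ν) := by
            gcongr
            calc ∫⁻ u, pastWeight h s u * F u ∂lebesgueNN
                ≤ ∫⁻ u, pastWeight h s u * x ∂lebesgueNN := by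
                  refine lintegral_mono fun u => ?_
                  by_cases hu : u < s
                  · gcongr
                    have : (u : ℝ) ≤ T := (NNReal.coe_le_coe.2 hu.le).trans hs
                    exact le_iSup (fun s : {s : ℝ≥0 // (s : ℝ) ≤ T} => F s) ⟨u, this⟩
                  · simp [pastWeight, hu]
              _ = (∫⁻ u, pastWeight h s u ∂lebesgueNN) * x :=
                  lintegral_mul_const _ (measurable_pastWeight hh s)
              _ ≤ _ := by
                  gcongr
                  exact lintegral_pastWeight_le hh hs
        _ = ENNReal.ofReal (ψ 0) + (L * ((∫⁻ x in Icc 0 T, ENNReal.ofReal |h x|)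
              * ∫⁻ y, ENNReal.ofReal (b y) ∂ν)) * x := by ring
        _ ≤ _ := by gcongr
    have := ennreal_le_div_of_le_add_mul hxfin (hψ0 0) hρ0 hρ1 (iSup_le hrec)
    exact fun s hs => (le_iSup (fun s : {s : ℝ≥0 // (s : ℝ) ≤ T} => F s) ⟨s, hs⟩).trans this
  calc ∫⁻ ω, ENNReal.ofReal (lam s ω) ∂μ
      ≤ ∫⁻ ω, ⨆ n, ENNReal.ofReal (localizedIntensity P b lam n s ω) ∂μ := by
        refine lintegral_mono_ae ?_
        filter_upwards [hl.ae_acceptedMass_lt_top hP hb hb_fin] with ω hω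
        obtain ⟨n, hn⟩ := ENNReal.exists_nat_gt (hω s hs).ne
        refine le_iSup_of_le n ?_
        rw [localizedIntensity, if_pos hn.le]
    _ = ⨆ n, ∫⁻ ω, ENNReal.ofReal (localizedIntensity P b lam n s ω) ∂μ := by
        refine lintegral_iSup (fun n => ?_) fun m n hmn ω => ?_
        · exact ((hXm n).comp (measurable_const.prodMk measurable_id)).ennreal_ofReal
        · by_cases hm : acceptedMass P b lam s ω ≤ m
          · have hn : acceptedMass P b lam s ω ≤ n := hm.trans (by exact_mod_cast hmn)
            simp only [localizedIntensity, if_pos hm, if_pos hn, le_refl]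
          · simp only [localizedIntensity, if_neg hm]
            rw [ENNReal.ofReal_of_nonpos (by norm_num)]
            exact zero_le
    _ ≤ _ := iSup_le fun n => hloc n s hs

end Moments

/-! ### Past kernels and their grid versions -/

/-- The kernel `u ↦ 1_{u < s} h (s - u)` through which past points enter the intensity at `s`. -/
noncomputable def pastKernel (h : ℝ → ℝ) (s u : ℝ≥0) : ℝ :=
  (Iio s).indicator (fun u : ℝ≥0 => h ((s : ℝ) - u)) u

/-- The grid version `u ↦ h ((n - k) Δ)` of the past kernel, where `k` is the bin of `u`; it
vanishes at time `0` and from the `n`-th bin on. -/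
noncomputable def gridKernel (h : ℝ → ℝ) (Δ : ℝ) (n : ℕ) (u : ℝ≥0) : ℝ :=
  {u : ℝ≥0 | 0 < u ∧ binIdx Δ u < n}.indicator
    (fun u : ℝ≥0 => h (((n : ℝ) - binIdx Δ u) * Δ)) u

theorem measurable_pastKernel {h : ℝ → ℝ} (hh : Measurable h) (s : ℝ≥0) :
    Measurable (pastKernel h s) :=
  (hh.comp (measurable_const.sub measurable_coe_nnreal)).indicator measurableSet_Iio

theorem measurableSet_binIdx_lt (Δ : ℝ) (n : ℕ) :
    MeasurableSet {u : ℝ≥0 | 0 < u ∧ binIdx Δ u < n} :=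
  measurableSet_Ioi.inter (((measurable_binIdx Δ).comp measurable_coe_nnreal) measurableSet_Iio)

theorem measurable_gridKernel (h : ℝ → ℝ) (Δ : ℝ) (n : ℕ) : Measurable (gridKernel h Δ n) := by
  refine Measurable.indicator ?_ (measurableSet_binIdx_lt Δ n)
  have : Measurable fun k : ℕ => h (((n : ℝ) - k) * Δ) := measurable_from_top
  exact this.comp ((measurable_binIdx Δ).comp measurable_coe_nnreal)

theorem lt_of_binIdx_lt {Δ : ℝ} (hΔ : 0 < Δ) {s u : ℝ} (h : binIdx Δ u < binIdx Δ s) : u < s := by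
  by_contra hc
  have : binIdx Δ s ≤ binIdx Δ u :=
    (binIdx_le_iff hΔ).2 ((not_lt.1 hc).trans (le_binIdx_mul hΔ u))
  omega

/-- The total weight of the grid kernel is at most the Riemann sum of `|h|`. -/
theorem lintegral_gridKernel_le (h : ℝ → ℝ) {Δ : ℝ} (hΔ : 0 < Δ) {n M : ℕ} (hnM : n ≤ M) :
    ∫⁻ u, ENNReal.ofReal |gridKernel h Δ n u| ∂lebesgueNN
      ≤ ENNReal.ofReal (∑ k ∈ Finset.Icc 1 M, |h ((k : ℝ) * Δ)| * Δ) := by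
  rw [lintegral_lebesgueNN (measurable_gridKernel h Δ n).abs.ennreal_ofReal]
  let F : ℕ → ℝ≥0∞ := fun k => ENNReal.ofReal |h (((n : ℝ) - k) * Δ)|
  calc ∫⁻ x in Ici (0 : ℝ), ENNReal.ofReal |gridKernel h Δ n x.toNNReal|
      ≤ ∫⁻ x in Ioc 0 ((n - 1 : ℕ) * Δ), F (binIdx Δ x) := by
        rw [← lintegral_indicator measurableSet_Ici, ← lintegral_indicator measurableSet_Ioc]
        refine lintegral_mono fun x => ?_
        by_cases hx : 0 ≤ x
        · rw [indicator_of_mem (mem_Ici.2 hx)]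
          by_cases hm : x.toNNReal ∈ {u : ℝ≥0 | 0 < u ∧ binIdx Δ u < n}
          · have h1 : 0 < x := Real.toNNReal_pos.1 hm.1
            have h2 : binIdx Δ x ≤ n - 1 := by
              have := hm.2
              rw [Real.coe_toNNReal x hx] at this
              omega
            rw [gridKernel, indicator_of_mem hm, Real.coe_toNNReal x hx,
              indicator_of_mem (show x ∈ Ioc 0 ((n - 1 : ℕ) * Δ) from
                ⟨h1, (binIdx_le_iff hΔ).1 h2⟩)]
          · rw [gridKernel, indicator_of_notMem hm, abs_zero, ENNReal.ofReal_zero]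
            exact zero_le
        · rw [indicator_of_notMem (by simpa using hx)]
          exact zero_le
    _ = ∑ k ∈ Finset.Icc 1 (n - 1), F k * ENNReal.ofReal Δ := lintegral_binIdx hΔ F _
    _ = ∑ k ∈ Finset.Icc 1 (n - 1), ENNReal.ofReal |h ((k : ℝ) * Δ)| * ENNReal.ofReal Δ := by
        refine Finset.sum_nbij' (fun k => n - k) (fun k => n - k) ?_ ?_ ?_ ?_ ?_
        · intro k hk; rw [Finset.mem_Icc] at hk ⊢; omega
        · intro k hk; rw [Finset.mem_Icc] at hk ⊢; omega
        · intro k hk; rw [Finset.mem_Icc] at hk; omega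
        · intro k hk; rw [Finset.mem_Icc] at hk; omega
        · intro k hk
          rw [Finset.mem_Icc] at hk
          simp only [F]
          rw [Nat.cast_sub (by omega)]
    _ ≤ ∑ k ∈ Finset.Icc 1 M, ENNReal.ofReal |h ((k : ℝ) * Δ)| * ENNReal.ofReal Δ := by
        refine Finset.sum_le_sum_of_subset fun k hk => ?_
        rw [Finset.mem_Icc] at hk ⊢
        omega
    _ = _ := by
        rw [ENNReal.ofReal_sum_of_nonneg fun k _ => by positivity]
        exact Finset.sum_congr rfl fun k _ => (ENNReal.ofReal_mul (abs_nonneg _)).symm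

/-- The past kernel and its grid version are close in `L¹`, uniformly in the time `s`: away from
the last bin both arguments of `h` lie within `Δ` of each other, and the last bin has length at
most `Δ`. -/
theorem lintegral_pastKernel_sub_gridKernel_le {p : ℝ} (hp : 1 ≤ p) {h : ℝ → ℝ}
    (hh : Measurable h) {T H : ℝ} (hH : ∀ x, |h x| ≤ H) (hV : ePVar p h T ≠ ⊤) {Δ : ℝ} (hΔ : 0 < Δ)
    {M : ℕ} (hMΔ : M * Δ = T) {s : ℝ≥0} (hs0 : 0 < s) (hsT : (s : ℝ) ≤ T) :
    ∫⁻ u, ENNReal.ofReal |pastKernel h s u - gridKernel h Δ (binIdx Δ s) u| ∂lebesgueNN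
      ≤ ENNReal.ofReal (2 * (pVarNorm p h T * T ^ ((p - 1) / p) * Δ ^ (1 / p)) + Δ * H) := by
  have hs0' : (0 : ℝ) < s := hs0
  have hT : 0 ≤ T := hs0'.le.trans hsT
  have hH0 : 0 ≤ H := (abs_nonneg _).trans (hH 0)
  obtain ⟨v, hv, hvb, hc⟩ := exists_monotone_control hT hV
  set V := (ePVar p h T).toReal with hVdef
  set n := binIdx Δ s with hn
  have hnM : n ≤ M := (binIdx_le_iff hΔ).2 (by rw [hMΔ]; exact hsT)
  have hsn : (s : ℝ) ≤ n * Δ := le_binIdx_mul hΔ s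
  have hns : n * Δ < s + Δ := binIdx_mul_lt hΔ hs0'
  let f : ℝ → ℝ := {x | binIdx Δ x < n}.indicator
    fun x => h (s - x) - h (((n : ℝ) - binIdx Δ x) * Δ)
  have hfm : Measurable f := by
    refine Measurable.indicator ?_ ((measurable_binIdx Δ) measurableSet_Iio)
    have : Measurable fun k : ℕ => h (((n : ℝ) - k) * Δ) := measurable_from_top
    exact (hh.comp (measurable_const.sub measurable_id)).sub (this.comp (measurable_binIdx Δ))
  have hw : Monotone fun x => V - v (s - x) := fun x y hxy => by
    have := hv (by linarith : (s : ℝ) - y ≤ s - x)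
    simp only
    linarith
  have hfc : ∀ x ∈ Ioc 0 (s : ℝ), |f x| ^ p
      ≤ (fun x => V - v (s - x)) (x + Δ) - (fun x => V - v (s - x)) (x - Δ) := by
    intro x hx
    have hmono := hv (by linarith : (s : ℝ) - (x + Δ) ≤ s - (x - Δ))
    simp only
    by_cases hm : binIdx Δ x < n
    · simp only [f]
      rw [indicator_of_mem (by exact hm)]
      have h1 := le_binIdx_mul hΔ x
      have h2 := binIdx_mul_lt hΔ hx.1
      have hbn : (binIdx Δ x : ℝ) ≤ n := by exact_mod_cast hm.le
      have h3 : 0 ≤ ((n : ℝ) - binIdx Δ x) * Δ := mul_nonneg (sub_nonneg.2 hbn) hΔ.le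
      have h4 : ((n : ℝ) - binIdx Δ x) * Δ ≤ T := by
        have : (n : ℝ) * Δ ≤ M * Δ := by gcongr
        have : 0 ≤ (binIdx Δ x : ℝ) * Δ := by positivity
        linarith
      have := abs_sub_rpow_le_of_control hv hc (s := s - x)
        (t := ((n : ℝ) - binIdx Δ x) * Δ) (x := s - (x + Δ)) (y := s - (x - Δ))
        ⟨by linarith [hx.2], by linarith [hx.1]⟩ ⟨h3, h4⟩ (by linarith) (by linarith) (by linarith)
        (by linarith)
      linarith
    · simp only [f]
      rw [indicator_of_notMem (by exact hm), abs_zero, Real.zero_rpow (by linarith)]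
      linarith
  have key := lintegral_abs_le_of_control hp hw (V := V)
    (fun x => ⟨by linarith [(hvb (s - x)).2], by linarith [(hvb (s - x)).1]⟩) hs0'.le hΔ.le hΔ.le
    hfm.aemeasurable hfc
  have hkey : (s - 0 : ℝ) ^ (1 - 1 / p) * ((Δ + Δ) * V) ^ (1 / p)
      ≤ 2 * (pVarNorm p h T * T ^ ((p - 1) / p) * Δ ^ (1 / p)) := by
    rw [sub_zero]
    refine (rpow_one_sub_mul_rpow hp hs0'.le hsT (by linarith)
      ENNReal.toReal_nonneg).trans ?_
    have h2 : (Δ + Δ) ^ (1 / p) ≤ 2 * Δ ^ (1 / p) := by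
      rw [← two_mul, Real.mul_rpow zero_le_two hΔ.le]
      gcongr
      calc (2 : ℝ) ^ (1 / p) ≤ 2 ^ (1 : ℝ) := by
            refine Real.rpow_le_rpow_of_exponent_le one_le_two ?_
            rw [div_le_one (by linarith)]; exact hp
        _ = 2 := Real.rpow_one 2
    have h3 : 0 ≤ V ^ (1 / p) * T ^ ((p - 1) / p) := by positivity
    calc V ^ (1 / p) * T ^ ((p - 1) / p) * (Δ + Δ) ^ (1 / p)
        ≤ V ^ (1 / p) * T ^ ((p - 1) / p) * (2 * Δ ^ (1 / p)) := by gcongr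
      _ = _ := by rw [pVarNorm]; ring
  rw [lintegral_lebesgueNN (f := fun u => ENNReal.ofReal |pastKernel h s u - gridKernel h Δ n u|)
    ((measurable_pastKernel hh s).sub (measurable_gridKernel h Δ n)).abs.ennreal_ofReal]
  have hpt : ∀ x ∈ Ioi (0 : ℝ),
      ENNReal.ofReal |pastKernel h s x.toNNReal - gridKernel h Δ n x.toNNReal|
        ≤ (Icc 0 (s : ℝ)).indicator (fun x => ENNReal.ofReal |f x|) x
          + (Ioc (s - Δ : ℝ) s).indicator (fun _ => ENNReal.ofReal H) x := by
    intro x hx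
    have hx00 : 0 < x := hx
    have hx0 : 0 ≤ x := hx00.le
    have hlt : x.toNNReal < s ↔ x < s := by
      rw [← NNReal.coe_lt_coe, Real.coe_toNNReal x hx0]
    by_cases hxs : x < s
    · rw [pastKernel, indicator_of_mem (by exact hlt.2 hxs), Real.coe_toNNReal x hx0]
      by_cases hm : binIdx Δ x < n
      · refine le_add_of_le_of_nonneg ?_ zero_le
        rw [gridKernel, indicator_of_mem (by
          refine ⟨Real.toNNReal_pos.2 hx00, ?_⟩
          rw [Real.coe_toNNReal x hx0]; exact hm), Real.coe_toNNReal x hx0,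
          indicator_of_mem (show x ∈ Icc 0 (s : ℝ) from ⟨hx0, hxs.le⟩)]
        simp only [f]
        rw [indicator_of_mem (by exact hm)]
      · refine le_add_of_nonneg_of_le zero_le ?_
        have hxm : x ∈ Ioc (s - Δ : ℝ) s := by
          refine ⟨?_, hxs.le⟩
          have h1 : ¬ binIdx Δ x ≤ n - 1 := by
            have : 0 < n := (binIdx_pos_iff hΔ).2 hs0'
            omega
          rw [binIdx_le_iff hΔ, not_le, Nat.cast_sub ((binIdx_pos_iff hΔ).2 hs0')] at h1
          push_cast at h1
          linarith
        rw [indicator_of_mem hxm, gridKernel, indicator_of_notMem (fun hcon => hm (by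
          have := hcon.2
          rwa [Real.coe_toNNReal x hx0] at this)), sub_zero]
        exact ENNReal.ofReal_le_ofReal (hH _)
    · rw [pastKernel, indicator_of_notMem (show x.toNNReal ∉ Iio s from fun hcon => hxs (hlt.1 hcon)), gridKernel,
        indicator_of_notMem (fun hcon => hxs (by
          have := hcon.2
          rw [Real.coe_toNNReal x hx0] at this
          exact lt_of_binIdx_lt hΔ this)), sub_zero, abs_zero, ENNReal.ofReal_zero]
      exact zero_le
  rw [← setLIntegral_congr Ioi_ae_eq_Ici]
  refine (setLIntegral_mono' measurableSet_Ioi hpt).trans ?_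
  refine (setLIntegral_le_lintegral _ _).trans ?_
  rw [lintegral_add_left (hfm.abs.ennreal_ofReal.indicator measurableSet_Icc),
    lintegral_indicator measurableSet_Icc, lintegral_indicator measurableSet_Ioc,
    setLIntegral_const, Real.volume_Ioc, ← setLIntegral_congr Ioc_ae_eq_Icc,
    ENNReal.ofReal_add (by have := pVarNorm_nonneg p h T; positivity) (by positivity)]
  gcongr
  · exact key.trans (ENNReal.ofReal_le_ofReal hkey)
  · rw [sub_sub_cancel, mul_comm, ENNReal.ofReal_mul hΔ.le]

/-! ### Distance of the continuous and discrete intensities -/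

theorem mem_binBelow_iff {Δ : ℝ} (hΔ : 0 < Δ) {k : ℕ} (hk : 1 ≤ k) {l : ℝ} {z : State} :
    z ∈ binBelow Δ k l ↔ binIdx Δ z.1 = k ∧ (z.2.1 : ℝ) ≤ l := by
  rw [binIdx_eq_iff hΔ hk, and_assoc]
  rfl

theorem measurableSet_binBelow (Δ : ℝ) (k : ℕ) (l : ℝ) : MeasurableSet (binBelow Δ k l) :=
  (measurableSet_lt measurable_const (measurable_coe_nnreal.comp measurable_fst)).inter
    ((measurableSet_le (measurable_coe_nnreal.comp measurable_fst) measurable_const).inter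
      (measurableSet_le (measurable_coe_nnreal.comp measurable_snd.fst) measurable_const))

theorem exists_binBelow_subset_box (Δ : ℝ) (k : ℕ) (l : ℝ) : ∃ n, binBelow Δ k l ⊆ box n := by
  obtain ⟨n, hn⟩ := exists_nat_ge (max (k * Δ) l)
  refine ⟨n, fun z hz => ⟨?_, ?_, trivial⟩⟩
  · have : (z.1 : ℝ) ≤ n := hz.2.1.trans ((le_max_left _ _).trans hn)
    exact_mod_cast this
  · have : (z.2.1 : ℝ) ≤ n := hz.2.2.trans ((le_max_right _ _).trans hn)
    exact_mod_cast this

theorem integrableOn_of_lintegral_lt_top {m : Measure State} {g : ℝ → ℝ} (hg : Measurable g)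
    {A : Set State} (h : ∫⁻ z in A, ENNReal.ofReal |g z.2.2| ∂m < ⊤) :
    IntegrableOn (fun z => g z.2.2) A m := by
  refine ⟨(hg.comp measurable_snd.snd).aestronglyMeasurable, ?_⟩
  simpa only [HasFiniteIntegral, Real.enorm_eq_ofReal_abs] using h

/-- A sum of integrals over time bins, each with its own height, is one integral over all points
below a step function of time. -/
theorem sum_setIntegral_binBelow {Δ : ℝ} (hΔ : 0 < Δ) {m : Measure State} (l : ℕ → ℝ)
    {g : ℕ → ℝ} {f : ℝ → ℝ} (N : ℕ)
    (hint : ∀ k ∈ Finset.Icc 1 N, IntegrableOn (fun z => f z.2.2) (binBelow Δ k (l k)) m) :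
    ∑ k ∈ Finset.Icc 1 N, g k * ∫ z in binBelow Δ k (l k), f z.2.2 ∂m
        = ∫ z in {z : State | 0 < z.1 ∧ binIdx Δ z.1 < N + 1 ∧ (z.2.1 : ℝ) ≤ l (binIdx Δ z.1)},
          g (binIdx Δ z.1) * f z.2.2 ∂m ∧
      IntegrableOn (fun z : State => g (binIdx Δ z.1) * f z.2.2)
        {z : State | 0 < z.1 ∧ binIdx Δ z.1 < N + 1 ∧ (z.2.1 : ℝ) ≤ l (binIdx Δ z.1)} m := by
  have hU : {z : State | 0 < z.1 ∧ binIdx Δ z.1 < N + 1 ∧ (z.2.1 : ℝ) ≤ l (binIdx Δ z.1)}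
      = ⋃ k ∈ Finset.Icc 1 N, binBelow Δ k (l k) := by
    ext z
    simp only [mem_ofPred_eq, mem_iUnion, exists_prop, Finset.mem_Icc]
    constructor
    · rintro ⟨h1, h2, h3⟩
      have h4 : 0 < binIdx Δ z.1 := (binIdx_pos_iff hΔ).2 h1
      exact ⟨binIdx Δ z.1, ⟨h4, by omega⟩, (mem_binBelow_iff hΔ h4).2 ⟨rfl, h3⟩⟩
    · rintro ⟨k, ⟨h1, h2⟩, h3⟩
      obtain ⟨h4, h5⟩ := (mem_binBelow_iff hΔ h1).1 h3
      refine ⟨?_, by omega, by rwa [h4]⟩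
      have : (0 : ℝ) < z.1 := (binIdx_pos_iff hΔ).1 (by omega)
      exact_mod_cast this
  have hcongr : ∀ k ∈ Finset.Icc 1 N, EqOn (fun z : State => g k * f z.2.2)
      (fun z : State => g (binIdx Δ z.1) * f z.2.2) (binBelow Δ k (l k)) := by
    intro k hk z hz
    have := ((mem_binBelow_iff hΔ (Finset.mem_Icc.1 hk).1).1 hz).1
    simp only [this]
  have hint' : ∀ k ∈ Finset.Icc 1 N,
      IntegrableOn (fun z : State => g (binIdx Δ z.1) * f z.2.2) (binBelow Δ k (l k)) m :=
    fun k hk => IntegrableOn.congr_fun ((hint k hk).const_mul (g k)) (hcongr k hk)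
      (measurableSet_binBelow _ _ _)
  rw [hU]
  refine ⟨?_, (integrableOn_finset_iUnion).2 hint'⟩
  rw [integral_biUnion_finset _ (fun k _ => measurableSet_binBelow _ _ _) ?_ hint']
  · refine Finset.sum_congr rfl fun k hk => ?_
    rw [← integral_const_mul]
    exact setIntegral_congr_fun (measurableSet_binBelow _ _ _) (hcongr k hk)
  · intro i hi j hj hij
    rw [Function.onFun, Set.disjoint_left]
    intro z hzi hzj
    exact hij (((mem_binBelow_iff hΔ (Finset.mem_Icc.1 hi).1).1 hzi).1.symm.trans
      ((mem_binBelow_iff hΔ (Finset.mem_Icc.1 hj).1).1 hzj).1)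

section Discrete

variable {Ω : Type*} [mΩ : MeasurableSpace Ω] {P : Kernel Ω State} {ν : Measure ℝ} {μ : Measure Ω}

theorem integrableOn_binBelow {ω : Ω} {g : ℝ → ℝ} (hg : Measurable g)
    (hbox : ∀ n : ℕ, ∫⁻ z in box n, ENNReal.ofReal |g z.2.2| ∂(P ω) < ⊤) (Δ : ℝ) (k : ℕ) (l : ℝ) :
    IntegrableOn (fun z => g z.2.2) (binBelow Δ k l) (P ω) := by
  obtain ⟨n, hn⟩ := exists_binBelow_subset_box Δ k l
  exact integrableOn_of_lintegral_lt_top hg ((lintegral_mono_set hn).trans_lt (hbox n))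

theorem discIntensity_eq_sum (h ψ b : ℝ → ℝ) (Δ : ℝ) (ω : Ω) (n : ℕ) :
    discIntensity P h ψ b Δ ω n = ψ (∑ k ∈ Finset.Icc 1 (n - 1), h (((n : ℝ) - (k : ℝ)) * Δ) *
      ∫ z in binBelow Δ k (discIntensity P h ψ b Δ ω k), b z.2.2 ∂(P ω)) := by
  rw [discIntensity, Fin.sum_univ_eq_sum_range (fun k => if k = 0 then 0 else
    h (((n : ℝ) - (k : ℝ)) * Δ) *
      ∫ z in binBelow Δ k (discIntensity P h ψ b Δ ω k), b z.2.2 ∂(P ω)) n]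
  congr 1
  symm
  refine Finset.sum_subset_zero_on_sdiff ?_ ?_ ?_
  · intro k hk
    rw [Finset.mem_Icc] at hk
    rw [Finset.mem_range]
    omega
  · intro k hk
    rw [Finset.mem_sdiff, Finset.mem_range, Finset.mem_Icc] at hk
    rw [if_pos (by omega)]
  · intro k hk
    rw [Finset.mem_Icc] at hk
    rw [if_neg (by omega)]

/-- The discrete intensities satisfy the same kind of equation as the continuous one, with the grid
kernel in place of the kernel and the step intensity as acceptance height. -/
theorem discIntensity_eq_integral {h ψ b : ℝ → ℝ} (hb : Measurable b) {Δ : ℝ} (hΔ : 0 < Δ) {ω : Ω}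
    (hbox : ∀ n : ℕ, ∫⁻ z in box n, ENNReal.ofReal |b z.2.2| ∂(P ω) < ⊤) (n : ℕ) :
    discIntensity P h ψ b Δ ω n
        = ψ (∫ z in {z : State | (z.2.1 : ℝ) ≤ stepIntensity P h ψ b Δ z.1 ω},
          gridKernel h Δ n z.1 * b z.2.2 ∂(P ω)) ∧
      IntegrableOn (fun z : State => gridKernel h Δ n z.1 * b z.2.2)
        {z : State | (z.2.1 : ℝ) ≤ stepIntensity P h ψ b Δ z.1 ω} (P ω) := by
  obtain ⟨h1, h2⟩ := sum_setIntegral_binBelow hΔ (m := P ω) (discIntensity P h ψ b Δ ω)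
    (g := fun k => h (((n : ℝ) - (k : ℝ)) * Δ)) (f := b) (n - 1)
    (fun k _ => integrableOn_binBelow hb hbox Δ k _)
  have hS : MeasurableSet {z : State | 0 < z.1 ∧ binIdx Δ z.1 < n} :=
    measurable_fst (measurableSet_binIdx_lt Δ n)
  have hset : {z : State | 0 < z.1 ∧ binIdx Δ z.1 < n - 1 + 1 ∧
        (z.2.1 : ℝ) ≤ discIntensity P h ψ b Δ ω (binIdx Δ z.1)}
      = {z : State | (z.2.1 : ℝ) ≤ stepIntensity P h ψ b Δ z.1 ω}
        ∩ {z : State | 0 < z.1 ∧ binIdx Δ z.1 < n} := by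
    ext z
    simp only [mem_ofPred_eq, mem_inter_iff, stepIntensity]
    constructor
    · rintro ⟨h1, h2, h3⟩
      have h4 : 0 < binIdx Δ z.1 := (binIdx_pos_iff hΔ).2 h1
      exact ⟨h3, h1, by omega⟩
    · rintro ⟨h3, h1, h2⟩
      exact ⟨h1, by omega, h3⟩
  have hfun : (fun z : State => gridKernel h Δ n z.1 * b z.2.2)
      = {z : State | 0 < z.1 ∧ binIdx Δ z.1 < n}.indicator
        fun z => h (((n : ℝ) - binIdx Δ z.1) * Δ) * b z.2.2 := by
    funext z
    rw [gridKernel]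
    by_cases hz : z ∈ {z : State | 0 < z.1 ∧ binIdx Δ z.1 < n}
    · rw [indicator_of_mem hz, indicator_of_mem (by exact hz)]
    · rw [indicator_of_notMem hz, indicator_of_notMem (by exact hz), zero_mul]
  rw [hset] at h1 h2
  refine ⟨?_, ?_⟩
  · rw [hfun, setIntegral_indicator hS, ← h1]
    exact discIntensity_eq_sum h ψ b Δ ω n
  · rw [hfun]
    refine (integrable_indicator_iff hS).2 ?_
    rw [IntegrableOn, Measure.restrict_restrict hS, inter_comm]
    exact h2

theorem ofReal_discIntensity_le {L : ℝ≥0} {h ψ b : ℝ → ℝ} (hψ : LipschitzWith L ψ)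
    (hb : Measurable b) (hb0 : ∀ y, 0 ≤ b y) {Δ : ℝ} (hΔ : 0 < Δ) {ω : Ω}
    (hbox : ∀ n : ℕ, ∫⁻ z in box n, ENNReal.ofReal |b z.2.2| ∂(P ω) < ⊤) (n : ℕ) :
    ENNReal.ofReal (discIntensity P h ψ b Δ ω n) ≤ ENNReal.ofReal (ψ 0) +
      L * ∫⁻ z in {z : State | (z.2.1 : ℝ) ≤ stepIntensity P h ψ b Δ z.1 ω},
        ENNReal.ofReal |gridKernel h Δ n z.1| * ENNReal.ofReal (b z.2.2) ∂(P ω) := by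
  rw [(discIntensity_eq_integral hb hΔ hbox n).1]
  refine (ofReal_le_add_lipschitz hψ _).trans ?_
  gcongr
  refine (ofReal_abs_integral_le _ _).trans (le_of_eq (lintegral_congr fun z => ?_))
  rw [abs_mul, abs_of_nonneg (hb0 _), ENNReal.ofReal_mul (abs_nonneg _)]

theorem measurable_lintegral_below [IsSFiniteKernel P] {X : ℝ≥0 → Ω → ℝ}
    (hX : Measurable (Function.uncurry X)) {f : State → ℝ≥0∞} (hf : Measurable f) :
    Measurable fun ω => ∫⁻ z in {z : State | (z.2.1 : ℝ) ≤ X z.1 ω}, f z ∂(P ω) := by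
  have hS : MeasurableSet {x : Ω × State | (x.2.2.1 : ℝ) ≤ X x.2.1 x.1} :=
    measurableSet_le (measurable_coe_nnreal.comp measurable_snd.snd.fst)
      (hX.comp (measurable_snd.fst.prodMk measurable_fst))
  have := Measurable.lintegral_kernel_prod_right' (κ := P) ((hf.comp measurable_snd).indicator hS)
  refine Eq.subst (motive := fun g => Measurable g) ?_ this
  funext ω
  rw [← lintegral_indicator (measurableSet_le_process hX ω)]
  rfl

/-- Moment bound for the discrete intensities, by strong induction along the grid. -/
theorem lintegral_discIntensity_le [IsProbabilityMeasure μ] [IsProbabilityMeasure ν]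
    {L : ℝ≥0} {h ψ b : ℝ → ℝ} {ρ : ℝ} (hP : IsPoissonRandomMeasure P ν μ)
    (hψ : LipschitzWith L ψ) (hψ0 : ∀ x, 0 ≤ ψ x) (hb : Measurable b) (hb0 : ∀ y, 0 ≤ b y)
    (hb_fin : ∫⁻ y, ENNReal.ofReal (b y) ∂ν ≠ ⊤) {Δ : ℝ≥0} (hΔ : 0 < Δ)
    (hρ0 : 0 ≤ ρ) (hρ1 : ρ < 1) {M : ℕ}
    (hρ : ∀ n ≤ M, L * ((∫⁻ u, ENNReal.ofReal |gridKernel h Δ n u| ∂lebesgueNN)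
      * ∫⁻ y, ENNReal.ofReal (b y) ∂ν) ≤ ENNReal.ofReal ρ) {n : ℕ} (hn : n ≤ M) :
    ∫⁻ ω, ENNReal.ofReal (discIntensity P h ψ b Δ ω n) ∂μ ≤ ENNReal.ofReal (ψ 0 / (1 - ρ)) := by
  have hΔ' : (0 : ℝ) < Δ := hΔ
  induction n using Nat.strong_induction_on with
  | _ n ih =>
  have hA0 : 0 ≤ ψ 0 / (1 - ρ) := div_nonneg (hψ0 0) (by linarith)
  calc ∫⁻ ω, ENNReal.ofReal (discIntensity P h ψ b Δ ω n) ∂μ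
      ≤ ∫⁻ ω, (ENNReal.ofReal (ψ 0) +
        L * ∫⁻ z in {z : State | (z.2.1 : ℝ) ≤ stepIntensity P h ψ b Δ z.1 ω},
        ENNReal.ofReal |gridKernel h Δ n z.1| * ENNReal.ofReal (b z.2.2) ∂(P ω)) ∂μ := by
        refine lintegral_mono_ae ?_
        filter_upwards [hP.ae_lintegral_box_lt_top hb.ennreal_ofReal hb_fin] with ω hbox
        refine ofReal_discIntensity_le hψ hb hb0 hΔ' (fun k => ?_) n
        simp_rw [abs_of_nonneg (hb0 _)]
        exact hbox k
    _ = ENNReal.ofReal (ψ 0) + L * ((∫⁻ u, ENNReal.ofReal |gridKernel h Δ n u| *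
          (∫⁻ ω, ENNReal.ofReal (stepIntensity P h ψ b Δ u ω) ∂μ) ∂lebesgueNN)
          * ∫⁻ y, ENNReal.ofReal (b y) ∂ν) := by
        rw [lintegral_add_left measurable_const, lintegral_const, measure_univ, mul_one,
          lintegral_const_mul' _ _ ENNReal.coe_ne_top,
          hP.lintegral_below (measurable_stepIntensity hP hψ.continuous.measurable hb hb0 hΔ)
            (measurable_gridKernel h Δ n).abs.ennreal_ofReal hb.ennreal_ofReal]
    _ ≤ ENNReal.ofReal (ψ 0) + L * (((∫⁻ u, ENNReal.ofReal |gridKernel h Δ n u| ∂lebesgueNN)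
          * ENNReal.ofReal (ψ 0 / (1 - ρ))) * ∫⁻ y, ENNReal.ofReal (b y) ∂ν) := by
        gcongr
        rw [← lintegral_mul_const _ (measurable_gridKernel h Δ n).abs.ennreal_ofReal]
        refine lintegral_mono fun u => ?_
        by_cases hu : u ∈ {u : ℝ≥0 | 0 < u ∧ binIdx Δ u < n}
        · gcongr
          exact ih _ hu.2 (hu.2.le.trans hn)
        · simp [gridKernel, hu]
    _ = ENNReal.ofReal (ψ 0) + (L * ((∫⁻ u, ENNReal.ofReal |gridKernel h Δ n u| ∂lebesgueNN)
          * ∫⁻ y, ENNReal.ofReal (b y) ∂ν)) * ENNReal.ofReal (ψ 0 / (1 - ρ)) := by ring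
    _ ≤ ENNReal.ofReal (ψ 0) + ENNReal.ofReal ρ * ENNReal.ofReal (ψ 0 / (1 - ρ)) := by
        gcongr
        exact hρ n hn
    _ = ENNReal.ofReal (ψ 0 / (1 - ρ)) := by
        rw [← ENNReal.ofReal_mul hρ0, ← ENNReal.ofReal_add (hψ0 0) (by positivity)]
        congr 1
        have : 1 - ρ ≠ 0 := by linarith
        field_simp
        ring

/-- Pathwise comparison of the two intensities: the kernel error is paid on the accepted points,
the grid kernel on the points that exactly one of the two intensities accepts. -/
theorem ofReal_abs_intensity_sub_le {L : ℝ≥0} {h ψ b : ℝ → ℝ} {H : ℝ} (hψ : LipschitzWith L ψ)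
    (hh : Measurable h) (hH : ∀ x, |h x| ≤ H)
    (hb : Measurable b) (hb0 : ∀ y, 0 ≤ b y) {Δ : ℝ} (hΔ : 0 < Δ) {lam : ℝ≥0 → Ω → ℝ}
    (hlam : Measurable (Function.uncurry lam))
    (hstep : Measurable (Function.uncurry (stepIntensity P h ψ b Δ))) {ω : Ω}
    (hbox : ∀ n : ℕ, ∫⁻ z in box n, ENNReal.ofReal |b z.2.2| ∂(P ω) < ⊤)
    (h0 : P ω ({0} ×ˢ univ) = 0) {s : ℝ≥0} (hZ : acceptedMass P b lam s ω < ⊤)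
    (heq : lam s ω = ψ (∫ z in {z : State | z.1 < s ∧ (z.2.1 : ℝ) ≤ lam z.1 ω},
      h ((s : ℝ) - (z.1 : ℝ)) * b z.2.2 ∂(P ω))) (n : ℕ) :
    ENNReal.ofReal |lam s ω - discIntensity P h ψ b Δ ω n| ≤ L *
      ((∫⁻ z in {z : State | (z.2.1 : ℝ) ≤ lam z.1 ω},
        ENNReal.ofReal |pastKernel h s z.1 - gridKernel h Δ n z.1| * ENNReal.ofReal (b z.2.2) ∂(P ω))
      + ∫⁻ z in {z : State | ¬((z.2.1 : ℝ) ≤ lam z.1 ω ↔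
          (z.2.1 : ℝ) ≤ stepIntensity P h ψ b Δ z.1 ω)},
        ENNReal.ofReal |gridKernel h Δ n z.1| * ENNReal.ofReal (b z.2.2) ∂(P ω)) := by
  set A : Set State := {z : State | (z.2.1 : ℝ) ≤ lam z.1 ω} with hAdef
  set B : Set State := {z : State | (z.2.1 : ℝ) ≤ stepIntensity P h ψ b Δ z.1 ω} with hBdef
  have hA : MeasurableSet A := measurableSet_le_process hlam ω
  have hB : MeasurableSet B := measurableSet_le_process hstep ω
  have hm1 : MeasurableSet {z : State | z.1 < s} := measurable_fst measurableSet_Iio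
  set f : State → ℝ := fun z => pastKernel h s z.1 * b z.2.2 with hf
  set g : State → ℝ := fun z => gridKernel h Δ n z.1 * b z.2.2 with hg
  have hfm : Measurable f :=
    ((measurable_pastKernel hh s).comp measurable_fst).mul (hb.comp measurable_snd.snd)
  have hfind : f = {z : State | z.1 < s}.indicator
      fun z => h ((s : ℝ) - (z.1 : ℝ)) * b z.2.2 := by
    funext z
    simp only [hf, pastKernel]
    by_cases hz : z.1 < s
    · rw [indicator_of_mem (by exact hz), indicator_of_mem (by exact hz)]
    · rw [indicator_of_notMem (by exact hz), indicator_of_notMem (by exact hz), zero_mul]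
  have hset : {z : State | z.1 < s ∧ (z.2.1 : ℝ) ≤ lam z.1 ω} = A ∩ {z : State | z.1 < s} := by
    ext z; exact and_comm
  have hlamf : lam s ω = ψ (∫ z in A, f z ∂(P ω)) := by
    rw [heq, hset, hfind, setIntegral_indicator hm1]
  have hfint : IntegrableOn f A (P ω) := by
    refine ⟨hfm.aestronglyMeasurable, ?_⟩
    rw [← setLIntegral_before_eq_acceptedMass h0, hset] at hZ
    have hle : ∀ z, ‖f z‖ₑ ≤ ENNReal.ofReal H *
        {z : State | z.1 < s}.indicator (fun z => ENNReal.ofReal (b z.2.2)) z := by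
      intro z
      rw [hfind, Real.enorm_eq_ofReal_abs]
      by_cases hz : z.1 < s
      · rw [indicator_of_mem (by exact hz), indicator_of_mem (by exact hz), abs_mul,
          abs_of_nonneg (hb0 _), ENNReal.ofReal_mul (abs_nonneg _)]
        gcongr
        exact hH _
      · rw [indicator_of_notMem (by exact hz), abs_zero, ENNReal.ofReal_zero]
        exact zero_le
    refine (lintegral_mono hle).trans_lt ?_
    rw [lintegral_const_mul' _ _ ENNReal.ofReal_ne_top, setLIntegral_indicator hm1, inter_comm]
    exact ENNReal.mul_lt_top ENNReal.ofReal_lt_top hZ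
  obtain ⟨hdisc, hgint⟩ := discIntensity_eq_integral (h := h) (ψ := ψ) hb hΔ hbox n
  have hfA : Integrable (A.indicator f) (P ω) := (integrable_indicator_iff hA).2 hfint
  have hgB : Integrable (B.indicator g) (P ω) := (integrable_indicator_iff hB).2 hgint
  rw [hlamf, hdisc]
  refine (ofReal_lipschitz_le hψ _ _).trans ?_
  gcongr
  rw [← integral_indicator hA, ← integral_indicator hB, ← integral_sub hfA hgB]
  refine (ofReal_abs_integral_le _ _).trans ?_
  have hC : MeasurableSet {z : State | ¬((z.2.1 : ℝ) ≤ lam z.1 ω ↔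
      (z.2.1 : ℝ) ≤ stepIntensity P h ψ b Δ z.1 ω)} := (hA.iff hB).compl
  rw [← lintegral_indicator hA, ← lintegral_indicator hC, ← lintegral_add_left]
  · refine lintegral_mono fun z => ?_
    have habs : ∀ x : ℝ, ENNReal.ofReal |x * b z.2.2| = ENNReal.ofReal |x| * ENNReal.ofReal (b z.2.2) :=
      fun x => by rw [abs_mul, abs_of_nonneg (hb0 _), ENNReal.ofReal_mul (abs_nonneg _)]
    by_cases hzA : z ∈ A <;> by_cases hzB : z ∈ B
    · rw [indicator_of_mem hzA, indicator_of_mem hzB, indicator_of_mem hzA, ← habs]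
      refine le_add_of_le_of_nonneg (le_of_eq ?_) zero_le
      congr 2
      simp only [hf, hg]
      ring
    · have hzC : z ∈ {z : State | ¬((z.2.1 : ℝ) ≤ lam z.1 ω ↔
          (z.2.1 : ℝ) ≤ stepIntensity P h ψ b Δ z.1 ω)} := fun hc => hzB (hc.1 hzA)
      rw [indicator_of_mem hzA, indicator_of_notMem hzB, indicator_of_mem hzA,
        indicator_of_mem hzC, ← habs, ← habs, ← ENNReal.ofReal_add (abs_nonneg _) (abs_nonneg _)]
      refine ENNReal.ofReal_le_ofReal ?_
      refine le_trans (le_of_eq ?_) (abs_add_le _ _)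
      congr 1
      simp only [hf]
      ring
    · have hzC : z ∈ {z : State | ¬((z.2.1 : ℝ) ≤ lam z.1 ω ↔
          (z.2.1 : ℝ) ≤ stepIntensity P h ψ b Δ z.1 ω)} := fun hc => hzA (hc.2 hzB)
      rw [indicator_of_notMem hzA, indicator_of_mem hzB, indicator_of_mem hzC, ← habs, zero_sub,
        abs_neg]
      exact le_add_of_nonneg_of_le zero_le le_rfl
    · rw [indicator_of_notMem hzA, indicator_of_notMem hzB, sub_zero, abs_zero, ENNReal.ofReal_zero]
      exact zero_le
  · refine Measurable.indicator ?_ hA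
    exact ((((measurable_pastKernel hh s).sub (measurable_gridKernel h Δ n)).comp
      measurable_fst).abs.ennreal_ofReal).mul (hb.comp measurable_snd.snd).ennreal_ofReal

/-- The mean distance of the two intensities is controlled by the `L¹` distance `Γ` of the kernels:
it satisfies a renewal inequality with constant `ρ < 1`, which is solved by taking the supremum over
time. -/
theorem IsHawkesIntensity.lintegral_abs_sub_stepIntensity_le [IsProbabilityMeasure μ]
    [IsProbabilityMeasure ν] {L : ℝ≥0} {h ψ b : ℝ → ℝ} {T H ρ A Γ mb : ℝ} {lam : ℝ≥0 → Ω → ℝ}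
    (hl : IsHawkesIntensity P μ h ψ b T lam) (hP : IsPoissonRandomMeasure P ν μ)
    (hψ : LipschitzWith L ψ) (hψ0 : ∀ x, 0 ≤ ψ x) (hb : Measurable b) (hb0 : ∀ y, 0 ≤ b y)
    (hmb0 : 0 ≤ mb) (hmb : ∫⁻ y, ENNReal.ofReal (b y) ∂ν = ENNReal.ofReal mb)
    (hh : Measurable h) (hH : ∀ x, |h x| ≤ H) {Δ : ℝ≥0} (hΔ : 0 < Δ)
    (hρ0 : 0 ≤ ρ) (hρ1 : ρ < 1) {M : ℕ} (hMΔ : (M : ℝ) * Δ = T)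
    (hρ : ∀ n ≤ M, L * ((∫⁻ u, ENNReal.ofReal |gridKernel h Δ n u| ∂lebesgueNN)
      * ∫⁻ y, ENNReal.ofReal (b y) ∂ν) ≤ ENNReal.ofReal ρ)
    (hA0 : 0 ≤ A) (hΓ0 : 0 ≤ Γ)
    (hA : ∀ s : ℝ≥0, (s : ℝ) ≤ T → ∫⁻ ω, ENNReal.ofReal (lam s ω) ∂μ ≤ ENNReal.ofReal A)
    (hΓ : ∀ s : ℝ≥0, 0 < s → (s : ℝ) ≤ T →
      ∫⁻ u, ENNReal.ofReal |pastKernel h s u - gridKernel h Δ (binIdx Δ s) u| ∂lebesgueNN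
        ≤ ENNReal.ofReal Γ) {s : ℝ≥0} (hs0 : 0 < s) (hsT : (s : ℝ) ≤ T) :
    ∫⁻ ω, ENNReal.ofReal |lam s ω - stepIntensity P h ψ b Δ s ω| ∂μ
      ≤ ENNReal.ofReal (L * (Γ * A * mb) / (1 - ρ)) := by
  have hΔ' : (0 : ℝ) < Δ := hΔ
  have hb_fin : ∫⁻ y, ENNReal.ofReal (b y) ∂ν ≠ ⊤ := by rw [hmb]; exact ENNReal.ofReal_ne_top
  have hstepP := measurable_stepIntensity (h := h) hP hψ.continuous.measurable hb hb0 hΔ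
  have hstep := hstepP.mono (predictable_le P) le_rfl
  have hlam := hl.measurable
  set D : ℝ≥0 → ℝ≥0∞ := fun s =>
    ∫⁻ ω, ENNReal.ofReal |lam s ω - stepIntensity P h ψ b Δ s ω| ∂μ with hD
  set d : ℝ≥0∞ := ⨆ s : {s : ℝ≥0 // 0 < s ∧ (s : ℝ) ≤ T}, D s with hd
  have hle_d : ∀ u : ℝ≥0, 0 < u → (u : ℝ) ≤ T → D u ≤ d := fun u hu huT =>
    le_iSup (fun s : {s : ℝ≥0 // 0 < s ∧ (s : ℝ) ≤ T} => D s) ⟨u, hu, huT⟩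
  have hidx : ∀ s : ℝ≥0, (s : ℝ) ≤ T → binIdx Δ s ≤ M := fun s hs =>
    (binIdx_le_iff hΔ').2 (hMΔ ▸ hs)
  have hdfin : d ≠ ⊤ := by
    refine ne_top_of_le_ne_top (b := ENNReal.ofReal A + ENNReal.ofReal (ψ 0 / (1 - ρ)))
      (ENNReal.add_ne_top.2 ⟨ENNReal.ofReal_ne_top, ENNReal.ofReal_ne_top⟩) (iSup_le ?_)
    rintro ⟨s, hs0, hsT⟩
    calc D s ≤ ∫⁻ ω, (ENNReal.ofReal (lam s ω) + ENNReal.ofReal (stepIntensity P h ψ b Δ s ω)) ∂μ := by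
          refine lintegral_mono_ae ?_
          filter_upwards [hl.intensity_eq] with ω heq
          have h1 : 0 ≤ lam s ω := by rw [heq s hsT]; exact hψ0 _
          have h2 : 0 ≤ stepIntensity P h ψ b Δ s ω := by
            rw [stepIntensity, discIntensity]; exact hψ0 _
          rw [← ENNReal.ofReal_add h1 h2]
          refine ENNReal.ofReal_le_ofReal ?_
          rw [abs_le]
          constructor <;> linarith
      _ = _ := lintegral_add_left
          (hlam.comp (measurable_const.prodMk measurable_id)).ennreal_ofReal _
      _ ≤ _ := add_le_add (hA s hsT) (lintegral_discIntensity_le hP hψ hψ0 hb hb0 hb_fin hΔ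
          hρ0 hρ1 hρ (hidx s hsT))
  have hrec : ∀ s : {s : ℝ≥0 // 0 < s ∧ (s : ℝ) ≤ T},
      D s ≤ ENNReal.ofReal (L * (Γ * A * mb)) + ENNReal.ofReal ρ * d := by
    rintro ⟨s, hs0, hsT⟩
    set n := binIdx Δ s with hn
    have hcm : Measurable fun u => ENNReal.ofReal |pastKernel h s u - gridKernel h Δ n u| :=
      ((measurable_pastKernel hh s).sub (measurable_gridKernel h Δ n)).abs.ennreal_ofReal
    have hgm : Measurable fun u => ENNReal.ofReal |gridKernel h Δ n u| :=
      (measurable_gridKernel h Δ n).abs.ennreal_ofReal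
    have hsfk := hP.isSFiniteKernel
    have hint1 : Measurable fun ω => ∫⁻ z in {z : State | (z.2.1 : ℝ) ≤ lam z.1 ω},
        ENNReal.ofReal |pastKernel h s z.1 - gridKernel h Δ n z.1|
          * ENNReal.ofReal (b z.2.2) ∂(P ω) := by
      exact measurable_lintegral_below hlam
        ((hcm.comp measurable_fst).mul (hb.comp measurable_snd.snd).ennreal_ofReal)
    calc D s ≤ ∫⁻ ω, L *
          ((∫⁻ z in {z : State | (z.2.1 : ℝ) ≤ lam z.1 ω},
            ENNReal.ofReal |pastKernel h s z.1 - gridKernel h Δ n z.1|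
              * ENNReal.ofReal (b z.2.2) ∂(P ω))
          + ∫⁻ z in {z : State | ¬((z.2.1 : ℝ) ≤ lam z.1 ω ↔
              (z.2.1 : ℝ) ≤ stepIntensity P h ψ b Δ z.1 ω)},
            ENNReal.ofReal |gridKernel h Δ n z.1| * ENNReal.ofReal (b z.2.2) ∂(P ω)) ∂μ := by
          refine lintegral_mono_ae ?_
          filter_upwards [hl.intensity_eq, hP.ae_apply_zero_time,
            hP.ae_lintegral_box_lt_top hb.ennreal_ofReal hb_fin,
            hl.ae_acceptedMass_lt_top hP hb hb_fin] with ω heq h0 hbox hZ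
          refine ofReal_abs_intensity_sub_le hψ hh hH hb hb0 hΔ' hlam hstep (fun k => ?_) h0
            (hZ s hsT) (heq s hsT) n
          simp_rw [abs_of_nonneg (hb0 _)]
          exact hbox k
      _ = L * ((∫⁻ u, ENNReal.ofReal |pastKernel h s u - gridKernel h Δ n u|
              * (∫⁻ ω, ENNReal.ofReal (lam u ω) ∂μ) ∂lebesgueNN) * ENNReal.ofReal mb
          + ∫⁻ ω, ∫⁻ z in {z : State | ¬((z.2.1 : ℝ) ≤ lam z.1 ω ↔
              (z.2.1 : ℝ) ≤ stepIntensity P h ψ b Δ z.1 ω)},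
            ENNReal.ofReal |gridKernel h Δ n z.1| * ENNReal.ofReal (b z.2.2) ∂(P ω) ∂μ) := by
          rw [lintegral_const_mul' _ _ ENNReal.coe_ne_top, lintegral_add_left hint1,
            hP.lintegral_below hl.predictable.measurable hcm hb.ennreal_ofReal, hmb]
      _ ≤ L * ((ENNReal.ofReal Γ * ENNReal.ofReal A) * ENNReal.ofReal mb
          + ((∫⁻ u, ENNReal.ofReal |gridKernel h Δ n u| ∂lebesgueNN) * d)
              * ∫⁻ y, ENNReal.ofReal (b y) ∂ν) := by
          gcongr
          · calc ∫⁻ u, ENNReal.ofReal |pastKernel h s u - gridKernel h Δ n u|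
                  * (∫⁻ ω, ENNReal.ofReal (lam u ω) ∂μ) ∂lebesgueNN
                ≤ ∫⁻ u, ENNReal.ofReal |pastKernel h s u - gridKernel h Δ n u|
                  * ENNReal.ofReal A ∂lebesgueNN := by
                  refine lintegral_mono fun u => ?_
                  by_cases hu : u < s
                  · gcongr
                    exact hA u ((NNReal.coe_le_coe.2 hu.le).trans hsT)
                  · have h1 : pastKernel h s u = 0 := indicator_of_notMem (by exact hu) _
                    have h2 : gridKernel h Δ n u = 0 := by
                      refine indicator_of_notMem (fun hc => hu ?_) _
                      exact_mod_cast lt_of_binIdx_lt hΔ' hc.2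
                    simp [h1, h2]
              _ = _ := lintegral_mul_const _ hcm
              _ ≤ _ := by gcongr; exact hΓ s hs0 hsT
          · refine (hP.lintegral_disagree_le hl.predictable.measurable hstepP hgm
              hb.ennreal_ofReal).trans ?_
            gcongr
            rw [← lintegral_mul_const _ hgm]
            refine lintegral_mono fun u => ?_
            by_cases hu : u ∈ {u : ℝ≥0 | 0 < u ∧ binIdx Δ u < n}
            · gcongr
              refine hle_d u hu.1 ?_
              exact (lt_of_binIdx_lt hΔ' hu.2).le.trans hsT
            · simp [gridKernel, hu]
      _ = ENNReal.ofReal (L * (Γ * A * mb)) + (L * ((∫⁻ u, ENNReal.ofReal |gridKernel h Δ n u|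
            ∂lebesgueNN) * ∫⁻ y, ENNReal.ofReal (b y) ∂ν)) * d := by
          rw [ENNReal.ofReal_mul L.coe_nonneg, ENNReal.ofReal_mul (by positivity),
            ENNReal.ofReal_mul hΓ0, ENNReal.ofReal_coe_nnreal]
          ring
      _ ≤ _ := by
          gcongr
          exact hρ n (hidx s hsT)
  exact (hle_d s hs0 hsT).trans
    (ennreal_le_div_of_le_add_mul hdfin (by positivity) hρ0 hρ1 (iSup_le hrec))

end Discrete

/-! ### Fractional Sobolev norm -/

theorem sobolevNorm_congr {η T : ℝ} {u v : ℝ → ℝ} (h : EqOn u v (Icc 0 T)) :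
    sobolevNorm η T u = sobolevNorm η T v := by
  rw [sobolevNorm, sobolevNorm]
  congr 1
  · exact setLIntegral_congr_fun measurableSet_Icc fun t ht => by simp only [h ht]
  · refine setLIntegral_congr_fun measurableSet_Icc fun s hs => ?_
    exact setLIntegral_congr_fun measurableSet_Icc fun t ht => by simp only [h ht, h hs]

theorem measurable_sobolevIntegrand (η : ℝ) {u : ℝ → ℝ} (hu : Measurable u) :
    Measurable fun x : ℝ × ℝ => ENNReal.ofReal (|u x.2 - u x.1| / |x.2 - x.1| ^ (1 + η)) := by
  have : Measurable fun x : ℝ × ℝ => |x.2 - x.1| ^ (1 + η) :=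
    (measurable_snd.sub measurable_fst).abs.pow_const _
  exact (((hu.comp measurable_snd).sub (hu.comp measurable_fst)).abs.div this).ennreal_ofReal

theorem sobolevNorm_add_le {η T : ℝ} {u v : ℝ → ℝ} (hu : Measurable u) :
    sobolevNorm η T (fun t => u t + v t) ≤ sobolevNorm η T u + sobolevNorm η T v := by
  have h1 : ∫⁻ t in Icc 0 T, ENNReal.ofReal |u t + v t|
      ≤ (∫⁻ t in Icc 0 T, ENNReal.ofReal |u t|) + ∫⁻ t in Icc 0 T, ENNReal.ofReal |v t| := by
    rw [← lintegral_add_left hu.abs.ennreal_ofReal]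
    refine lintegral_mono fun t => ?_
    rw [← ENNReal.ofReal_add (abs_nonneg _) (abs_nonneg _)]
    exact ENNReal.ofReal_le_ofReal (abs_add_le _ _)
  have h2 : ∫⁻ s in Icc 0 T, ∫⁻ t in Icc 0 T,
        ENNReal.ofReal (|u t + v t - (u s + v s)| / |t - s| ^ (1 + η))
      ≤ (∫⁻ s in Icc 0 T, ∫⁻ t in Icc 0 T, ENNReal.ofReal (|u t - u s| / |t - s| ^ (1 + η)))
        + ∫⁻ s in Icc 0 T, ∫⁻ t in Icc 0 T, ENNReal.ofReal (|v t - v s| / |t - s| ^ (1 + η)) := by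
    have hm := measurable_sobolevIntegrand η hu
    rw [← lintegral_add_left (Measurable.lintegral_prod_right' hm)]
    refine lintegral_mono fun s => ?_
    rw [← lintegral_add_left (show Measurable fun t =>
      ENNReal.ofReal (|u t - u s| / |t - s| ^ (1 + η)) from hm.comp measurable_prodMk_left)]
    refine lintegral_mono fun t => ?_
    rw [← ENNReal.ofReal_add (by positivity) (by positivity), ← add_div]
    refine ENNReal.ofReal_le_ofReal ?_
    gcongr
    rw [add_sub_add_comm]
    exact abs_add_le _ _
  refine (add_le_add h1 h2).trans (le_of_eq ?_)
  rw [sobolevNorm, sobolevNorm]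
  ring

theorem sobolevNorm_const_mul (η T c : ℝ) (u : ℝ → ℝ) :
    sobolevNorm η T (fun t => c * u t) = ENNReal.ofReal |c| * sobolevNorm η T u := by
  rw [sobolevNorm, sobolevNorm, mul_add, ← lintegral_const_mul' _ _ ENNReal.ofReal_ne_top,
    ← lintegral_const_mul' _ _ ENNReal.ofReal_ne_top]
  congr 1
  · refine lintegral_congr fun t => ?_
    rw [abs_mul, ENNReal.ofReal_mul (abs_nonneg _)]
  · refine lintegral_congr fun s => ?_
    rw [← lintegral_const_mul' _ _ ENNReal.ofReal_ne_top]
    refine lintegral_congr fun t => ?_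
    rw [← mul_sub, abs_mul, mul_div_assoc, ENNReal.ofReal_mul (abs_nonneg _)]

/-- Minkowski's inequality for the fractional Sobolev norm of a superposition. -/
theorem sobolevNorm_integral_le {α : Type*} [MeasurableSpace α] {m : Measure α} [SFinite m]
    {η T : ℝ} {F : α → ℝ → ℝ} (hF : Measurable (Function.uncurry F))
    (hint : ∀ t ∈ Icc 0 T, Integrable (fun z => F z t) m) :
    sobolevNorm η T (fun t => ∫ z, F z t ∂m) ≤ ∫⁻ z, sobolevNorm η T (F z) ∂m := by
  have hm1 : Measurable fun x : α × ℝ => ENNReal.ofReal |F x.1 x.2| := hF.abs.ennreal_ofReal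
  have hm2 : Measurable fun x : (α × ℝ) × ℝ =>
      ENNReal.ofReal (|F x.1.1 x.2 - F x.1.1 x.1.2| / |x.2 - x.1.2| ^ (1 + η)) := by
    have h1 : Measurable fun x : (α × ℝ) × ℝ => F x.1.1 x.2 :=
      hF.comp (measurable_fst.fst.prodMk measurable_snd)
    have h2 : Measurable fun x : (α × ℝ) × ℝ => F x.1.1 x.1.2 := hF.comp measurable_fst
    have h3 : Measurable fun x : (α × ℝ) × ℝ => |x.2 - x.1.2| ^ (1 + η) :=
      (measurable_snd.sub measurable_fst.snd).abs.pow_const _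
    exact ((h1.sub h2).abs.div h3).ennreal_ofReal
  have h1 : ∫⁻ t in Icc 0 T, ENNReal.ofReal |∫ z, F z t ∂m|
      ≤ ∫⁻ z, (∫⁻ t in Icc 0 T, ENNReal.ofReal |F z t|) ∂m := by
    rw [lintegral_lintegral_swap hm1.aemeasurable]
    exact lintegral_mono fun t => ofReal_abs_integral_le _ _
  have h2 : ∫⁻ s in Icc 0 T, ∫⁻ t in Icc 0 T,
        ENNReal.ofReal (|(∫ z, F z t ∂m) - ∫ z, F z s ∂m| / |t - s| ^ (1 + η))
      ≤ ∫⁻ z, (∫⁻ s in Icc 0 T, ∫⁻ t in Icc 0 T,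
        ENNReal.ofReal (|F z t - F z s| / |t - s| ^ (1 + η))) ∂m := by
    refine le_of_le_of_eq ?_ (lintegral_lintegral_swap (f := fun z s => ∫⁻ t in Icc 0 T,
      ENNReal.ofReal (|F z t - F z s| / |t - s| ^ (1 + η)))
      (Measurable.lintegral_prod_right' hm2).aemeasurable).symm
    refine setLIntegral_mono' measurableSet_Icc fun s hs => ?_
    have hms : Measurable fun x : α × ℝ =>
        ENNReal.ofReal (|F x.1 x.2 - F x.1 s| / |x.2 - s| ^ (1 + η)) :=
      hm2.comp ((measurable_fst.prodMk measurable_const).prodMk measurable_snd)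
    rw [lintegral_lintegral_swap hms.aemeasurable]
    refine setLIntegral_mono' measurableSet_Icc fun t ht => ?_
    rw [← integral_sub (hint t ht) (hint s hs), div_eq_mul_inv,
      ENNReal.ofReal_mul (abs_nonneg _)]
    simp_rw [div_eq_mul_inv, ENNReal.ofReal_mul (abs_nonneg _)]
    rw [lintegral_mul_const' _ _ ENNReal.ofReal_ne_top]
    gcongr
    exact ofReal_abs_integral_le _ _
  have hm3 : Measurable fun z => ∫⁻ t in Icc 0 T, ENNReal.ofReal |F z t| :=
    Measurable.lintegral_prod_right' hm1
  refine (add_le_add h1 h2).trans (le_of_eq ?_)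
  rw [← lintegral_add_left hm3]
  rfl

/-- The bound `ℓ + (8/(1-η) + 4/η) ℓ^{1-η}` for the fractional Sobolev norm of the indicator of an
interval of length `ℓ`. -/
noncomputable def intervalBound (η ℓ : ℝ) : ℝ := ℓ + (8 / (1 - η) + 4 / η) * ℓ ^ (1 - η)

theorem intervalBound_nonneg {η ℓ : ℝ} (hη : 0 < η) (hη1 : η < 1) (hℓ : 0 ≤ ℓ) :
    0 ≤ intervalBound η ℓ := by
  have : 0 < 1 - η := by linarith
  rw [intervalBound]
  positivity

theorem lintegral_comp_abs_eq (f : ℝ → ℝ≥0∞) :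
    ∫⁻ x, f |x| = 2 * ∫⁻ x in Ioi 0, f x := by
  have h1 : ∫⁻ x in Ioi (0 : ℝ), f |x| = ∫⁻ x in Ioi (0 : ℝ), f x :=
    setLIntegral_congr_fun measurableSet_Ioi fun x hx => by simp only [abs_of_pos (mem_Ioi.1 hx)]
  have h2 : ∫⁻ x in Iic (0 : ℝ), f |x| = ∫⁻ x in Ioi (0 : ℝ), f x := by
    rw [← h1, setLIntegral_congr (Iio_ae_eq_Iic (a := (0 : ℝ))).symm,
      ← lintegral_indicator measurableSet_Iio, ← lintegral_indicator measurableSet_Ioi,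
      ← lintegral_neg_eq_self]
    refine lintegral_congr fun x => ?_
    by_cases hx : 0 < x
    · rw [indicator_of_mem (by simpa using hx), indicator_of_mem (by simpa using hx), abs_neg]
    · rw [indicator_of_notMem (by simpa using hx), indicator_of_notMem (by simpa using hx)]
  rw [← lintegral_add_compl _ (measurableSet_Iic (a := (0 : ℝ))), compl_Iic, h1, h2, two_mul]

theorem lintegral_min_rpow_le {η ℓ : ℝ} (hη : 0 < η) (hη1 : η < 1) (hℓ : 0 < ℓ) :
    ∫⁻ x in Ioi (0 : ℝ), ENNReal.ofReal (min (4 * x) (2 * ℓ) / x ^ (1 + η))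
      ≤ ENNReal.ofReal ((4 / (1 - η) + 2 / η) * ℓ ^ (1 - η)) := by
  have hη2 : 0 < 1 - η := by linarith
  rw [← Ioc_union_Ioi_eq_Ioi hℓ.le]
  refine (lintegral_union_le _ _ _).trans ?_
  rw [add_mul, ENNReal.ofReal_add (by positivity) (by positivity)]
  refine add_le_add ?_ ?_
  · calc ∫⁻ x in Ioc (0 : ℝ) ℓ, ENNReal.ofReal (min (4 * x) (2 * ℓ) / x ^ (1 + η))
        ≤ ∫⁻ x in Ioc (0 : ℝ) ℓ, ENNReal.ofReal (4 * x ^ (-η)) := by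
          refine setLIntegral_mono' measurableSet_Ioc fun x hx => ENNReal.ofReal_le_ofReal ?_
          rw [div_le_iff₀ (Real.rpow_pos_of_pos hx.1 _), mul_assoc, ← Real.rpow_add hx.1]
          refine (min_le_left _ _).trans (le_of_eq ?_)
          simp
      _ = ENNReal.ofReal (∫ x in Ioc (0 : ℝ) ℓ, 4 * x ^ (-η)) := by
          rw [ofReal_integral_eq_lintegral_ofReal]
          · have := (intervalIntegral.intervalIntegrable_rpow' (a := 0) (b := ℓ)
              (show -1 < -η by linarith)).const_mul 4
            exact (intervalIntegrable_iff_integrableOn_Ioc_of_le hℓ.le).1 this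
          · exact (ae_restrict_iff' measurableSet_Ioc).2 (Eventually.of_forall fun x hx =>
              mul_nonneg (by norm_num) (Real.rpow_nonneg hx.1.le _))
      _ ≤ _ := by
          rw [← intervalIntegral.integral_of_le hℓ.le, intervalIntegral.integral_const_mul,
            integral_rpow (Or.inl (by linarith)), Real.zero_rpow (by linarith)]
          refine le_of_eq ?_
          congr 1
          rw [show -η + 1 = 1 - η by ring]
          ring
  · calc ∫⁻ x in Ioi ℓ, ENNReal.ofReal (min (4 * x) (2 * ℓ) / x ^ (1 + η))
        ≤ ∫⁻ x in Ioi ℓ, ENNReal.ofReal (2 * ℓ * x ^ (-(1 + η))) := by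
          refine setLIntegral_mono' measurableSet_Ioi fun x hx => ENNReal.ofReal_le_ofReal ?_
          have hx0 : 0 < x := hℓ.trans hx
          rw [Real.rpow_neg hx0.le, ← div_eq_mul_inv]
          gcongr
          exact min_le_right _ _
      _ = ENNReal.ofReal (∫ x in Ioi ℓ, 2 * ℓ * x ^ (-(1 + η))) := by
          rw [ofReal_integral_eq_lintegral_ofReal]
          · exact (integrableOn_Ioi_rpow_of_lt (by linarith) hℓ).const_mul _
          · refine (ae_restrict_iff' measurableSet_Ioi).2 (Eventually.of_forall fun x hx => ?_)
            have hx0 : 0 < x := hℓ.trans hx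
            positivity
      _ ≤ _ := by
          rw [integral_const_mul, integral_Ioi_rpow_of_lt (by linarith) hℓ]
          refine le_of_eq ?_
          congr 1
          rw [show -(1 + η) + 1 = -η by ring, sub_eq_add_neg 1 η, Real.rpow_add hℓ, Real.rpow_one]
          field_simp

/-- After the substitution `t = s + x`, the double integral only sees the measure of the symmetric
difference of `[a, b)` with its translate by `x`, which is at most `min (4|x|) (2(b-a))`. -/
theorem sobolevNorm_indicator_le {η : ℝ} (hη : 0 < η) (hη1 : η < 1) (T : ℝ) {a b ℓ : ℝ}
    (hℓ : 0 < ℓ) (hab : b - a ≤ ℓ) :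
    sobolevNorm η T ((Ico a b).indicator 1) ≤ ENNReal.ofReal (intervalBound η ℓ) := by
  have hη2 : 0 < 1 - η := by linarith
  set φ : ℝ → ℝ := (Ico a b).indicator 1 with hφ
  have hφm : Measurable φ := measurable_one.indicator measurableSet_Ico
  rw [intervalBound, ENNReal.ofReal_add hℓ.le (by positivity)]
  refine add_le_add ?_ ?_
  · calc ∫⁻ t in Icc 0 T, ENNReal.ofReal |φ t| ≤ ∫⁻ t, (Ico a b).indicator 1 t := by
          refine (setLIntegral_le_lintegral _ _).trans (lintegral_mono fun t => ?_)
          by_cases ht : t ∈ Ico a b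
          · simp [hφ, ht]
          · simp [hφ, ht]
      _ = ENNReal.ofReal (b - a) := by
          rw [lintegral_indicator_one measurableSet_Ico, Real.volume_Ico]
      _ ≤ _ := ENNReal.ofReal_le_ofReal hab
  · have hm := measurable_sobolevIntegrand η hφm
    have hshift : ∀ x : ℝ, ∫⁻ s, ENNReal.ofReal |φ (x + s) - φ s|
        ≤ ENNReal.ofReal (min (4 * |x|) (2 * ℓ)) := by
      intro x
      have hle : ∀ S : Set ℝ, MeasurableSet S → (∀ s, φ (x + s) ≠ φ s → s ∈ S) →
          ∫⁻ s, ENNReal.ofReal |φ (x + s) - φ s| ≤ volume S := by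
        intro S hS h
        rw [← lintegral_indicator_one hS]
        refine lintegral_mono fun s => ?_
        by_cases hs : φ (x + s) = φ s
        · rw [hs, sub_self, abs_zero, ENNReal.ofReal_zero]
          exact zero_le
        · rw [indicator_of_mem (h s hs), Pi.one_apply, ← ENNReal.ofReal_one]
          refine ENNReal.ofReal_le_ofReal ?_
          simp only [hφ, indicator, Pi.one_apply]
          split_ifs <;> norm_num
      have hmem : ∀ s, φ (x + s) ≠ φ s →
          (x + s ∈ Ico a b ∧ s ∉ Ico a b) ∨ (x + s ∉ Ico a b ∧ s ∈ Ico a b) := by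
        intro s hs
        by_cases h1 : x + s ∈ Ico a b <;> by_cases h2 : s ∈ Ico a b
        · exact absurd (by simp [hφ, h1, h2]) hs
        · exact Or.inl ⟨h1, h2⟩
        · exact Or.inr ⟨h1, h2⟩
        · exact absurd (by simp [hφ, h1, h2]) hs
      rw [min_def]
      split_ifs
      · refine (hle (Icc (a - |x|) (a + |x|) ∪ Icc (b - |x|) (b + |x|))
          (measurableSet_Icc.union measurableSet_Icc) fun s hs => ?_).trans ?_
        · have h1 := le_abs_self x
          have h2 := neg_abs_le x
          simp only [mem_union, mem_Icc]
          rcases hmem s hs with ⟨⟨h3, h4⟩, h5⟩ | ⟨h5, h3, h4⟩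
          · rw [mem_Ico, not_and_or, not_le, not_lt] at h5
            rcases h5 with h5 | h5
            · left; constructor <;> linarith
            · right; constructor <;> linarith
          · rw [mem_Ico, not_and_or, not_le, not_lt] at h5
            rcases h5 with h5 | h5
            · left; constructor <;> linarith
            · right; constructor <;> linarith
        · refine (measure_union_le _ _).trans (le_of_eq ?_)
          rw [Real.volume_Icc, Real.volume_Icc, ← ENNReal.ofReal_add
            (by linarith [abs_nonneg x]) (by linarith [abs_nonneg x])]
          congr 1
          ring
      · refine (hle (Ico (a - x) (b - x) ∪ Ico a b)
          (measurableSet_Ico.union measurableSet_Ico) fun s hs => ?_).trans ?_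
        · rcases hmem s hs with ⟨⟨h3, h4⟩, h5⟩ | ⟨h5, h3⟩
          · left; constructor <;> linarith
          · right; exact h3
        · refine (measure_union_le _ _).trans ?_
          rw [Real.volume_Ico, Real.volume_Ico, two_mul, ENNReal.ofReal_add hℓ.le hℓ.le]
          exact add_le_add (ENNReal.ofReal_le_ofReal (by linarith))
            (ENNReal.ofReal_le_ofReal hab)
    calc ∫⁻ s in Icc 0 T, ∫⁻ t in Icc 0 T, ENNReal.ofReal (|φ t - φ s| / |t - s| ^ (1 + η))
        ≤ ∫⁻ s, ∫⁻ t, ENNReal.ofReal (|φ t - φ s| / |t - s| ^ (1 + η)) :=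
          (setLIntegral_le_lintegral _ _).trans
            (lintegral_mono fun s => setLIntegral_le_lintegral _ _)
      _ = ∫⁻ s, ∫⁻ x, ENNReal.ofReal (|φ (x + s) - φ s| / |x| ^ (1 + η)) := by
          refine lintegral_congr fun s => ?_
          rw [← lintegral_add_right_eq_self _ s]
          simp only [add_sub_cancel_right]
      _ = ∫⁻ x, ∫⁻ s, ENNReal.ofReal (|φ (x + s) - φ s| / |x| ^ (1 + η)) := by
          refine lintegral_lintegral_swap (Measurable.aemeasurable ?_)
          have : Measurable fun x : ℝ × ℝ => |x.2| ^ (1 + η) :=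
            measurable_snd.abs.pow_const _
          exact (((hφm.comp (measurable_snd.add measurable_fst)).sub
            (hφm.comp measurable_fst)).abs.div this).ennreal_ofReal
      _ ≤ ∫⁻ x, ENNReal.ofReal (min (4 * |x|) (2 * ℓ) / |x| ^ (1 + η)) := by
          refine lintegral_mono fun x => ?_
          simp_rw [div_eq_mul_inv, ENNReal.ofReal_mul (abs_nonneg _)]
          rw [lintegral_mul_const' _ _ ENNReal.ofReal_ne_top,
            ENNReal.ofReal_mul (le_min (by positivity) (by positivity))]
          gcongr
          exact hshift x
      _ = 2 * ∫⁻ x in Ioi (0 : ℝ), ENNReal.ofReal (min (4 * x) (2 * ℓ) / x ^ (1 + η)) := by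
          exact lintegral_comp_abs_eq fun x => ENNReal.ofReal (min (4 * x) (2 * ℓ) / x ^ (1 + η))
      _ ≤ 2 * ENNReal.ofReal ((4 / (1 - η) + 2 / η) * ℓ ^ (1 - η)) := by
          gcongr
          exact lintegral_min_rpow_le hη hη1 hℓ
      _ = ENNReal.ofReal ((8 / (1 - η) + 4 / η) * ℓ ^ (1 - η)) := by
          rw [show (2 : ℝ≥0∞) = ENNReal.ofReal 2 by simp, ← ENNReal.ofReal_mul (by norm_num)]
          congr 1
          ring

/-! ### Error of the risk process -/

section Risk

variable {Ω : Type*} [mΩ : MeasurableSpace Ω] {P : Kernel Ω State} {ν : Measure ℝ} {μ : Measure Ω}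

/-- The contribution at time `t` of the point `z` to the difference of the two risk processes. A
point accepted by exactly one of the thinnings contributes from its own time on; a point accepted by
the discrete thinning is seen only from the end of its time bin on. -/
noncomputable def riskDiff (T Δ : ℝ) (X Y : ℝ≥0 → ℝ) (z : State) (t : ℝ) : ℝ :=
  (if 0 < z.1 ∧ (z.1 : ℝ) ≤ T then z.2.2 * ((if (z.2.1 : ℝ) ≤ X z.1 then 1 else 0)
      - if (z.2.1 : ℝ) ≤ Y z.1 then 1 else 0) else 0)
    * (Ico (z.1 : ℝ) (z.1 + T)).indicator 1 t
  + (if 0 < z.1 ∧ (z.1 : ℝ) ≤ T then z.2.2 * (if (z.2.1 : ℝ) ≤ Y z.1 then 1 else 0) else 0)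
    * (Ico (z.1 : ℝ) (binIdx Δ z.1 * Δ)).indicator 1 t

theorem indicator_sub_indicator_eq_riskDiff {T Δ : ℝ} (hΔ : 0 < Δ) (X Y : ℝ≥0 → ℝ) {t : ℝ}
    (ht : t ∈ Icc 0 T) (z : State) :
    {z : State | 0 < z.1 ∧ (z.1 : ℝ) ≤ t ∧ (z.2.1 : ℝ) ≤ X z.1}.indicator (fun z => z.2.2) z
      - {z : State | 0 < z.1 ∧ binIdx Δ z.1 < ⌊t / Δ⌋₊ + 1 ∧ (z.2.1 : ℝ) ≤ Y z.1}.indicator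
        (fun z => z.2.2) z = riskDiff T Δ X Y z t := by
  have hbin : binIdx Δ z.1 < ⌊t / Δ⌋₊ + 1 ↔ binIdx Δ z.1 * Δ ≤ t := by
    rw [Nat.lt_succ_iff, Nat.le_floor_iff (div_nonneg ht.1 hΔ.le), le_div_iff₀ hΔ]
  have hle : (z.1 : ℝ) ≤ binIdx Δ z.1 * Δ := le_binIdx_mul hΔ _
  simp only [riskDiff, indicator, mem_ofPred_eq, mem_Ico, Pi.one_apply, hbin]
  by_cases h0 : 0 < z.1
  · have h0' : (0 : ℝ) < z.1 := h0
    by_cases h1 : (z.1 : ℝ) ≤ t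
    · have h2 : (z.1 : ℝ) ≤ T := h1.trans ht.2
      have h3 : t < (z.1 : ℝ) + T := by linarith [ht.2]
      by_cases h4 : binIdx Δ z.1 * Δ ≤ t
      · by_cases h5 : (z.2.1 : ℝ) ≤ X z.1 <;> by_cases h6 : (z.2.1 : ℝ) ≤ Y z.1 <;>
          simp [h0, h1, h2, h3, h4, h5, h6, not_lt.2 h4]
      · by_cases h5 : (z.2.1 : ℝ) ≤ X z.1 <;> by_cases h6 : (z.2.1 : ℝ) ≤ Y z.1 <;>
          simp [h0, h1, h2, h3, h4, h5, h6, not_le.1 h4]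
    · have h4 : ¬ binIdx Δ z.1 * Δ ≤ t := fun hc => h1 (hle.trans hc)
      simp [h1, h4]
  · simp [h0]

theorem measurable_riskDiff (T Δ : ℝ) {X Y : ℝ≥0 → ℝ} (hX : Measurable X) (hY : Measurable Y) :
    Measurable (Function.uncurry (riskDiff T Δ X Y)) := by
  have hz : Measurable fun x : State × ℝ => (x.1.1 : ℝ) :=
    measurable_coe_nnreal.comp measurable_fst.fst
  have hθ : Measurable fun x : State × ℝ => (x.1.2.1 : ℝ) :=
    measurable_coe_nnreal.comp measurable_fst.snd.fst
  have hT : MeasurableSet {x : State × ℝ | 0 < x.1.1 ∧ (x.1.1 : ℝ) ≤ T} :=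
    (measurable_fst.fst measurableSet_Ioi).inter (measurableSet_le hz measurable_const)
  have h1 : Measurable fun x : State × ℝ => if (x.1.2.1 : ℝ) ≤ X x.1.1 then (1 : ℝ) else 0 :=
    Measurable.ite (measurableSet_le hθ (hX.comp measurable_fst.fst)) measurable_const
      measurable_const
  have h2 : Measurable fun x : State × ℝ => if (x.1.2.1 : ℝ) ≤ Y x.1.1 then (1 : ℝ) else 0 :=
    Measurable.ite (measurableSet_le hθ (hY.comp measurable_fst.fst)) measurable_const
      measurable_const
  have h3 : Measurable fun x : State × ℝ => (Ico (x.1.1 : ℝ) (x.1.1 + T)).indicator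
      (1 : ℝ → ℝ) x.2 := by
    simp only [indicator, Pi.one_apply]
    exact Measurable.ite ((measurableSet_le hz measurable_snd).inter
      (measurableSet_lt measurable_snd (hz.add_const T))) measurable_const measurable_const
  have hb : Measurable fun x : State × ℝ => (binIdx Δ x.1.1 : ℝ) * Δ :=
    ((measurable_from_top (f := fun k : ℕ => (k : ℝ))).comp
      ((measurable_binIdx Δ).comp hz)).mul_const Δ
  have h4 : Measurable fun x : State × ℝ => (Ico (x.1.1 : ℝ) (binIdx Δ x.1.1 * Δ)).indicator
      (1 : ℝ → ℝ) x.2 := by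
    simp only [indicator, Pi.one_apply]
    exact Measurable.ite ((measurableSet_le hz measurable_snd).inter
      (measurableSet_lt measurable_snd hb)) measurable_const measurable_const
  have hy : Measurable fun x : State × ℝ => x.1.2.2 := measurable_fst.snd.snd
  exact ((Measurable.ite hT (hy.mul (h1.sub h2)) measurable_const).mul h3).add
    ((Measurable.ite hT (hy.mul h2) measurable_const).mul h4)

/-- Each point contributes at most the norm of the indicator of an interval of length `T` if the
thinnings disagree on it, plus that of an interval of length at most `Δ` if the discrete thinning
accepts it. -/
theorem sobolevNorm_riskDiff_le {η T Δ : ℝ} (hη : 0 < η) (hη1 : η < 1) (hT : 0 < T) (hΔ : 0 < Δ)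
    (X Y : ℝ≥0 → ℝ) (z : State) :
    sobolevNorm η T (riskDiff T Δ X Y z)
      ≤ {z : State | ¬((z.2.1 : ℝ) ≤ X z.1 ↔ (z.2.1 : ℝ) ≤ Y z.1)}.indicator (fun z =>
          (Ioc (0 : ℝ≥0) T.toNNReal).indicator
            (fun _ => ENNReal.ofReal (intervalBound η T)) z.1 * ENNReal.ofReal |z.2.2|) z
        + {z : State | (z.2.1 : ℝ) ≤ Y z.1}.indicator (fun z =>
          (Ioc (0 : ℝ≥0) T.toNNReal).indicator
            (fun _ => ENNReal.ofReal (intervalBound η Δ)) z.1 * ENNReal.ofReal |z.2.2|) z := by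
  have hφ : ∀ a b : ℝ, Measurable ((Ico a b).indicator (1 : ℝ → ℝ)) := fun a b =>
    measurable_one.indicator measurableSet_Ico
  refine (sobolevNorm_add_le ((hφ _ _).const_mul _)).trans ?_
  rw [sobolevNorm_const_mul, sobolevNorm_const_mul]
  by_cases hz : 0 < z.1 ∧ (z.1 : ℝ) ≤ T
  · have hz' : z.1 ∈ Ioc (0 : ℝ≥0) T.toNNReal := ⟨hz.1, NNReal.le_toNNReal_of_coe_le hz.2⟩
    have hz0 : (0 : ℝ) < z.1 := hz.1
    rw [if_pos hz, if_pos hz]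
    have b1 := sobolevNorm_indicator_le hη hη1 T hT (a := z.1) (b := z.1 + T) (by linarith)
    have b2 := sobolevNorm_indicator_le hη hη1 T hΔ (a := z.1) (b := binIdx Δ z.1 * Δ)
      (by linarith [binIdx_mul_lt hΔ hz0])
    simp only [indicator, mem_ofPred_eq, hz', if_true]
    by_cases h5 : (z.2.1 : ℝ) ≤ X z.1 <;> by_cases h6 : (z.2.1 : ℝ) ≤ Y z.1
    · simp only [h5, h6, if_true, sub_self, mul_zero, abs_zero, ENNReal.ofReal_zero, zero_mul,
        zero_add, mul_one, not_true, if_false]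
      rw [mul_comm]
      gcongr
    · simp only [h5, h6, if_true, if_false, sub_zero, mul_one, mul_zero, abs_zero,
        ENNReal.ofReal_zero, zero_mul, add_zero, iff_false, not_true, not_false_eq_true]
      rw [mul_comm]
      gcongr
    · simp only [h5, h6, if_true, if_false, zero_sub, mul_neg, abs_neg, mul_one, iff_true,
        not_false_eq_true]
      rw [mul_comm, mul_comm (ENNReal.ofReal |z.2.2|)]
      gcongr
    · simp [h5, h6]
  · simp [hz]

theorem lintegral_indicator_Ioc_const_le (T : ℝ) (c : ℝ≥0∞) :
    ∫⁻ s, (Ioc (0 : ℝ≥0) T.toNNReal).indicator (fun _ => c) s ∂lebesgueNN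
      ≤ c * ENNReal.ofReal T := by
  rw [lintegral_indicator measurableSet_Ioc, setLIntegral_const]
  gcongr
  refine (measure_mono Ioc_subset_Iic_self).trans ?_
  rw [lebesgueNN_Iic]
  rfl

/-- Bound on a typical path: by Minkowski's inequality the norm of the difference of the risk
processes is at most the sum of the norms of the contributions of the points. -/
theorem sobolevNorm_risk_sub_discRisk_le {h ψ b : ℝ → ℝ} {η T Δ : ℝ} {lam : ℝ≥0 → Ω → ℝ} {ω : Ω}
    [SFinite (P ω)] (hη : 0 < η) (hη1 : η < 1) (hT : 0 < T) (hΔ : 0 < Δ)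
    (hlam : Measurable fun s => lam s ω)
    (hstep : Measurable fun s => stepIntensity P h ψ b Δ s ω)
    (hbox : ∀ n : ℕ, ∫⁻ z in box n, ENNReal.ofReal |z.2.2| ∂(P ω) < ⊤)
    (hfin : ∫⁻ z in {z : State | 0 < z.1 ∧ (z.1 : ℝ) ≤ T ∧ (z.2.1 : ℝ) ≤ lam z.1 ω},
      ENNReal.ofReal |z.2.2| ∂(P ω) < ⊤) :
    sobolevNorm η T (fun t => risk P lam t ω - discRisk P h ψ b Δ t ω)
      ≤ (∫⁻ z in {z : State | ¬((z.2.1 : ℝ) ≤ lam z.1 ω ↔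
            (z.2.1 : ℝ) ≤ stepIntensity P h ψ b Δ z.1 ω)},
          (Ioc (0 : ℝ≥0) T.toNNReal).indicator
            (fun _ => ENNReal.ofReal (intervalBound η T)) z.1 * ENNReal.ofReal |z.2.2| ∂(P ω))
        + ∫⁻ z in {z : State | (z.2.1 : ℝ) ≤ stepIntensity P h ψ b Δ z.1 ω},
          (Ioc (0 : ℝ≥0) T.toNNReal).indicator
            (fun _ => ENNReal.ofReal (intervalBound η Δ)) z.1 * ENNReal.ofReal |z.2.2| ∂(P ω) := by
  have hX : MeasurableSet {z : State | (z.2.1 : ℝ) ≤ lam z.1 ω} :=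
    measurableSet_le (measurable_coe_nnreal.comp measurable_snd.fst) (hlam.comp measurable_fst)
  have hY : MeasurableSet {z : State | (z.2.1 : ℝ) ≤ stepIntensity P h ψ b Δ z.1 ω} :=
    measurableSet_le (measurable_coe_nnreal.comp measurable_snd.fst) (hstep.comp measurable_fst)
  have hcoe : Measurable fun z : State => (z.1 : ℝ) := measurable_coe_nnreal.comp measurable_fst
  have hyint : Measurable fun z : State => ENNReal.ofReal |z.2.2| :=
    measurable_snd.snd.abs.ennreal_ofReal
  have key : ∀ t ∈ Icc 0 T, Integrable
      (fun z => riskDiff T Δ (fun s => lam s ω) (fun s => stepIntensity P h ψ b Δ s ω) z t) (P ω) ∧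
      risk P lam t ω - discRisk P h ψ b Δ t ω
        = ∫ z, riskDiff T Δ (fun s => lam s ω) (fun s => stepIntensity P h ψ b Δ s ω) z t
          ∂(P ω) := by
    intro t ht
    obtain ⟨h1, h2⟩ := sum_setIntegral_binBelow hΔ (m := P ω) (discIntensity P h ψ b Δ ω)
      (g := fun _ => 1) (f := fun y => y) ⌊t / Δ⌋₊
      (fun k _ => integrableOn_binBelow measurable_id hbox Δ k _)
    simp only [one_mul] at h1 h2
    have hS1 : MeasurableSet {z : State | 0 < z.1 ∧ (z.1 : ℝ) ≤ t ∧ (z.2.1 : ℝ) ≤ lam z.1 ω} :=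
      (measurable_fst measurableSet_Ioi).inter
        ((measurableSet_le hcoe measurable_const).inter hX)
    have hS2 : MeasurableSet {z : State | 0 < z.1 ∧ binIdx Δ z.1 < ⌊t / Δ⌋₊ + 1 ∧
        (z.2.1 : ℝ) ≤ stepIntensity P h ψ b Δ z.1 ω} :=
      (measurable_fst measurableSet_Ioi).inter
        ((((measurable_binIdx Δ).comp hcoe) measurableSet_Iio).inter hY)
    have h3 : IntegrableOn (fun z : State => z.2.2)
        {z : State | 0 < z.1 ∧ (z.1 : ℝ) ≤ t ∧ (z.2.1 : ℝ) ≤ lam z.1 ω} (P ω) := by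
      refine integrableOn_of_lintegral_lt_top measurable_id (lt_of_le_of_lt ?_ hfin)
      exact lintegral_mono_set fun z hz => ⟨hz.1, hz.2.1.trans ht.2, hz.2.2⟩
    have h4 := (integrable_indicator_iff hS1).2 h3
    have h5 := (integrable_indicator_iff hS2).2 h2
    have h6 := indicator_sub_indicator_eq_riskDiff hΔ (fun s => lam s ω)
      (fun s => stepIntensity P h ψ b Δ s ω) ht
    refine ⟨(h4.sub h5).congr (Eventually.of_forall h6), ?_⟩
    rw [← integral_congr_ae (Eventually.of_forall h6), integral_sub h4 h5,
      integral_indicator hS1, integral_indicator hS2]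
    congr 1
  rw [sobolevNorm_congr fun t ht => (key t ht).2]
  refine (sobolevNorm_integral_le (measurable_riskDiff T Δ hlam hstep)
    fun t ht => (key t ht).1).trans ?_
  refine (lintegral_mono fun z => sobolevNorm_riskDiff_le hη hη1 hT hΔ _ _ z).trans (le_of_eq ?_)
  have hc : ∀ c : ℝ≥0∞, Measurable fun z : State =>
      (Ioc (0 : ℝ≥0) T.toNNReal).indicator (fun _ => c) z.1 * ENNReal.ofReal |z.2.2| := fun c =>
    ((measurable_const.indicator measurableSet_Ioc).comp measurable_fst).mul hyint
  rw [lintegral_add_right _ ((hc _).indicator hY), lintegral_indicator hY]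
  congr 1
  exact lintegral_indicator (hX.iff hY).compl _

/-- Mean error of the risk process in terms of a bound `d` on the mean distance of the intensities
and a bound `A` on the mean of the discrete one. -/
theorem lintegral_sobolevNorm_risk_sub_le [IsProbabilityMeasure μ]
    [IsProbabilityMeasure ν] {h ψ b : ℝ → ℝ} {η T d A m : ℝ} {lam : ℝ≥0 → Ω → ℝ}
    (hl : IsHawkesIntensity P μ h ψ b T lam) (hP : IsPoissonRandomMeasure P ν μ)
    (hψ : Measurable ψ) (hb : Measurable b) (hb0 : ∀ y, 0 ≤ b y)
    (hη : 0 < η) (hη1 : η < 1) (hT : 0 < T) {Δ : ℝ≥0} (hΔ : 0 < Δ)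
    (hm0 : 0 ≤ m) (hm : ∫⁻ y, ENNReal.ofReal |y| ∂ν = ENNReal.ofReal m) (hd0 : 0 ≤ d) (hA0 : 0 ≤ A)
    (hd : ∀ s : ℝ≥0, 0 < s → (s : ℝ) ≤ T →
      ∫⁻ ω, ENNReal.ofReal |lam s ω - stepIntensity P h ψ b Δ s ω| ∂μ ≤ ENNReal.ofReal d)
    (hA : ∀ s : ℝ≥0, 0 < s → (s : ℝ) ≤ T →
      ∫⁻ ω, ENNReal.ofReal (stepIntensity P h ψ b Δ s ω) ∂μ ≤ ENNReal.ofReal A) :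
    ∫⁻ ω, sobolevNorm η T (fun t => risk P lam t ω - discRisk P h ψ b Δ t ω) ∂μ
      ≤ ENNReal.ofReal (T * m * (intervalBound η T * d + intervalBound η Δ * A)) := by
  have hΔ' : (0 : ℝ) < Δ := hΔ
  have := hP.isSFiniteKernel
  have hstepP := measurable_stepIntensity (h := h) hP hψ hb hb0 hΔ
  have hstep := hstepP.mono (predictable_le P) le_rfl
  have hlam := hl.measurable
  have hY : Measurable fun y : ℝ => ENNReal.ofReal |y| := measurable_id.abs.ennreal_ofReal
  have hfin : ∫⁻ y, ENNReal.ofReal |y| ∂ν ≠ ⊤ := by rw [hm]; exact ENNReal.ofReal_ne_top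
  have hC : ∀ c : ℝ≥0∞, Measurable ((Ioc (0 : ℝ≥0) T.toNNReal).indicator fun _ => c) := fun c =>
    measurable_const.indicator measurableSet_Ioc
  have hbound : ∀ (c e : ℝ≥0∞) (f : ℝ≥0 → ℝ≥0∞), (∀ s : ℝ≥0, 0 < s → (s : ℝ) ≤ T → f s ≤ e) →
      ∫⁻ s, (Ioc (0 : ℝ≥0) T.toNNReal).indicator (fun _ => c) s * f s ∂lebesgueNN
        ≤ c * ENNReal.ofReal T * e := by
    intro c e f hf
    calc _ ≤ ∫⁻ s, (Ioc (0 : ℝ≥0) T.toNNReal).indicator (fun _ => c) s * e ∂lebesgueNN := by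
          refine lintegral_mono fun s => ?_
          by_cases hs : s ∈ Ioc (0 : ℝ≥0) T.toNNReal
          · gcongr
            exact hf s hs.1 ((Real.le_toNNReal_iff_coe_le hT.le).1 hs.2)
          · simp [hs]
      _ ≤ _ := by
          rw [lintegral_mul_const _ (hC c)]
          gcongr
          exact lintegral_indicator_Ioc_const_le T c
  have hI := intervalBound_nonneg hη hη1 hT.le
  have hI' := intervalBound_nonneg hη hη1 hΔ'.le
  calc _ ≤ ∫⁻ ω, ((∫⁻ z in {z : State | ¬((z.2.1 : ℝ) ≤ lam z.1 ω ↔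
            (z.2.1 : ℝ) ≤ stepIntensity P h ψ b Δ z.1 ω)},
          (Ioc (0 : ℝ≥0) T.toNNReal).indicator
            (fun _ => ENNReal.ofReal (intervalBound η T)) z.1 * ENNReal.ofReal |z.2.2| ∂(P ω))
        + ∫⁻ z in {z : State | (z.2.1 : ℝ) ≤ stepIntensity P h ψ b Δ z.1 ω},
          (Ioc (0 : ℝ≥0) T.toNNReal).indicator
            (fun _ => ENNReal.ofReal (intervalBound η Δ)) z.1 * ENNReal.ofReal |z.2.2| ∂(P ω))
          ∂μ := by
        refine lintegral_mono_ae ?_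
        filter_upwards [hP.ae_eq_zero_of_lt_one, hl.finite_jumps,
          hP.ae_lintegral_box_lt_top hY hfin] with ω h01 hjump hbox
        refine sobolevNorm_risk_sub_discRisk_le hη hη1 hT hΔ'
          (hlam.comp (measurable_id.prodMk measurable_const))
          (hstep.comp (measurable_id.prodMk measurable_const)) hbox ?_
        exact setLIntegral_lt_top_of_measure_lt_top (g := fun y => ENNReal.ofReal |y|) h01 hbox
          ((measurable_fst measurableSet_Ioi).inter ((measurableSet_le
            (measurable_coe_nnreal.comp measurable_fst) measurable_const).inter
            (measurableSet_le_process hlam ω))) hjump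
    _ ≤ (ENNReal.ofReal (intervalBound η T) * ENNReal.ofReal T * ENNReal.ofReal d)
          * ENNReal.ofReal m
        + (ENNReal.ofReal (intervalBound η Δ) * ENNReal.ofReal T * ENNReal.ofReal A)
          * ENNReal.ofReal m := by
        have hf : Measurable fun z : State => (Ioc (0 : ℝ≥0) T.toNNReal).indicator
            (fun _ => ENNReal.ofReal (intervalBound η Δ)) z.1 * ENNReal.ofReal |z.2.2| :=
          ((hC _).comp measurable_fst).mul (hY.comp measurable_snd.snd)
        rw [lintegral_add_right _ (measurable_lintegral_below hstep hf), ← hm]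
        refine add_le_add ?_ ?_
        · refine (hP.lintegral_disagree_le hl.predictable.measurable hstepP (hC _) hY).trans ?_
          gcongr
          exact hbound _ _ _ hd
        · rw [hP.lintegral_below hstepP (hC _) hY]
          gcongr
          exact hbound _ _ _ hA
    _ = _ := by
        rw [← ENNReal.ofReal_mul hI, ← ENNReal.ofReal_mul (by positivity),
          ← ENNReal.ofReal_mul (by positivity), ← ENNReal.ofReal_mul hI',
          ← ENNReal.ofReal_mul (by positivity), ← ENNReal.ofReal_mul (by positivity),
          ← ENNReal.ofReal_add (by positivity) (by positivity)]
        congr 1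
        ring

end Risk

/-! ### Assembling the estimates -/

theorem ePVar_congr {p T : ℝ} {f g : ℝ → ℝ} (h : EqOn f g (Icc 0 T)) : ePVar p f T = ePVar p g T := by
  rw [ePVar, ePVar]
  refine iSup_congr fun q => Finset.sum_congr rfl fun i _ => ?_
  rw [h (q.2.2.2 _), h (q.2.2.2 _)]

theorem rho_congr {L : ℝ≥0} {f g b : ℝ → ℝ} {ν : Measure ℝ} {T : ℝ} (h : EqOn f g (Icc 0 T)) :
    rho L f b ν T = rho L g b ν T := by
  rw [rho, rho, setIntegral_congr_fun measurableSet_Icc fun t ht => congrArg abs (h ht)]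

section Assembly

variable {Ω : Type*} [mΩ : MeasurableSpace Ω] {P : Kernel Ω State} {ν : Measure ℝ} {μ : Measure Ω}

/-- Only the values of the kernel on `[0, T]` matter for the intensity. -/
theorem IsHawkesIntensity.congr_kernel {h h' ψ b : ℝ → ℝ} {T : ℝ} {lam : ℝ≥0 → Ω → ℝ}
    (hl : IsHawkesIntensity P μ h ψ b T lam) (hh : EqOn h h' (Icc 0 T)) :
    IsHawkesIntensity P μ h' ψ b T lam := by
  refine ⟨hl.predictable, hl.finite_jumps, ?_⟩
  filter_upwards [hl.intensity_eq] with ω hω t ht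
  rw [hω t ht]
  congr 1
  refine setIntegral_congr_fun ((measurable_fst measurableSet_Iio).inter
    (measurableSet_le_process hl.measurable ω)) fun z hz => ?_
  have hzt : (z.1 : ℝ) < t := hz.1
  have hz0 : (0 : ℝ) ≤ z.1 := z.1.coe_nonneg
  simp only [hh (show (t : ℝ) - z.1 ∈ Icc 0 T from ⟨by linarith, by linarith⟩)]

theorem discIntensity_congr {h h' : ℝ → ℝ} (ψ b : ℝ → ℝ) {T Δ : ℝ} (hΔ : 0 < Δ)
    (hh : EqOn h h' (Icc 0 T)) (ω : Ω) (n : ℕ) (hn : n * Δ ≤ T) :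
    discIntensity P h ψ b Δ ω n = discIntensity P h' ψ b Δ ω n := by
  induction n using Nat.strong_induction_on with
  | _ n ih =>
  rw [discIntensity_eq_sum, discIntensity_eq_sum]
  congr 1
  refine Finset.sum_congr rfl fun k hk => ?_
  rw [Finset.mem_Icc] at hk
  have hkn : (k : ℝ) ≤ n := by exact_mod_cast (show k ≤ n by omega)
  have hkT : k * Δ ≤ T := (mul_le_mul_of_nonneg_right hkn hΔ.le).trans hn
  have hk0 : 0 ≤ (k : ℝ) * Δ := by positivity
  rw [ih k (by omega) hkT, hh ⟨mul_nonneg (sub_nonneg.2 hkn) hΔ.le, by rw [sub_mul]; linarith⟩]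

theorem discRisk_congr {h h' : ℝ → ℝ} (ψ b : ℝ → ℝ) {T Δ : ℝ} (hΔ : 0 < Δ)
    (hh : EqOn h h' (Icc 0 T)) (ω : Ω) {t : ℝ} (ht : t ∈ Icc 0 T) :
    discRisk P h ψ b Δ t ω = discRisk P h' ψ b Δ t ω := by
  rw [discRisk, discRisk]
  refine Finset.sum_congr rfl fun k hk => ?_
  have h1 : (k : ℝ) ≤ t / Δ :=
    (Nat.le_floor_iff (div_nonneg ht.1 hΔ.le)).1 (Finset.mem_Icc.1 hk).2
  rw [discIntensity_congr ψ b hΔ hh ω k (((le_div_iff₀ hΔ).1 h1).trans ht.2)]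

/-- The error estimate with all constants explicit. -/
theorem IsHawkesIntensity.lintegral_sobolevNorm_le [IsProbabilityMeasure μ]
    [IsProbabilityMeasure ν] {L : ℝ≥0} {h ψ b : ℝ → ℝ} {η p T H ρ : ℝ} {lam : ℝ≥0 → Ω → ℝ}
    (hl : IsHawkesIntensity P μ h ψ b T lam) (hP : IsPoissonRandomMeasure P ν μ)
    (hψ : LipschitzWith L ψ) (hψ0 : ∀ x, 0 ≤ ψ x) (hb : Measurable b) (hb0 : ∀ y, 0 ≤ b y)
    (hbi : Integrable b ν) (hYi : Integrable (fun y : ℝ => y) ν)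
    (hη : 0 < η) (hη1 : η < 1) (hT : 0 < T) (hp : 1 ≤ p) (hh : Measurable h)
    (hH : ∀ x, |h x| ≤ H) (hV : ePVar p h T ≠ ⊤) (hρ0 : 0 ≤ ρ) (hρ1 : ρ < 1)
    (hρ : rho L h b ν T ≤ ρ) {M : ℕ} (hM : 1 ≤ M) (hρM : rhoDisc L h b ν T M ≤ ρ) :
    ∫⁻ ω, sobolevNorm η T (fun t => risk P lam t ω - discRisk P h ψ b (T / M) t ω) ∂μ
      ≤ ENNReal.ofReal (T * (∫ y, |y| ∂ν) * (intervalBound η T *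
          (L * ((2 * (pVarNorm p h T * T ^ ((p - 1) / p) * (T / M) ^ (1 / p)) + T / M * H)
            * (ψ 0 / (1 - ρ)) * ∫ y, b y ∂ν) / (1 - ρ))
        + intervalBound η (T / M) * (ψ 0 / (1 - ρ)))) := by
  have hM0 : (0 : ℝ) < M := by exact_mod_cast hM
  have hΔ0 : 0 < T / M := by positivity
  obtain ⟨Δ, hΔeq⟩ : ∃ Δ : ℝ≥0, (Δ : ℝ) = T / M := ⟨⟨T / M, hΔ0.le⟩, rfl⟩
  have hρM' : (L : ℝ) * (∑ k ∈ Finset.Icc 1 M, |h ((k : ℝ) * Δ)| * Δ) * ∫ y, b y ∂ν ≤ ρ := by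
    rw [hΔeq]; exact hρM
  have hMΔ : (M : ℝ) * Δ = T := by rw [hΔeq]; field_simp
  rw [← hΔeq] at hΔ0 ⊢
  have hΔ : 0 < Δ := hΔ0
  have hψ00 := hψ0 0
  have hρ2 : 0 < 1 - ρ := by linarith
  have hmb0 : 0 ≤ ∫ y, b y ∂ν := integral_nonneg hb0
  have hm0 : 0 ≤ ∫ y, |y| ∂ν := integral_nonneg fun y => abs_nonneg y
  have hmb : ∫⁻ y, ENNReal.ofReal (b y) ∂ν = ENNReal.ofReal (∫ y, b y ∂ν) :=
    (ofReal_integral_eq_lintegral_ofReal hbi (Eventually.of_forall hb0)).symm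
  have hm : ∫⁻ y, ENNReal.ofReal |y| ∂ν = ENNReal.ofReal (∫ y, |y| ∂ν) :=
    (ofReal_integral_eq_lintegral_ofReal hYi.abs (Eventually.of_forall fun y => abs_nonneg y)).symm
  have hbfin : ∫⁻ y, ENNReal.ofReal (b y) ∂ν ≠ ⊤ := by rw [hmb]; exact ENNReal.ofReal_ne_top
  have hhi : IntegrableOn (fun t => |h t|) (Icc 0 T) := (integrableOn_of_ePVar hp hT.le hV).abs
  have hρc : L * ((∫⁻ x in Icc 0 T, ENNReal.ofReal |h x|) * ∫⁻ y, ENNReal.ofReal (b y) ∂ν)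
      ≤ ENNReal.ofReal ρ := by
    rw [hmb, ← ofReal_integral_eq_lintegral_ofReal hhi (Eventually.of_forall fun y => abs_nonneg _),
      ← ENNReal.ofReal_mul (integral_nonneg fun y => abs_nonneg _), ← ENNReal.ofReal_coe_nnreal,
      ← ENNReal.ofReal_mul L.coe_nonneg, ← mul_assoc]
    exact ENNReal.ofReal_le_ofReal hρ
  have hρd : ∀ n ≤ M, L * ((∫⁻ u, ENNReal.ofReal |gridKernel h Δ n u| ∂lebesgueNN)
      * ∫⁻ y, ENNReal.ofReal (b y) ∂ν) ≤ ENNReal.ofReal ρ := by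
    intro n hn
    calc _ ≤ L * (ENNReal.ofReal (∑ k ∈ Finset.Icc 1 M, |h ((k : ℝ) * Δ)| * Δ)
          * ENNReal.ofReal (∫ y, b y ∂ν)) := by
          rw [hmb]
          gcongr
          exact lintegral_gridKernel_le h hΔ0 hn
      _ ≤ _ := by
          rw [← ENNReal.ofReal_mul (Finset.sum_nonneg fun k _ => by positivity),
            ← ENNReal.ofReal_coe_nnreal, ← ENNReal.ofReal_mul L.coe_nonneg, ← mul_assoc]
          exact ENNReal.ofReal_le_ofReal hρM'
  have hA : ∀ s : ℝ≥0, (s : ℝ) ≤ T →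
      ∫⁻ ω, ENNReal.ofReal (lam s ω) ∂μ ≤ ENNReal.ofReal (ψ 0 / (1 - ρ)) := fun s hs =>
    hl.lintegral_le hP hψ hψ0 hb hb0 hbfin hh hH hρ0 hρ1 hρc hs
  have hH0 : 0 ≤ H := (abs_nonneg _).trans (hH 0)
  have hV0 := pVarNorm_nonneg p h T
  exact lintegral_sobolevNorm_risk_sub_le hl hP hψ.continuous.measurable hb hb0 hη hη1 hT hΔ hm0 hm
    (by positivity) (by positivity)
    (fun s hs0 hsT => hl.lintegral_abs_sub_stepIntensity_le hP hψ hψ0 hb hb0 hmb0 hmb hh hH hΔ hρ0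
      hρ1 hMΔ hρd (by positivity) (by positivity) hA
      (fun s hs0 hsT => lintegral_pastKernel_sub_gridKernel_le hp hh hH hV hΔ0 hMΔ hs0 hsT) hs0 hsT)
    (fun s hs0 hsT => lintegral_discIntensity_le hP hψ hψ0 hb hb0 hbfin hΔ hρ0 hρ1 hρd
      ((binIdx_le_iff hΔ0).2 (by rw [hMΔ]; exact hsT)))

end Assembly

theorem intervalBound_le_mul {η T₀ T : ℝ} (hη : 0 < η) (hη1 : η < 1) (hT₀ : 0 < T₀) (hT : T₀ ≤ T) :
    intervalBound η T ≤ (1 + (8 / (1 - η) + 4 / η) * T₀ ^ (-η)) * T := by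
  have hη2 : 0 < 1 - η := by linarith
  have hT0 : 0 < T := hT₀.trans_le hT
  have h1 : T ^ (1 - η) ≤ T₀ ^ (-η) * T := by
    rw [sub_eq_neg_add, Real.rpow_add hT0, Real.rpow_one]
    gcongr ?_ * _
    exact Real.rpow_le_rpow_of_nonpos hT₀ hT (by linarith)
  calc T + (8 / (1 - η) + 4 / η) * T ^ (1 - η)
      ≤ T + (8 / (1 - η) + 4 / η) * (T₀ ^ (-η) * T) := by gcongr
    _ = _ := by ring

theorem intervalBound_le_rpow {η δ : ℝ} (hη : 0 < η) (hδ : 0 < δ) (hδ1 : δ ≤ 1) :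
    intervalBound η δ ≤ (1 + (8 / (1 - η) + 4 / η)) * δ ^ (1 - η) := by
  have h1 : δ ≤ δ ^ (1 - η) := by
    conv_lhs => rw [← Real.rpow_one δ]
    exact Real.rpow_le_rpow_of_exponent_ge hδ hδ1 (by linarith)
  calc δ + (8 / (1 - η) + 4 / η) * δ ^ (1 - η)
      ≤ δ ^ (1 - η) + (8 / (1 - η) + 4 / η) * δ ^ (1 - η) := by gcongr
    _ = _ := by ring

theorem sq_mul_rpow_eq {p T : ℝ} (hp : 1 ≤ p) (hT : 0 < T) :
    T ^ 2 * T ^ ((p - 1) / p) = T ^ ((3 * p - 1) / p) := by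
  rw [← Real.rpow_natCast T 2, ← Real.rpow_add hT]
  congr 1
  field_simp
  push_cast
  ring

/-- The kernel error enters with the factor `T ^ 2`; the part `T ^ 2 * δ * H` of it is absorbed by
`T * δ ^ (1 - η)` once `T * H * δ ^ η ≤ 1`. -/
theorem sq_mul_kernelError_le {η p T V H δ : ℝ} (hp : 1 ≤ p) (hT : 0 < T) (hδ : 0 < δ)
    (hsmall : T * H * δ ^ η ≤ 1) :
    T ^ 2 * (2 * (V * T ^ ((p - 1) / p) * δ ^ (1 / p)) + δ * H)
      ≤ 2 * (V * T ^ ((3 * p - 1) / p) * δ ^ (1 / p)) + T * δ ^ (1 - η) := by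
  have h1 : T ^ 2 * (δ * H) ≤ T * δ ^ (1 - η) := by
    have h2 : δ = δ ^ (1 - η) * δ ^ η := by
      rw [← Real.rpow_add hδ, sub_add_cancel, Real.rpow_one]
    calc T ^ 2 * (δ * H) = T * δ ^ (1 - η) * (T * H * δ ^ η) := by
          conv_lhs => rw [h2]
          ring
      _ ≤ T * δ ^ (1 - η) * 1 := by gcongr
      _ = _ := mul_one _
  rw [← sq_mul_rpow_eq hp hT]
  linarith

theorem exists_rpow_mul_le {η c : ℝ} (hη : 0 < η) (hc : 0 ≤ c) :
    ∃ δ₀ : ℝ, 0 < δ₀ ∧ ∀ δ : ℝ, 0 < δ → δ ≤ δ₀ → c * δ ^ η ≤ 1 := by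
  refine ⟨(1 / (c + 1)) ^ (1 / η), by positivity, fun δ hδ hδ₀ => ?_⟩
  have h1 : δ ^ η ≤ 1 / (c + 1) := by
    calc δ ^ η ≤ ((1 / (c + 1)) ^ (1 / η)) ^ η := by gcongr
      _ = 1 / (c + 1) := by
        rw [← Real.rpow_mul (by positivity), one_div_mul_cancel hη.ne', Real.rpow_one]
  calc c * δ ^ η ≤ c * (1 / (c + 1)) := by gcongr
    _ ≤ 1 := by
      rw [mul_one_div, div_le_one (by positivity)]
      linarith

/-- The estimate in the fractional Sobolev norm for a kernel that is measurable and bounded on the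
whole line. -/
theorem exists_sobolev_const_of_measurable (L : ℝ≥0) (ψ b : ℝ → ℝ) (ν : Measure ℝ)
    [IsProbabilityMeasure ν] (hψ : LipschitzWith L ψ) (hψ0 : ∀ x, 0 ≤ ψ x) (hb : Measurable b)
    (hb0 : ∀ y, 0 ≤ b y) (hbi : Integrable b ν) (hYi : Integrable (fun y : ℝ => y) ν)
    {r η T₀ : ℝ} (hr : r < 1) (hη : 0 < η) (hη1 : η < 1) (hT₀ : 0 < T₀) :
    ∃ K : ℝ, 0 < K ∧ ∀ (T p H : ℝ) (h : ℝ → ℝ), T₀ ≤ T → 1 ≤ p → Measurable h →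
      (∀ x, |h x| ≤ H) → rho L h b ν T ≤ r → ePVar p h T ≠ ⊤ →
      ∃ Δ₀ : ℝ, 0 < Δ₀ ∧ ∀ M : ℕ, 1 ≤ M → T / M ≤ Δ₀ →
        ∀ (Ω : Type*) [MeasurableSpace Ω] (μ : Measure Ω) [IsProbabilityMeasure μ]
          (P : Kernel Ω State) (lam : ℝ≥0 → Ω → ℝ),
          IsPoissonRandomMeasure P ν μ → IsHawkesIntensity P μ h ψ b T lam →
          ∫⁻ ω, sobolevNorm η T
              (fun t => risk P lam t ω - discRisk P h ψ b (T / M) t ω) ∂μ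
            ≤ ENNReal.ofReal (K * (pVarNorm p h T * T ^ ((3 * p - 1) / p) * (T / M) ^ (1 / p)
              + T * (T / M) ^ (1 - η))) := by
  -- The discrete stability constant only converges to the continuous one, so both are compared with
  -- a number `ρ` strictly between `r` and `1`.
  obtain ⟨ρ, hρr, hρ1⟩ := exists_between (max_lt hr one_pos)
  have hrρ : r < ρ := (le_max_left _ _).trans_lt hρr
  have hρ0 : 0 ≤ ρ := ((le_max_right _ _).trans_lt hρr).le
  have hρ2 : 0 < 1 - ρ := by linarith
  have hη2 : 0 < 1 - η := by linarith
  have hψ00 := hψ0 0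
  have hmb0 : 0 ≤ ∫ y, b y ∂ν := integral_nonneg hb0
  have hm0 : 0 ≤ ∫ y, |y| ∂ν := integral_nonneg fun y => abs_nonneg y
  set c : ℝ := 8 / (1 - η) + 4 / η with hc
  have hc0 : 0 ≤ c := by positivity
  set A : ℝ := ψ 0 / (1 - ρ) with hA
  have hA0 : 0 ≤ A := by positivity
  set K₁ : ℝ := (∫ y, |y| ∂ν) * (1 + c * T₀ ^ (-η)) * (L * A * (∫ y, b y ∂ν) / (1 - ρ)) with hK₁
  set K₂ : ℝ := (∫ y, |y| ∂ν) * (1 + c) * A with hK₂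
  have hK₁0 : 0 ≤ K₁ := by positivity
  have hK₂0 : 0 ≤ K₂ := by positivity
  refine ⟨2 * K₁ + K₂ + 1, by positivity, fun T p H h hT hp hh hH hρ hV => ?_⟩
  have hT0 : 0 < T := hT₀.trans_le hT
  have hH0 : 0 ≤ H := (abs_nonneg _).trans (hH 0)
  obtain ⟨Δ₁, hΔ₁, hdisc⟩ := exists_rhoDisc_lt L ν hb0 hp hT0 hV (hρ.trans_lt hrρ)
  obtain ⟨Δ₂, hΔ₂, hsmall⟩ := exists_rpow_mul_le hη (show 0 ≤ T * H by positivity)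
  refine ⟨min (min Δ₁ Δ₂) 1, by positivity, fun M hM hMΔ Ω _ μ _ P lam hP hl => ?_⟩
  have hM0 : (0 : ℝ) < M := by exact_mod_cast hM
  set δ := T / M with hδ
  have hδ0 : 0 < δ := by positivity
  have hδ1 : δ ≤ 1 := hMΔ.trans (min_le_right _ _)
  refine (hl.lintegral_sobolevNorm_le hP hψ hψ0 hb hb0 hbi hYi hη hη1 hT0 hp hh hH hV hρ0 hρ1
    (hρ.trans hrρ.le) hM
    (hdisc M hM (hMΔ.trans ((min_le_left _ _).trans (min_le_left _ _)))).le).trans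
    (ENNReal.ofReal_le_ofReal ?_)
  have e1 := sq_mul_kernelError_le (V := pVarNorm p h T) hp hT0 hδ0
    (hsmall δ hδ0 (hMΔ.trans ((min_le_left _ _).trans (min_le_right _ _))))
  have e2 := intervalBound_le_mul hη hη1 hT₀ hT
  have e3 := intervalBound_le_rpow hη hδ0 hδ1
  have hV0 := pVarNorm_nonneg p h T
  rw [← hδ]
  set Γ := 2 * (pVarNorm p h T * T ^ ((p - 1) / p) * δ ^ (1 / p)) + δ * H with hΓ
  have hΓ0 : 0 ≤ Γ := by positivity
  set a := pVarNorm p h T * T ^ ((3 * p - 1) / p) * δ ^ (1 / p) with ha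
  have ha0 : 0 ≤ a := by positivity
  have hd0 : 0 ≤ T * δ ^ (1 - η) := by positivity
  calc T * (∫ y, |y| ∂ν) * (intervalBound η T * (L * (Γ * A * ∫ y, b y ∂ν) / (1 - ρ))
        + intervalBound η δ * A)
      ≤ T * (∫ y, |y| ∂ν) * ((1 + c * T₀ ^ (-η)) * T * (L * (Γ * A * ∫ y, b y ∂ν) / (1 - ρ))
        + (1 + c) * δ ^ (1 - η) * A) := by gcongr
    _ = K₁ * (T ^ 2 * Γ) + K₂ * (T * δ ^ (1 - η)) := by
        rw [hK₁, hK₂]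
        ring
    _ ≤ K₁ * (2 * a + T * δ ^ (1 - η)) + K₂ * (T * δ ^ (1 - η)) := by gcongr
    _ ≤ (2 * K₁ + K₂ + 1) * (a + T * δ ^ (1 - η)) := by
        have q1 := mul_nonneg hK₁0 hd0
        have q2 := mul_nonneg hK₂0 ha0
        linear_combination q1 + q2 + ha0 + hd0

end HawkesRisk

theorem mainTheorem2
    (L : ℝ≥0) (ψ b : ℝ → ℝ) (ν : Measure ℝ) [IsProbabilityMeasure ν]
    (hψ : LipschitzWith L ψ) (hψ_nonneg : ∀ x, 0 ≤ ψ x)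
    (hb : Measurable b) (hb_nonneg : ∀ y, 0 ≤ b y)
    (hb_int : Integrable b ν) (hY_int : Integrable (fun y : ℝ => y) ν) :
    (∃ K : ℝ, 0 < K ∧
      ∀ (T p : ℝ) (h : ℝ → ℝ), 0 < T → 1 ≤ p → IntegrableOn h (Icc 0 T) →
        HawkesRisk.rho L h b ν T < 1 → HawkesRisk.ePVar p h T ≠ ⊤ →
        Tendsto (fun Δ : ℝ => ∫ t in (0 : ℝ)..(T - Δ), |h t - h (HawkesRisk.gridProj Δ t + Δ)|)
          (𝓝[>] 0) (𝓝 0) ∧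
        ∃ Δ₀ : ℝ, 0 < Δ₀ ∧ ∀ M : ℕ, 1 ≤ M → T / M ≤ Δ₀ →
          HawkesRisk.rhoDisc L h b ν T M < 1 ∧
          HawkesRisk.CR h T (T / M) ≤
            K * (HawkesRisk.pVarNorm p h T * T ^ ((p - 1) / p) * (T / M) ^ (1 / p)
              + (T / M) * HawkesRisk.supNorm h T)) ∧
    (∀ r η T₀ : ℝ, r < 1 → 0 < η → η < 1 → 0 < T₀ →
      ∃ K : ℝ, 0 < K ∧
      ∀ (T p : ℝ) (h : ℝ → ℝ), T₀ ≤ T → 1 ≤ p → IntegrableOn h (Icc 0 T) →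
        HawkesRisk.rho L h b ν T ≤ r → HawkesRisk.ePVar p h T ≠ ⊤ →
        ∃ Δ₀ : ℝ, 0 < Δ₀ ∧ ∀ M : ℕ, 1 ≤ M → T / M ≤ Δ₀ →
          ∀ (Ω : Type*) [MeasurableSpace Ω] (μ : Measure Ω) [IsProbabilityMeasure μ]
            (P : Kernel Ω HawkesRisk.State) (lam : ℝ≥0 → Ω → ℝ),
            HawkesRisk.IsPoissonRandomMeasure P ν μ →
            HawkesRisk.IsHawkesIntensity P μ h ψ b T lam →
            ∫⁻ ω, HawkesRisk.sobolevNorm η T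
                (fun t => HawkesRisk.risk P lam t ω
                  - HawkesRisk.discRisk P h ψ b (T / M) t ω) ∂μ
              ≤ ENNReal.ofReal (K *
                (HawkesRisk.pVarNorm p h T * T ^ ((3 * p - 1) / p) * (T / M) ^ (1 / p)
                  + T * (T / M) ^ (1 - η)
                  + (T / M) * HawkesRisk.supNorm h T))) := by
  refine ⟨⟨2, two_pos, fun T p h hT hp _ hρ hV => ⟨HawkesRisk.tendsto_integral_grid hp hT hV, ?_⟩⟩,
    fun r η T₀ hr hη hη1 hT₀ => ?_⟩
  · obtain ⟨Δ₀, hΔ₀, hdisc⟩ := HawkesRisk.exists_rhoDisc_lt L ν hb_nonneg hp hT hV hρ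
    refine ⟨Δ₀, hΔ₀, fun M hM hMΔ => ⟨hdisc M hM hMΔ, ?_⟩⟩
    have hM1 : (1 : ℝ) ≤ M := by exact_mod_cast hM
    exact HawkesRisk.CR_le hp hV (by positivity) (div_le_self hT.le hM1)
  · obtain ⟨K, hK, hmain⟩ := HawkesRisk.exists_sobolev_const_of_measurable L ψ b ν hψ hψ_nonneg hb
      hb_nonneg hb_int hY_int hr hη hη1 hT₀
    refine ⟨K, hK, fun T p h hT hp _ hρ hV => ?_⟩
    have hT0 : 0 < T := hT₀.trans_le hT
    -- The kernel matters on `[0, T]` only, so it may be replaced by a bounded measurable one.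
    have heq : EqOn h ((Icc 0 T).indicator h) (Icc 0 T) := fun t ht =>
      (indicator_of_mem ht h).symm
    have hbd : ∀ x, |(Icc 0 T).indicator h x| ≤ HawkesRisk.supNorm h T := by
      intro x
      by_cases hx : x ∈ Icc 0 T
      · rw [indicator_of_mem hx]
        exact HawkesRisk.abs_le_supNorm hp hT0.le hV hx
      · rw [indicator_of_notMem hx, abs_zero]
        exact HawkesRisk.supNorm_nonneg h T
    have hVeq := HawkesRisk.ePVar_congr (p := p) heq
    obtain ⟨Δ₀, hΔ₀, hbound⟩ := hmain T p (HawkesRisk.supNorm h T) ((Icc 0 T).indicator h) hT hp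
      (HawkesRisk.measurable_indicator_of_ePVar hp hT0.le hV) hbd
      (by rwa [← HawkesRisk.rho_congr heq]) (by rwa [← hVeq])
    refine ⟨Δ₀, hΔ₀, fun M hM hMΔ Ω _ μ _ P lam hP hl => ?_⟩
    have hM0 : (0 : ℝ) < M := by exact_mod_cast hM
    have hδ0 : 0 < T / M := by positivity
    have hsob : ∀ ω, HawkesRisk.sobolevNorm η T
          (fun t => HawkesRisk.risk P lam t ω - HawkesRisk.discRisk P h ψ b (T / M) t ω)
        = HawkesRisk.sobolevNorm η T (fun t => HawkesRisk.risk P lam t ω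
          - HawkesRisk.discRisk P ((Icc 0 T).indicator h) ψ b (T / M) t ω) := fun ω =>
      HawkesRisk.sobolevNorm_congr fun t ht => by
        simp only [HawkesRisk.discRisk_congr ψ b hδ0 heq ω ht]
    rw [lintegral_congr hsob]
    refine (hbound M hM hMΔ Ω μ P lam hP (hl.congr_kernel heq)).trans
      (ENNReal.ofReal_le_ofReal ?_)
    have hS := HawkesRisk.supNorm_nonneg h T
    rw [HawkesRisk.pVarNorm, HawkesRisk.pVarNorm, hVeq]
    exact mul_le_mul_of_nonneg_left (le_add_of_nonneg_right (by positivity)) hK.le
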